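/- Let $q$ be a power of an odd prime, $\theta$ a generator of $\mathbb F_{q^2}^\times$, $\gamma=\theta^{q+1}$ (a generator of $\mathbb F_q^\times$), $\eta=\theta^{q-1}$, $\gamma^{1/2}=\theta^{(q+1)/2}$. Let $J$ be the $4\times4$ matrix with $J_{14}=J_{23}=1$, $J_{32}=J_{41}=-1$ and all other entries $0$, and $G=\mathrm{GSp}(4,\mathbb F_q)=\{g\in\mathrm{GL}(4,\mathbb F_q): {}^tgJg=\lambda(g)J,\ \lambda(g)\in\mathbb F_q^\times\}$. Let $B$ (Borel), $P$ (Siegel), $Q$ (Klingen) be the subgroups of block upper triangular matrices in $G$ with diagonal blocks of sizes $(1,1,1,1)$, $(2,2)$, $(1,2,1)$. Let $\chi_1,\chi_2,\chi,\sigma$ be characters $\mathbb F_q^\times\to\mathbb C^\times$ and $(\pi,V)$ an irreducible complex representation of $\mathrm{GL}(2,\mathbb F_q)$ with character $\chi_\pi$. Define representations of $G$, acting by right translation on functions $f$ on $G$ with $f(hg)=\rho(h)f(g)$ for all $h$ in the subgroup: - $\chi_1\times\chi_2\rtimes\sigma$: subgroup $B$, $\rho(h)=\chi_1(h_{11})\chi_2(h_{22})\sigma(\lambda(h))$,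 $f$ with values in $\mathbb C$; - $\pi\rtimes\sigma$: subgroup $P$, $\rho(h)=\sigma(\lambda(h))\pi(A)$, $A$ the upper left $2\times2$ block, $f$ with values in $V$; - $\chi\rtimes\pi$: subgroup $Q$, $\rho(h)=\chi(h_{11})\pi(A)$, $A$ the middle $2\times2$ block, $f$ with values in $V$. **Notation.** In $\mathrm{GL}(2,\mathbb F_q)$ write $[a,b]=\mathrm{diag}(a,b)$ and $[a]^+=\begin{pmatrix}a&1\\0&a\end{pmatrix}$; for $x\in\mathbb F_{q^2}^\times$ let $[x,x^q]$ be $\begin{pmatrix}0&-x^{q+1}\\1&x+x^q\end{pmatrix}$, which has eigenvalues $x,x^q$. Put $e_k=[\gamma^{k+1/2},-\gamma^{k+1/2}]$, $t_{k,i}=[\gamma^k\theta^i,\gamma^k\theta^{qi}]$, $h_{k,i}=[\gamma^k\eta^i,\gamma^k\eta^{-i}]$ (all of the form $[x,x^q]$). In $G$ put $m(A,c)=\mathrm{diag}(A,cA')$ with $A'=w\,{}^tA^{-1}w$, $w=\begin{pmatrix}0&1\\1&0\end{pmatrix}$; $\ell(t,A)=\mathrm{diag}(t,A,t^{-1}\det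 A)$; and $n(\mu,\kappa,x)=\begin{pmatrix}1_2&S\\0&1_2\end{pmatrix}$ with $S=\begin{pmatrix}\mu&\kappa\\x&\mu\end{pmatrix}$. **Classes.** For integers $i,j,k$ consider the conjugacy classes of $G$ with these representatives. - $A_1(k)$: $m([\gamma^k,\gamma^k],\gamma^{2k})=\gamma^k 1_4$; $A_2(k)$: $\gamma^k n(0,1,0)$; $A_{31}(k)$: $\gamma^k n(0,1,-1)$; $A_{32}(k)$: $\gamma^k n(0,1,-\gamma)$; $A_5(k)$: $m([\gamma^k]^+,\gamma^{2k})n(0,0,1)$. - $B_{11}(k)$: $m([\gamma^k,-\gamma^k],\gamma^{2k})$; $B_3(k)$, $B_{41}(k)$, $B_{42}(k)$: the representative of $B_{11}(k)$ times $n(0,0,1)$, $n(0,1,1)$, $n(0,1,\gamma)$ respectively. - $B_{12}(k)$: $m(e_k,\gamma^{2k+1})$; $B_{43}(k)$: $m(e_k,\gamma^{2k+1})n(1,0,0)$; $B_{44}(k)$: $m(e_k,\gamma^{2k+1})n(a,b\gamma^{2k+1},b)$ for any $a,b\in\mathbb F_q$ with $a^2-b^2\gamma^{2k+1}$ not a square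 in $\mathbb F_q$. - $B_{21}(k)$: $m([\gamma^k,\gamma^k],-\gamma^{2k})$; $B_{51}(k)$: $m([\gamma^k]^+,-\gamma^{2k})$; $B_{22}(k)$: $m(e_k,-\gamma^{2k+1})$; $B_{52}(k)$: $m(e_k,-\gamma^{2k+1})n(0,0,1)$. - For $\gamma^i\ne\pm1$: $C_1(i,k)$: $m([\gamma^k,\gamma^k],\gamma^{2k+i})$; $C_{21}(i,k)$: $m([\gamma^k,-\gamma^k],-\gamma^{2k+i})$; $C_{22}(i,k)$: $m(e_k,-\gamma^{2k+i+1})$; $C_3(i,k)$: $m([\gamma^k]^+,\gamma^{2k+i})$; $C_4(i,k)$: $\ell(\gamma^{k+i},[\gamma^k]^+)$; $C_5(i,k)$: $\ell(\gamma^{k+i},[\gamma^k,\gamma^k])$. - For $\gamma^i,\gamma^j\ne\pm1$, $\gamma^i\neq\gamma^{j}$, $\gamma^{i+j}\ne1$: $C_6(i,j,k)$: $m([\gamma^k,\gamma^{k+i}],\gamma^{2k+i+j})$. - For $\eta^i\ne1$, $\gamma^i\ne1$: $D_1(i,k)$: $\ell(\gamma^k,t_{k,i})$. - For $\eta^i\ne\pm1$: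 $D_2(i,k)$: $m(t_{k,i},\gamma^{2k+i})$; $D_{31}(i,k)$: $m(t_{k,i},-\gamma^{2k+i})$; $D_5(i,k)$: $m(t_{k,i},\gamma^{2k+i})n(0,0,1)$; $D_6(i,k)$: $\ell(\gamma^k,h_{k,i})$; $D_8(i,k)$: $\ell(\gamma^k,h_{k,i})n(0,1,0)$; and, if also $\gamma^j\ne\pm1$, $D_4(i,j,k)$: $m(t_{k,i},\gamma^{2k+i+j})$. Then the characters of the three induced representations have the following values, and each of them is $0$ at every $g\in G$ that lies in none of the classes listed for it. **$\chi_1\times\chi_2\rtimes\sigma$.** The value is $\chi_1(\gamma^k)\chi_2(\gamma^k)$ times: - $A_1$: $(q^2+1)(q+1)^2\sigma(\gamma^{2k})$; $A_2$: $(q+1)^2\sigma(\gamma^{2k})$; $A_{31}$: $(3q+1)\sigma(\gamma^{2k})$; $A_{32}$: $(q+1)\sigma(\gamma^{2k})$; $A_5$: $\sigma(\gamma^{2k})$. - $B_{11}$, $B_3$, $B_{41}$, $B_{42}$: $\epsilon\,\sigma(\gamma^{2k})(\chi_1(-1)+\chi_2(-1))$ with $\epsilon=(q+1)^2$, $q+1$,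 $1$, $1$ respectively. - $B_{21}$, $B_{51}$: $\epsilon\,\sigma(-\gamma^{2k})(1+\chi_1(-1)\chi_2(-1)+\chi_1(-1)+\chi_2(-1))$ with $\epsilon=q+1$, $1$ respectively. - $C_1$, $C_3$: $\epsilon\,\sigma(\gamma^{2k+i})(1+\chi_1(\gamma^i)\chi_2(\gamma^i)+\chi_1(\gamma^i)+\chi_2(\gamma^i))$ with $\epsilon=q+1$, $1$ respectively. - $C_{21}$: $\sigma(-\gamma^{2k+i})\bigl(\chi_1(-1)+\chi_2(-1)+\chi_1(-1)\chi_2(-1)(\chi_1(\gamma^i)+\chi_2(\gamma^i))+(\chi_1(-1)+\chi_2(-1))\chi_1(\gamma^i)\chi_2(\gamma^i)+\chi_1(\gamma^i)+\chi_2(\gamma^i)\bigr)$. - $C_4$, $C_5$: $\epsilon\,\sigma(\gamma^{2k})(\chi_1(\gamma^i)+\chi_1(\gamma^{-i})+\chi_2(\gamma^i)+\chi_2(\gamma^{-i}))$ with $\epsilon=1$, $q+1$ respectively. - $C_6$: $\sigma(\gamma^{2k+i+j})\bigl(\chi_1(\gamma^i)+\chi_1(\gamma^j)+\chi_2(\gamma^i)+\chi_2(\gamma^j)+\chi_1(\gamma^{i+j})(\chi_2(\gamma^i)+\chi_2(\gamma^j))+\chi_2(\gamma^{i+j})(\chi_1(\gamma^i)+\chi_1(\gamma^j))\bigr)$.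 **$\pi\rtimes\sigma$.** - $A_1$: $(q^2+1)(q+1)\sigma(\gamma^{2k})\chi_\pi([\gamma^k,\gamma^k])$; $A_2$: $(q+1)\sigma(\gamma^{2k})\chi_\pi([\gamma^k,\gamma^k])$; $A_{31}$: $\sigma(\gamma^{2k})\bigl(\chi_\pi([\gamma^k,\gamma^k])+2q\chi_\pi([\gamma^k]^+)\bigr)$; $A_{32}$: $\sigma(\gamma^{2k})\chi_\pi([\gamma^k,\gamma^k])$; $A_5$: $\sigma(\gamma^{2k})\chi_\pi([\gamma^k]^+)$. - $B_{11}$, $B_3$, $B_{41}$, $B_{42}$: $\epsilon\,\sigma(\gamma^{2k})\chi_\pi([\gamma^k,-\gamma^k])$ with $\epsilon=(q+1)^2$, $q+1$, $1$, $1$ respectively. - $B_{12}$, $B_{43}$, $B_{44}$: $\epsilon\,\sigma(\gamma^{2k+1})\chi_\pi(e_k)$ with $\epsilon=q^2+1$, $1$, $1$ respectively; $B_{22}$, $B_{52}$: $\epsilon\,\sigma(-\gamma^{2k+1})\chi_\pi(e_k)$ with $\epsilon=q+1$, $1$ respectively. - $B_{21}$: $\sigma(-\gamma^{2k})\bigl(\chi_\pi([\gamma^k,\gamma^k])+\chi_\pi([-\gamma^k,-\gamma^k])+(q+1)\chi_\pi([\gamma^k,-\gamma^k])\bigr)$;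 $B_{51}$: $\sigma(-\gamma^{2k})\bigl(\chi_\pi([\gamma^k,-\gamma^k])+\chi_\pi([\gamma^k]^+)+\chi_\pi([-\gamma^k]^+)\bigr)$. - $C_1$: $\sigma(\gamma^{2k+i})\bigl(\chi_\pi([\gamma^k,\gamma^k])+\chi_\pi([\gamma^{k+i},\gamma^{k+i}])+(q+1)\chi_\pi([\gamma^k,\gamma^{k+i}])\bigr)$; $C_3$: $\sigma(\gamma^{2k+i})\bigl(\chi_\pi([\gamma^k]^+)+\chi_\pi([\gamma^{k+i}]^+)+\chi_\pi([\gamma^k,\gamma^{k+i}])\bigr)$. - $C_{21}$: $\sigma(-\gamma^{2k+i})\bigl(\chi_\pi([\gamma^k,-\gamma^k])+\chi_\pi([\gamma^{k+i},-\gamma^{k+i}])+\chi_\pi([\gamma^k,\gamma^{k+i}])+\chi_\pi([-\gamma^k,-\gamma^{k+i}])\bigr)$; $C_{22}$: $\sigma(-\gamma^{2k+i+1})\bigl(\chi_\pi(e_k)+\chi_\pi(e_{k+i})\bigr)$. - $C_4$, $C_5$: $\epsilon\,\sigma(\gamma^{2k})\bigl(\chi_\pi([\gamma^k,\gamma^{k+i}])+\chi_\pi([\gamma^k,\gamma^{k-i}])\bigr)$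 with $\epsilon=1$, $q+1$ respectively. - $C_6$: $\sigma(\gamma^{2k+i+j})\bigl(\chi_\pi([\gamma^k,\gamma^{k+i}])+\chi_\pi([\gamma^k,\gamma^{k+j}])+\chi_\pi([\gamma^{k+i},\gamma^{k+i+j}])+\chi_\pi([\gamma^{k+j},\gamma^{k+i+j}])\bigr)$. - $D_2$, $D_5$: $\epsilon\,\sigma(\gamma^{2k+i})\chi_\pi(t_{k,i})$ with $\epsilon=q+1$, $1$ respectively; $D_{31}$: $\sigma(-\gamma^{2k+i})\bigl(\chi_\pi(t_{k,i})+\chi_\pi([-\gamma^k\theta^i,-\gamma^k\theta^{qi}])\bigr)$; $D_4$: $\sigma(\gamma^{2k+i+j})\bigl(\chi_\pi(t_{k,i})+\chi_\pi(t_{k+j,i})\bigr)$. The classes $D_1,D_6,D_8$ are not listed here. **$\chi\rtimes\pi$.** The value is $\chi(\gamma^k)$ times: - $A_1$: $(q^2+1)(q+1)\chi_\pi([\gamma^k,\gamma^k])$; $A_2$: $\chi_\pi([\gamma^k,\gamma^k])+q(q+1)\chi_\pi([\gamma^k]^+)$; $A_{31}$: $2\bigl(\chi_\pi([\gamma^k,\gamma^k])+\frac{q-1}{2}\chi_\pi([\gamma^k]^+)\bigr)$;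 $A_{32}$: $(q+1)\chi_\pi([\gamma^k]^+)$; $A_5$: $\chi_\pi([\gamma^k]^+)$. - $B_{11}$: $(q+1)\bigl(\chi(-1)\chi_\pi([\gamma^k,\gamma^k])+\chi_\pi([-\gamma^k,-\gamma^k])\bigr)$; $B_3$: $\chi(-1)\chi_\pi([\gamma^k,\gamma^k])+(q+1)\chi_\pi([-\gamma^k]^+)$; $B_{41}$, $B_{42}$: $\chi(-1)\chi_\pi([\gamma^k]^+)+\chi_\pi([-\gamma^k]^+)$; $B_{21}$, $B_{51}$: $\epsilon(1+\chi(-1))\chi_\pi([\gamma^k,-\gamma^k])$ with $\epsilon=q+1$, $1$ respectively. - $C_1$, $C_3$: $\epsilon(1+\chi(\gamma^i))\chi_\pi([\gamma^k,\gamma^{k+i}])$ with $\epsilon=q+1$, $1$ respectively; $C_{21}$: $(\chi(\gamma^i)+\chi(-1))\chi_\pi([\gamma^k,-\gamma^{k+i}])+(1+\chi(-\gamma^i))\chi_\pi([-\gamma^k,\gamma^{k+i}])$. - $C_4$: $(\chi(\gamma^i)+\chi(\gamma^{-i}))\chi_\pi([\gamma^k]^+)+\chi_\pi([\gamma^{k+i},\gamma^{k-i}])$;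 $C_5$: $(\chi(\gamma^i)+\chi(\gamma^{-i}))\chi_\pi([\gamma^k,\gamma^k])+(q+1)\chi_\pi([\gamma^{k+i},\gamma^{k-i}])$. - $C_6$: $(1+\chi(\gamma^{i+j}))\chi_\pi([\gamma^{k+i},\gamma^{k+j}])+(\chi(\gamma^i)+\chi(\gamma^j))\chi_\pi([\gamma^k,\gamma^{k+i+j}])$. - $D_1$: $(1+\chi(\gamma^i))\chi_\pi(t_{k,i})$; $D_6$: $(q+1)\chi_\pi(h_{k,i})$; $D_8$: $\chi_\pi(h_{k,i})$. -/

import Mathlib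

open Matrix

noncomputable section

namespace GSpFour

variable {F : Type*} [Field F]

/-! ### The group `GSp(4, F)` -/

/-- The alternating form defining `GSp(4)`. -/
def J (F : Type*) [Field F] : Matrix (Fin 4) (Fin 4) F :=
  !![0, 0, 0, 1; 0, 0, 1, 0; 0, -1, 0, 0; -1, 0, 0, 0]

theorem J_mul_J : J F * J F = -1 := by
  ext i j
  fin_cases i <;> fin_cases j <;> simp [J, Matrix.mul_apply, Fin.sum_univ_four]

theorem J_ne_zero : J F ≠ 0 := fun h => by
  have := congrFun (congrFun h 0) 3
  simp [J] at this

theorem mul_J_mul {M N : Matrix (Fin 4) (Fin 4) F} {c d : F}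
    (hM : Mᵀ * J F * M = c • J F) (hN : Nᵀ * J F * N = d • J F) :
    (M * N)ᵀ * J F * (M * N) = (c * d) • J F := by
  calc (M * N)ᵀ * J F * (M * N) = Nᵀ * (Mᵀ * J F * M) * N := by
        simp only [Matrix.transpose_mul, Matrix.mul_assoc]
    _ = (c * d) • J F := by
        rw [hM, Matrix.mul_smul, Matrix.smul_mul, hN, smul_smul]

/-- `GSp(4, F)`, the group of all `g` in `GL(4, F)` with `ᵗg J g = c J` for some `c` in `Fˣ`. -/
def GSp4 (F : Type*) [Field F] : Subgroup (GL (Fin 4) F) where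
  carrier := {g | ∃ c : Fˣ, (g : Matrix (Fin 4) (Fin 4) F)ᵀ * J F * g = (c : F) • J F}
  mul_mem' := by
    rintro g h ⟨c, hc⟩ ⟨d, hd⟩
    exact ⟨c * d, by simpa using mul_J_mul hc hd⟩
  one_mem' := ⟨1, by simp⟩
  inv_mem' := by
    rintro g ⟨c, hc⟩
    refine ⟨c⁻¹, ?_⟩
    have h1 : (g : Matrix (Fin 4) (Fin 4) F) * (g⁻¹ : GL (Fin 4) F) = 1 := by
      rw [← Units.val_mul, mul_inv_cancel, Units.val_one]
    have h2 : ((g⁻¹ : GL (Fin 4) F) : Matrix (Fin 4) (Fin 4) F)ᵀ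
        * (g : Matrix (Fin 4) (Fin 4) F)ᵀ = 1 := by
      rw [← Matrix.transpose_mul, h1, Matrix.transpose_one]
    have h3 : J F = (c : F)⁻¹ • ((g : Matrix (Fin 4) (Fin 4) F)ᵀ * J F * g) := by
      rw [hc, smul_smul, inv_mul_cancel₀ c.ne_zero, one_smul]
    calc _ = ((g⁻¹ : GL (Fin 4) F) : Matrix (Fin 4) (Fin 4) F)ᵀ
          * ((c : F)⁻¹ • ((g : Matrix (Fin 4) (Fin 4) F)ᵀ * J F * g))
          * (g⁻¹ : GL (Fin 4) F) := by rw [← h3]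
      _ = (c : F)⁻¹ • ((((g⁻¹ : GL (Fin 4) F) : Matrix (Fin 4) (Fin 4) F)ᵀ
          * (g : Matrix (Fin 4) (Fin 4) F)ᵀ) * J F
          * ((g : Matrix (Fin 4) (Fin 4) F) * (g⁻¹ : GL (Fin 4) F))) := by
        simp only [Matrix.mul_smul, Matrix.smul_mul, Matrix.mul_assoc]
      _ = _ := by rw [h1, h2]; simp

/-- The underlying matrix of an element of `GSp(4, F)`. -/
abbrev mat (g : GSp4 F) : Matrix (Fin 4) (Fin 4) F := ((g : GL (Fin 4) F) : Matrix _ _ F)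

theorem mat_mul (g h : GSp4 F) : mat (g * h) = mat g * mat h := rfl

theorem mat_one : mat (1 : GSp4 F) = 1 := rfl

/-- The multiplier as an element of `F`: the scalar `c` with `ᵗg J g = c J`, which is the
upper right entry of `ᵗg J g`. -/
def multiplierVal (g : GSp4 F) : F := ((mat g)ᵀ * J F * mat g) 0 3

theorem multiplierVal_spec (g : GSp4 F) :
    (mat g)ᵀ * J F * mat g = multiplierVal g • J F := by
  obtain ⟨c, hc⟩ := g.2
  have : multiplierVal g = c := by
    rw [multiplierVal, hc]; simp [J]
  rw [this, hc]

/-- The multiplier homomorphism `GSp(4, F) → Fˣ`. -/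
def multiplier : GSp4 F →* Fˣ :=
  MonoidHom.toHomUnits
    { toFun := multiplierVal
      map_one' := by simp [multiplierVal, mat_one, J]
      map_mul' := fun g h => by
        have := mul_J_mul (multiplierVal_spec g) (multiplierVal_spec h)
        rw [← mat_mul, multiplierVal_spec (g * h)] at this
        simpa [J] using congrFun (congrFun this 0) 3 }

/-- An element of `GSp(4, F)` from a matrix `M` with `ᵗM J M = c J`, `c` in `Fˣ`. -/
def ofMatrix (M : Matrix (Fin 4) (Fin 4) F) (c : Fˣ) (h : Mᵀ * J F * M = (c : F) • J F) :
    GSp4 F :=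
  ⟨⟨M, -((c : F)⁻¹ • (J F * Mᵀ * J F)), by
      have h1 : (-((c : F)⁻¹ • (J F * Mᵀ * J F))) * M = 1 := by
        calc (-((c : F)⁻¹ • (J F * Mᵀ * J F))) * M
            = -((c : F)⁻¹ • (J F * (Mᵀ * J F * M))) := by
              simp only [Matrix.neg_mul, Matrix.smul_mul, Matrix.mul_assoc]
          _ = 1 := by
              rw [h, Matrix.mul_smul, smul_smul, inv_mul_cancel₀ c.ne_zero, one_smul, J_mul_J,
                neg_neg]
      exact mul_eq_one_comm.mp h1, by
      calc (-((c : F)⁻¹ • (J F * Mᵀ * J F))) * M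
            = -((c : F)⁻¹ • (J F * (Mᵀ * J F * M))) := by
              simp only [Matrix.neg_mul, Matrix.smul_mul, Matrix.mul_assoc]
          _ = 1 := by
              rw [h, Matrix.mul_smul, smul_smul, inv_mul_cancel₀ c.ne_zero, one_smul, J_mul_J,
                neg_neg]⟩, c, h⟩

/-! ### The standard parabolic subgroups -/

/-- The subgroup of all `g` in `GSp(4, F)` with `g i j = 0` whenever `b j < b i`. -/
def parabolic (F : Type*) [Field F] (b : Fin 4 → ℕ) : Subgroup (GSp4 F) where
  carrier := {g | (mat g).BlockTriangular b}
  mul_mem' := fun hg hh => hg.mul hh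
  one_mem' := Matrix.blockTriangular_one
  inv_mem' := by
    intro g hg
    have hinv : mat g⁻¹ = (mat g)⁻¹ := Matrix.coe_units_inv (g : GL (Fin 4) F)
    let _ : Invertible (mat g) := (g : GL (Fin 4) F).invertible
    change (mat g⁻¹).BlockTriangular b
    rw [hinv]
    exact Matrix.blockTriangular_inv_of_blockTriangular hg

/-- The Borel subgroup: upper triangular matrices. -/
abbrev borel (F : Type*) [Field F] : Subgroup (GSp4 F) := parabolic F ![0, 1, 2, 3]

/-- The Siegel parabolic subgroup: block upper triangular, blocks of sizes 2, 2. -/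
abbrev siegel (F : Type*) [Field F] : Subgroup (GSp4 F) := parabolic F ![0, 0, 1, 1]

/-- The Klingen parabolic subgroup: block upper triangular, blocks of sizes 1, 2, 1. -/
abbrev klingen (F : Type*) [Field F] : Subgroup (GSp4 F) := parabolic F ![0, 1, 1, 2]

theorem parabolic_zero {b : Fin 4 → ℕ} (g : parabolic F b) {i j : Fin 4} (h : b j < b i) :
    mat (g : GSp4 F) i j = 0 := g.2 h

/-- The first diagonal entry on the Borel subgroup. -/
def borelFst : borel F →* Fˣ :=
  MonoidHom.toHomUnits
    { toFun := fun g => mat (g : GSp4 F) 0 0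
      map_one' := by simp [mat_one]
      map_mul' := fun g h => by
        have h1 := parabolic_zero h (i := 1) (j := 0) (by simp)
        have h2 := parabolic_zero h (i := 2) (j := 0) (by simp)
        have h3 := parabolic_zero h (i := 3) (j := 0) (by simp)
        simp [mat_mul, Matrix.mul_apply, Fin.sum_univ_four, h1, h2, h3] }

/-- The second diagonal entry on the Borel subgroup. -/
def borelSnd : borel F →* Fˣ :=
  MonoidHom.toHomUnits
    { toFun := fun g => mat (g : GSp4 F) 1 1
      map_one' := by simp [mat_one]
      map_mul' := fun g h => by
        have h1 := parabolic_zero g (i := 1) (j := 0) (by simp)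
        have h2 := parabolic_zero h (i := 2) (j := 1) (by simp)
        have h3 := parabolic_zero h (i := 3) (j := 1) (by simp)
        simp [mat_mul, Matrix.mul_apply, Fin.sum_univ_four, h1, h2, h3] }

/-- The upper left `2 × 2` block on the Siegel parabolic subgroup. -/
def siegelBlock : siegel F →* GL (Fin 2) F :=
  MonoidHom.toHomUnits
    { toFun := fun g => !![mat (g : GSp4 F) 0 0, mat (g : GSp4 F) 0 1;
                           mat (g : GSp4 F) 1 0, mat (g : GSp4 F) 1 1]
      map_one' := by simp [mat_one, Matrix.one_fin_two]
      map_mul' := fun g h => by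
        have h1 := parabolic_zero h (i := 2) (j := 0) (by simp)
        have h2 := parabolic_zero h (i := 2) (j := 1) (by simp)
        have h3 := parabolic_zero h (i := 3) (j := 0) (by simp)
        have h4 := parabolic_zero h (i := 3) (j := 1) (by simp)
        simp [mat_mul, Matrix.mul_apply, Fin.sum_univ_four, h1, h2, h3, h4] }

/-- The upper left entry on the Klingen parabolic subgroup. -/
def klingenFst : klingen F →* Fˣ :=
  MonoidHom.toHomUnits
    { toFun := fun g => mat (g : GSp4 F) 0 0
      map_one' := by simp [mat_one]
      map_mul' := fun g h => by
        have h1 := parabolic_zero h (i := 1) (j := 0) (by simp)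
        have h2 := parabolic_zero h (i := 2) (j := 0) (by simp)
        have h3 := parabolic_zero h (i := 3) (j := 0) (by simp)
        simp [mat_mul, Matrix.mul_apply, Fin.sum_univ_four, h1, h2, h3] }

/-- The middle `2 × 2` block on the Klingen parabolic subgroup. -/
def klingenBlock : klingen F →* GL (Fin 2) F :=
  MonoidHom.toHomUnits
    { toFun := fun g => !![mat (g : GSp4 F) 1 1, mat (g : GSp4 F) 1 2;
                           mat (g : GSp4 F) 2 1, mat (g : GSp4 F) 2 2]
      map_one' := by simp [mat_one, Matrix.one_fin_two]
      map_mul' := fun g h => by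
        have h1 := parabolic_zero g (i := 1) (j := 0) (by simp)
        have h2 := parabolic_zero g (i := 2) (j := 0) (by simp)
        have h3 := parabolic_zero h (i := 3) (j := 1) (by simp)
        have h4 := parabolic_zero h (i := 3) (j := 2) (by simp)
        simp [mat_mul, Matrix.mul_apply, Fin.sum_univ_four, h1, h2, h3, h4] }

/-! ### The parabolically induced representations

`Representation.coind H.subtype ρ` is the space of all functions `f` on `GSp(4, F)` with
`f (h * g) = ρ h (f g)` for `h` in `H`, on which the group acts by right translation. -/

/-- The representation `v ↦ α(h) ρ(h) v`, the twist of `ρ` by the linear character `α`. -/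
def twist {H V : Type*} [Group H] [AddCommGroup V] [Module ℂ V]
    (α : H →* ℂˣ) (ρ : Representation ℂ H V) : Representation ℂ H V where
  toFun h := (α h : ℂ) • ρ h
  map_one' := by simp
  map_mul' g h := by
    ext v
    simp [smul_smul, mul_comm]

/-- `χ₁ × χ₂ ⋊ σ`, induced from the character `χ₁(a) χ₂(b) σ(c)` of the Borel subgroup. -/
def borelInd (χ₁ χ₂ σ : Fˣ →* ℂˣ) :=
  Representation.coind (borel F).subtype
    (twist ((χ₁.comp borelFst) * (χ₂.comp borelSnd)
      * (σ.comp (multiplier.comp (borel F).subtype)))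
      (Representation.trivial ℂ (borel F) ℂ))

variable {V : Type*} [AddCommGroup V] [Module ℂ V]

/-- `π ⋊ σ`, induced from the representation `σ(c) π(A)` of the Siegel parabolic subgroup. -/
def siegelInd (π : Representation ℂ (GL (Fin 2) F) V) (σ : Fˣ →* ℂˣ) :=
  Representation.coind (siegel F).subtype
    (twist (σ.comp (multiplier.comp (siegel F).subtype)) (π.comp siegelBlock))

/-- `χ ⋊ π`, induced from the representation `χ(t) π(A)` of the Klingen parabolic subgroup,
where `A` is the middle block. -/
def klingenInd (χ : Fˣ →* ℂˣ) (π : Representation ℂ (GL (Fin 2) F) V) :=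
  Representation.coind (klingen F).subtype
    (twist (χ.comp klingenFst) (π.comp klingenBlock))

/-! ### Elements of `GL(2, F)` -/

/-- The diagonal matrix with entries `a`, `b`. -/
def dg (a b : Fˣ) : GL (Fin 2) F :=
  Matrix.GeneralLinearGroup.mkOfDetNeZero !![(a : F), 0; 0, (b : F)] (by simp)

/-- The Jordan block of size two with eigenvalue `a`. -/
def jd (a : Fˣ) : GL (Fin 2) F :=
  Matrix.GeneralLinearGroup.mkOfDetNeZero !![(a : F), 1; 0, (a : F)] (by simp)

section Elliptic

variable {E : Type*} [Field E] [Algebra F E] [FiniteDimensional F E]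

/-- For a quadratic extension `E` of `F` and `x` in `E` but not in `F`, an element of `GL(2, F)`
with eigenvalues `x` and its conjugate: the companion matrix of `X² - tr(x) X + N(x)`.
It stands for the matrix written `diag(x, x^q)` over `E`, to which it is conjugate in
`GL(2, E)`; its conjugacy class in `GL(2, F)` is determined by this. -/
def ell (x : Eˣ) : GL (Fin 2) F :=
  Matrix.GeneralLinearGroup.mkOfDetNeZero
    !![0, -Algebra.norm F (x : E); 1, Algebra.trace F E (x : E)]
    (by simp [Matrix.det_fin_two])

end Elliptic

/-! ### Elements of `GSp(4, F)` -/

/-- The element `diag(A, c A')` of the Siegel Levi subgroup, where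
`A' = w ᵗA⁻¹ w = Δ⁻¹ [[a, -b], [-c', d]]` for `A = [[a, b], [c', d]]`, `Δ = det A`. -/
def siegelLevi (A : GL (Fin 2) F) (c : Fˣ) : GSp4 F :=
  ofMatrix
    !![A.1 0 0, A.1 0 1, 0, 0;
       A.1 1 0, A.1 1 1, 0, 0;
       0, 0, c * A.1 0 0 / A.1.det, -(c * A.1 0 1 / A.1.det);
       0, 0, -(c * A.1 1 0 / A.1.det), c * A.1 1 1 / A.1.det] c (by
    have h : A.1.det ≠ 0 := (Matrix.isUnit_iff_isUnit_det _).mp A.isUnit |>.ne_zero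
    have h' := Matrix.det_fin_two A.1
    ext i j
    fin_cases i <;> fin_cases j <;>
      simp [J, Matrix.mul_apply, Fin.sum_univ_four] <;> field_simp <;> rw [h'] <;> ring)

/-- The element of the unipotent radical of the Siegel parabolic subgroup with upper right block
`[[μ, κ], [x, μ]]`. -/
def siegelUnip (μ κ x : F) : GSp4 F :=
  ofMatrix !![1, 0, μ, κ; 0, 1, x, μ; 0, 0, 1, 0; 0, 0, 0, 1] 1 (by
    ext i j
    fin_cases i <;> fin_cases j <;> simp [J, Matrix.mul_apply, Fin.sum_univ_four])

/-- The element `diag(t, A, det(A) t⁻¹)` of the Klingen Levi subgroup. -/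
def klingenLevi (t : Fˣ) (A : GL (Fin 2) F) : GSp4 F :=
  ofMatrix
    !![(t : F), 0, 0, 0;
       0, A.1 0 0, A.1 0 1, 0;
       0, A.1 1 0, A.1 1 1, 0;
       0, 0, 0, A.1.det / t] A.det (by
    ext i j
    fin_cases i <;> fin_cases j <;>
      simp [J, Matrix.mul_apply, Fin.sum_univ_four, Matrix.det_fin_two] <;> field_simp <;> ring)

/-! ### Conjugacy classes -/

/-- Names of (families of) conjugacy classes of `GSp(4, F)`. -/
inductive Cls (F : Type*)
  | A1 (k : ℤ) | A2 (k : ℤ) | A31 (k : ℤ) | A32 (k : ℤ) | A5 (k : ℤ)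
  | B11 (k : ℤ) | B12 (k : ℤ) | B21 (k : ℤ) | B22 (k : ℤ) | B3 (k : ℤ)
  | B41 (k : ℤ) | B42 (k : ℤ) | B43 (k : ℤ) | B44 (k : ℤ) (a b : F)
  | B51 (k : ℤ) | B52 (k : ℤ)
  | C1 (i k : ℤ) | C21 (i k : ℤ) | C22 (i k : ℤ) | C3 (i k : ℤ) | C4 (i k : ℤ) | C5 (i k : ℤ)
  | C6 (i j k : ℤ)
  | D1 (i k : ℤ) | D2 (i k : ℤ) | D31 (i k : ℤ) | D4 (i j k : ℤ) | D5 (i k : ℤ)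
  | D6 (i k : ℤ) | D8 (i k : ℤ)

section Classes

variable {E : Type*} [Field E] [Algebra F E] [FiniteDimensional F E] [Fintype F]

/-- An element of `Fˣ` as an element of `Eˣ`. -/
def up (E : Type*) [Field E] [Algebra F E] (a : Fˣ) : Eˣ := Units.map (algebraMap F E) a

/-- `η = θ^(q-1)`. -/
def eta (F : Type*) [Fintype F] (θ : Eˣ) : Eˣ := θ ^ (Fintype.card F - 1)

/-- The matrix with eigenvalues `γ^k θ^i` and `γ^k θ^(qi)`. -/
def ellTheta (θ : Eˣ) (γ : Fˣ) (k i : ℤ) : GL (Fin 2) F := ell (up E (γ ^ k) * θ ^ i)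

/-- The matrix with eigenvalues `γ^k η^i` and `γ^k η^(-i)`. -/
def ellEta (θ : Eˣ) (γ : Fˣ) (k i : ℤ) : GL (Fin 2) F := ell (up E (γ ^ k) * eta F θ ^ i)

/-- The matrix with eigenvalues `γ^(k+1/2)` and `-γ^(k+1/2)`, where `γ^(1/2) = θ^((q+1)/2)` is a
square root of `γ = θ^(q+1)`. -/
def ellHalf (θ : Eˣ) (γ : Fˣ) (k : ℤ) : GL (Fin 2) F :=
  ell (up E (γ ^ k) * θ ^ ((Fintype.card F + 1) / 2))

/-- The conditions on the parameters. They say that the eigenvalues coincide only as they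
generically do in the family, and that the element is not in another family; for `B44`, that
`a + b γ^(k+1/2)` is not a square in `E`. -/
def Cls.Valid (θ : Eˣ) (γ : Fˣ) : Cls F → Prop
  | .B44 k a b => ¬ IsSquare (a ^ 2 - b ^ 2 * ((γ ^ (2 * k + 1) : Fˣ) : F))
  | .C1 i _ | .C21 i _ | .C22 i _ | .C3 i _ | .C4 i _ | .C5 i _ => γ ^ i ≠ 1 ∧ γ ^ i ≠ -1
  | .C6 i j _ => γ ^ i ≠ 1 ∧ γ ^ i ≠ -1 ∧ γ ^ j ≠ 1 ∧ γ ^ j ≠ -1 ∧ γ ^ i ≠ γ ^ j ∧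
      γ ^ (i + j) ≠ 1
  | .D1 i _ => eta F θ ^ i ≠ 1 ∧ γ ^ i ≠ 1
  | .D2 i _ | .D31 i _ | .D5 i _ | .D6 i _ | .D8 i _ => eta F θ ^ i ≠ 1 ∧ eta F θ ^ i ≠ -1
  | .D4 i j _ => eta F θ ^ i ≠ 1 ∧ eta F θ ^ i ≠ -1 ∧ γ ^ j ≠ 1 ∧ γ ^ j ≠ -1
  | _ => True

/-- Representatives of the conjugacy classes. -/
def Cls.rep (θ : Eˣ) (γ : Fˣ) : Cls F → GSp4 F
  | .A1 k => siegelLevi (dg (γ ^ k) (γ ^ k)) (γ ^ (2 * k))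
  | .A2 k => siegelLevi (dg (γ ^ k) (γ ^ k)) (γ ^ (2 * k)) * siegelUnip 0 1 0
  | .A31 k => siegelLevi (dg (γ ^ k) (γ ^ k)) (γ ^ (2 * k)) * siegelUnip 0 1 (-1)
  | .A32 k => siegelLevi (dg (γ ^ k) (γ ^ k)) (γ ^ (2 * k)) * siegelUnip 0 1 (-(γ : F))
  | .A5 k => siegelLevi (jd (γ ^ k)) (γ ^ (2 * k)) * siegelUnip 0 0 1
  | .B11 k => siegelLevi (dg (γ ^ k) (-γ ^ k)) (γ ^ (2 * k))
  | .B12 k => siegelLevi (ellHalf θ γ k) (γ ^ (2 * k + 1))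
  | .B21 k => siegelLevi (dg (γ ^ k) (γ ^ k)) (-γ ^ (2 * k))
  | .B22 k => siegelLevi (ellHalf θ γ k) (-γ ^ (2 * k + 1))
  | .B3 k => siegelLevi (dg (γ ^ k) (-γ ^ k)) (γ ^ (2 * k)) * siegelUnip 0 0 1
  | .B41 k => siegelLevi (dg (γ ^ k) (-γ ^ k)) (γ ^ (2 * k)) * siegelUnip 0 1 1
  | .B42 k => siegelLevi (dg (γ ^ k) (-γ ^ k)) (γ ^ (2 * k)) * siegelUnip 0 1 (γ : F)
  | .B43 k => siegelLevi (ellHalf θ γ k) (γ ^ (2 * k + 1)) * siegelUnip 1 0 0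
  | .B44 k a b => siegelLevi (ellHalf θ γ k) (γ ^ (2 * k + 1))
      * siegelUnip a (b * ((γ ^ (2 * k + 1) : Fˣ) : F)) b
  | .B51 k => siegelLevi (jd (γ ^ k)) (-γ ^ (2 * k))
  | .B52 k => siegelLevi (ellHalf θ γ k) (-γ ^ (2 * k + 1)) * siegelUnip 0 0 1
  | .C1 i k => siegelLevi (dg (γ ^ k) (γ ^ k)) (γ ^ (2 * k + i))
  | .C21 i k => siegelLevi (dg (γ ^ k) (-γ ^ k)) (-γ ^ (2 * k + i))
  | .C22 i k => siegelLevi (ellHalf θ γ k) (-γ ^ (2 * k + i + 1))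
  | .C3 i k => siegelLevi (jd (γ ^ k)) (γ ^ (2 * k + i))
  | .C4 i k => klingenLevi (γ ^ (k + i)) (jd (γ ^ k))
  | .C5 i k => klingenLevi (γ ^ (k + i)) (dg (γ ^ k) (γ ^ k))
  | .C6 i j k => siegelLevi (dg (γ ^ k) (γ ^ (k + i))) (γ ^ (2 * k + i + j))
  | .D1 i k => klingenLevi (γ ^ k) (ellTheta θ γ k i)
  | .D2 i k => siegelLevi (ellTheta θ γ k i) (γ ^ (2 * k + i))
  | .D31 i k => siegelLevi (ellTheta θ γ k i) (-γ ^ (2 * k + i))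
  | .D4 i j k => siegelLevi (ellTheta θ γ k i) (γ ^ (2 * k + i + j))
  | .D5 i k => siegelLevi (ellTheta θ γ k i) (γ ^ (2 * k + i)) * siegelUnip 0 0 1
  | .D6 i k => klingenLevi (γ ^ k) (ellEta θ γ k i)
  | .D8 i k => klingenLevi (γ ^ k) (ellEta θ γ k i) * siegelUnip 0 1 0

/-! ### The three tables of character values -/

/-- The value of a linear character of `Fˣ` as a complex number. -/
abbrev ev (χ : Fˣ →* ℂˣ) (a : Fˣ) : ℂ := (χ a : ℂ)

/-- Character values of `χ₁ × χ₂ ⋊ σ`; classes that are not listed get the value `0`. -/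
def borelTable (χ₁ χ₂ σ : Fˣ →* ℂˣ) (γ : Fˣ) : Cls F → ℂ :=
  let q : ℂ := Fintype.card F
  fun
  | .A1 k => (q ^ 2 + 1) * (q + 1) ^ 2 * ev χ₁ (γ ^ k) * ev χ₂ (γ ^ k) * ev σ (γ ^ (2 * k))
  | .A2 k => (q + 1) ^ 2 * ev χ₁ (γ ^ k) * ev χ₂ (γ ^ k) * ev σ (γ ^ (2 * k))
  | .A31 k => (3 * q + 1) * ev χ₁ (γ ^ k) * ev χ₂ (γ ^ k) * ev σ (γ ^ (2 * k))
  | .A32 k => (q + 1) * ev χ₁ (γ ^ k) * ev χ₂ (γ ^ k) * ev σ (γ ^ (2 * k))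
  | .A5 k => ev χ₁ (γ ^ k) * ev χ₂ (γ ^ k) * ev σ (γ ^ (2 * k))
  | .B11 k => (q + 1) ^ 2 * ev χ₁ (γ ^ k) * ev χ₂ (γ ^ k) * ev σ (γ ^ (2 * k))
      * (ev χ₁ (-1) + ev χ₂ (-1))
  | .B21 k => (q + 1) * ev χ₁ (γ ^ k) * ev χ₂ (γ ^ k) * ev σ (-γ ^ (2 * k))
      * (1 + ev χ₁ (-1) * ev χ₂ (-1) + ev χ₁ (-1) + ev χ₂ (-1))
  | .B3 k => (q + 1) * ev χ₁ (γ ^ k) * ev χ₂ (γ ^ k) * ev σ (γ ^ (2 * k))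
      * (ev χ₁ (-1) + ev χ₂ (-1))
  | .B41 k | .B42 k => ev χ₁ (γ ^ k) * ev χ₂ (γ ^ k) * ev σ (γ ^ (2 * k))
      * (ev χ₁ (-1) + ev χ₂ (-1))
  | .B51 k => ev χ₁ (γ ^ k) * ev χ₂ (γ ^ k) * ev σ (-γ ^ (2 * k))
      * (1 + ev χ₁ (-1) * ev χ₂ (-1) + ev χ₁ (-1) + ev χ₂ (-1))
  | .C1 i k => (q + 1) * ev χ₁ (γ ^ k) * ev χ₂ (γ ^ k) * ev σ (γ ^ (2 * k + i))
      * (1 + ev χ₁ (γ ^ i) * ev χ₂ (γ ^ i) + ev χ₁ (γ ^ i) + ev χ₂ (γ ^ i))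
  | .C21 i k => ev χ₁ (γ ^ k) * ev χ₂ (γ ^ k) * ev σ (-γ ^ (2 * k + i))
      * (ev χ₁ (-1) + ev χ₂ (-1)
        + ev χ₁ (-1) * ev χ₂ (-1) * (ev χ₁ (γ ^ i) + ev χ₂ (γ ^ i))
        + (ev χ₁ (-1) + ev χ₂ (-1)) * ev χ₁ (γ ^ i) * ev χ₂ (γ ^ i)
        + ev χ₁ (γ ^ i) + ev χ₂ (γ ^ i))
  | .C3 i k => ev χ₁ (γ ^ k) * ev χ₂ (γ ^ k) * ev σ (γ ^ (2 * k + i))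
      * (1 + ev χ₁ (γ ^ i) * ev χ₂ (γ ^ i) + ev χ₁ (γ ^ i) + ev χ₂ (γ ^ i))
  | .C4 i k => ev χ₁ (γ ^ k) * ev χ₂ (γ ^ k) * ev σ (γ ^ (2 * k))
      * (ev χ₁ (γ ^ i) + ev χ₁ (γ ^ (-i)) + ev χ₂ (γ ^ i) + ev χ₂ (γ ^ (-i)))
  | .C5 i k => (q + 1) * ev χ₁ (γ ^ k) * ev χ₂ (γ ^ k) * ev σ (γ ^ (2 * k))
      * (ev χ₁ (γ ^ i) + ev χ₁ (γ ^ (-i)) + ev χ₂ (γ ^ i) + ev χ₂ (γ ^ (-i)))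
  | .C6 i j k => ev χ₁ (γ ^ k) * ev χ₂ (γ ^ k) * ev σ (γ ^ (2 * k + i + j))
      * (ev χ₁ (γ ^ i) + ev χ₁ (γ ^ j) + ev χ₂ (γ ^ i) + ev χ₂ (γ ^ j)
        + ev χ₁ (γ ^ (i + j)) * (ev χ₂ (γ ^ i) + ev χ₂ (γ ^ j))
        + ev χ₂ (γ ^ (i + j)) * (ev χ₁ (γ ^ i) + ev χ₁ (γ ^ j)))
  | _ => 0

/-- Character values of `π ⋊ σ`, where `χπ` is the character of `π`; classes that are not
listed get the value `0`. -/
def siegelTable (χπ : GL (Fin 2) F → ℂ) (σ : Fˣ →* ℂˣ) (θ : Eˣ) (γ : Fˣ) : Cls F → ℂ :=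
  let q : ℂ := Fintype.card F
  fun
  | .A1 k => (q ^ 2 + 1) * (q + 1) * ev σ (γ ^ (2 * k)) * χπ (dg (γ ^ k) (γ ^ k))
  | .A2 k => (q + 1) * ev σ (γ ^ (2 * k)) * χπ (dg (γ ^ k) (γ ^ k))
  | .A31 k => ev σ (γ ^ (2 * k)) * (χπ (dg (γ ^ k) (γ ^ k)) + 2 * q * χπ (jd (γ ^ k)))
  | .A32 k => ev σ (γ ^ (2 * k)) * χπ (dg (γ ^ k) (γ ^ k))
  | .A5 k => ev σ (γ ^ (2 * k)) * χπ (jd (γ ^ k))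
  | .B11 k => (q + 1) ^ 2 * ev σ (γ ^ (2 * k)) * χπ (dg (γ ^ k) (-γ ^ k))
  | .B12 k => (q ^ 2 + 1) * ev σ (γ ^ (2 * k + 1)) * χπ (ellHalf θ γ k)
  | .B21 k => ev σ (-γ ^ (2 * k)) * (χπ (dg (γ ^ k) (γ ^ k)) + χπ (dg (-γ ^ k) (-γ ^ k))
      + (q + 1) * χπ (dg (γ ^ k) (-γ ^ k)))
  | .B22 k => (q + 1) * ev σ (-γ ^ (2 * k + 1)) * χπ (ellHalf θ γ k)
  | .B3 k => (q + 1) * ev σ (γ ^ (2 * k)) * χπ (dg (γ ^ k) (-γ ^ k))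
  | .B41 k | .B42 k => ev σ (γ ^ (2 * k)) * χπ (dg (γ ^ k) (-γ ^ k))
  | .B43 k | .B44 k _ _ => ev σ (γ ^ (2 * k + 1)) * χπ (ellHalf θ γ k)
  | .B51 k => ev σ (-γ ^ (2 * k)) * (χπ (dg (γ ^ k) (-γ ^ k)) + χπ (jd (γ ^ k))
      + χπ (jd (-γ ^ k)))
  | .B52 k => ev σ (-γ ^ (2 * k + 1)) * χπ (ellHalf θ γ k)
  | .C1 i k => ev σ (γ ^ (2 * k + i)) * (χπ (dg (γ ^ k) (γ ^ k))
      + χπ (dg (γ ^ (k + i)) (γ ^ (k + i))) + (q + 1) * χπ (dg (γ ^ k) (γ ^ (k + i))))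
  | .C21 i k => ev σ (-γ ^ (2 * k + i)) * (χπ (dg (γ ^ k) (-γ ^ k))
      + χπ (dg (γ ^ (k + i)) (-γ ^ (k + i))) + χπ (dg (γ ^ k) (γ ^ (k + i)))
      + χπ (dg (-γ ^ k) (-γ ^ (k + i))))
  | .C22 i k => ev σ (-γ ^ (2 * k + i + 1)) * (χπ (ellHalf θ γ k) + χπ (ellHalf θ γ (k + i)))
  | .C3 i k => ev σ (γ ^ (2 * k + i)) * (χπ (jd (γ ^ k)) + χπ (jd (γ ^ (k + i)))
      + χπ (dg (γ ^ k) (γ ^ (k + i))))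
  | .C4 i k => ev σ (γ ^ (2 * k)) * (χπ (dg (γ ^ k) (γ ^ (k + i)))
      + χπ (dg (γ ^ k) (γ ^ (k - i))))
  | .C5 i k => (q + 1) * ev σ (γ ^ (2 * k)) * (χπ (dg (γ ^ k) (γ ^ (k + i)))
      + χπ (dg (γ ^ k) (γ ^ (k - i))))
  | .C6 i j k => ev σ (γ ^ (2 * k + i + j)) * (χπ (dg (γ ^ k) (γ ^ (k + i)))
      + χπ (dg (γ ^ k) (γ ^ (k + j))) + χπ (dg (γ ^ (k + i)) (γ ^ (k + i + j)))
      + χπ (dg (γ ^ (k + j)) (γ ^ (k + i + j))))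
  | .D2 i k => (q + 1) * ev σ (γ ^ (2 * k + i)) * χπ (ellTheta θ γ k i)
  | .D31 i k => ev σ (-γ ^ (2 * k + i)) * (χπ (ellTheta θ γ k i)
      + χπ (ell (-(up E (γ ^ k) * θ ^ i))))
  | .D4 i j k => ev σ (γ ^ (2 * k + i + j)) * (χπ (ellTheta θ γ k i)
      + χπ (ellTheta θ γ (k + j) i))
  | .D5 i k => ev σ (γ ^ (2 * k + i)) * χπ (ellTheta θ γ k i)
  | _ => 0

/-- Character values of `χ ⋊ π`, where `χπ` is the character of `π`; classes that are not
listed get the value `0`. -/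
def klingenTable (χ : Fˣ →* ℂˣ) (χπ : GL (Fin 2) F → ℂ) (θ : Eˣ) (γ : Fˣ) : Cls F → ℂ :=
  let q : ℂ := Fintype.card F
  fun
  | .A1 k => (q ^ 2 + 1) * (q + 1) * ev χ (γ ^ k) * χπ (dg (γ ^ k) (γ ^ k))
  | .A2 k => ev χ (γ ^ k) * (χπ (dg (γ ^ k) (γ ^ k)) + q * (q + 1) * χπ (jd (γ ^ k)))
  | .A31 k => 2 * ev χ (γ ^ k) * (χπ (dg (γ ^ k) (γ ^ k)) + (q - 1) / 2 * χπ (jd (γ ^ k)))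
  | .A32 k => (q + 1) * ev χ (γ ^ k) * χπ (jd (γ ^ k))
  | .A5 k => ev χ (γ ^ k) * χπ (jd (γ ^ k))
  | .B11 k => (q + 1) * ev χ (γ ^ k) * (ev χ (-1) * χπ (dg (γ ^ k) (γ ^ k))
      + χπ (dg (-γ ^ k) (-γ ^ k)))
  | .B21 k => (q + 1) * ev χ (γ ^ k) * (1 + ev χ (-1)) * χπ (dg (γ ^ k) (-γ ^ k))
  | .B3 k => ev χ (γ ^ k) * (ev χ (-1) * χπ (dg (γ ^ k) (γ ^ k))
      + (q + 1) * χπ (jd (-γ ^ k)))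
  | .B41 k | .B42 k => ev χ (γ ^ k) * (ev χ (-1) * χπ (jd (γ ^ k)) + χπ (jd (-γ ^ k)))
  | .B51 k => ev χ (γ ^ k) * (1 + ev χ (-1)) * χπ (dg (γ ^ k) (-γ ^ k))
  | .C1 i k => (q + 1) * ev χ (γ ^ k) * (1 + ev χ (γ ^ i)) * χπ (dg (γ ^ k) (γ ^ (k + i)))
  | .C21 i k => ev χ (γ ^ k)
      * ((ev χ (γ ^ i) + ev χ (-1)) * χπ (dg (γ ^ k) (-γ ^ (k + i)))
        + (1 + ev χ (-γ ^ i)) * χπ (dg (-γ ^ k) (γ ^ (k + i))))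
  | .C3 i k => ev χ (γ ^ k) * (1 + ev χ (γ ^ i)) * χπ (dg (γ ^ k) (γ ^ (k + i)))
  | .C4 i k => ev χ (γ ^ k) * ((ev χ (γ ^ i) + ev χ (γ ^ (-i))) * χπ (jd (γ ^ k))
      + χπ (dg (γ ^ (k + i)) (γ ^ (k - i))))
  | .C5 i k => ev χ (γ ^ k) * ((ev χ (γ ^ i) + ev χ (γ ^ (-i))) * χπ (dg (γ ^ k) (γ ^ k))
      + (q + 1) * χπ (dg (γ ^ (k + i)) (γ ^ (k - i))))
  | .C6 i j k => ev χ (γ ^ k)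
      * ((1 + ev χ (γ ^ (i + j))) * χπ (dg (γ ^ (k + i)) (γ ^ (k + j)))
        + (ev χ (γ ^ i) + ev χ (γ ^ j)) * χπ (dg (γ ^ k) (γ ^ (k + i + j))))
  | .D1 i k => ev χ (γ ^ k) * (1 + ev χ (γ ^ i)) * χπ (ellTheta θ γ k i)
  | .D6 i k => (q + 1) * ev χ (γ ^ k) * χπ (ellEta θ γ k i)
  | .D8 i k => ev χ (γ ^ k) * χπ (ellEta θ γ k i)
  | _ => 0

/-- The class function `ψ` on `GSp(4, F)` has the given table of values: it takes the value
`table c` on the class of every representative `c`, and it vanishes on all elements that are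
conjugate to none of the representatives. -/
def HasTable (θ : Eˣ) (γ : Fˣ) (ψ : GSp4 F → ℂ) (table : Cls F → ℂ) : Prop :=
  (∀ c : Cls F, c.Valid θ γ → ∀ g : GSp4 F, IsConj (c.rep θ γ) g → ψ g = table c) ∧
  ∀ g : GSp4 F, (∀ c : Cls F, c.Valid θ γ → ¬ IsConj (c.rep θ γ) g) → ψ g = 0

end Classes

end GSpFour

end

/-!
The character of a representation induced from a subgroup `H` is a sum over the cosets `H g`: the
coset `H x` contributes the value of the inducing character at `x g x⁻¹` if this element is in `H`,
that is, if the coset is fixed by `g`, and nothing otherwise (`IsCosetReps.character_coind`). The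
cosets of the Siegel and Klingen subgroups are the Lagrangian planes and the lines in `F⁴`; the
Bruhat decomposition gives representatives `siegelRep`, `klingenRep` by four cells of dimension
`0`, `1`, `2`, `3`. Evaluating the characters means finding the fixed planes and lines in each cell
and the block of `GL(2)` by which the element acts on each of them.

This is carried out for an arbitrary class function `ψ` of `GL(2)` in place of the character of `π`.
The representatives of the classes have matrices of four shapes: two nested upper triangular blocks
(`cornerMat`), a Jordan block in the Siegel Levi subgroup (`jordanMat`), and an elliptic block in
the Siegel or in the Klingen Levi subgroup (`ellSiegelMat`, `ellKlingenMat`). For each shape the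
conditions on a fixed coset are linear or quadratic equations in the parameters of the cell, and
counting solutions gives `siegelSum_rep` and `klingenSum_rep`. An elliptic block has no eigenvalue
in `F`, which excludes all cells but at most two.

The representation `χ₁ × χ₂ ⋊ σ` is induced in stages, through the principal series of the Siegel
Levi subgroup (`character_borelInd`). Hence its character is obtained by inserting the character of
the principal series of `GL(2)` into the Siegel table, which reduces to the stated values
(`siegelTable_principalSeries`).

An induced character vanishes at elements without a conjugate in the inducing subgroup, and the
Borel subgroup is contained in the Siegel subgroup. So the vanishing off the listed classes follows
once every element of the Siegel or of the Klingen subgroup is conjugate to one of the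
representatives (`exists_rep_of_mem_siegel`, `exists_rep_of_mem_klingen`). To see this, the block in
`GL(2)` is conjugated to a diagonal matrix, a Jordan block or the companion matrix of an irreducible
polynomial; the unipotent part is removed, as far as the two Levi blocks have no eigenvalue in
common, by solving linear equations; what remains is normalized by the diagonal torus, up to squares
in `F`, and, in the elliptic case, by elements commuting with the block. An element of the Klingen
subgroup with split block is conjugate into the Siegel subgroup, so only elliptic blocks are new
there.
-/

open Matrix

noncomputable section

namespace GSpFour

/-! ### Characters of induced representations -/

theorem trace_pi_eq_sum {ι V : Type*} [Fintype ι] [DecidableEq ι] [AddCommGroup V] [Module ℂ V]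
    [FiniteDimensional ℂ V] (T : (ι → V) →ₗ[ℂ] (ι → V)) :
    LinearMap.trace ℂ (ι → V) T
      = ∑ i, LinearMap.trace ℂ V (LinearMap.proj i ∘ₗ T ∘ₗ LinearMap.single ℂ (fun _ => V) i) := by
  have h : T = ∑ i, (T ∘ₗ LinearMap.single ℂ (fun _ => V) i) ∘ₗ LinearMap.proj i := by
    ext i v j
    simp [Pi.single_apply, Finset.sum_apply]
    rw [Finset.sum_eq_single i] <;> simp +contextual
  conv_lhs => rw [h, map_sum]
  exact Finset.sum_congr rfl fun i _ => LinearMap.trace_comp_comm' _ _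

/-- A family of representatives of the cosets `H g`. -/
def IsCosetReps {G ι : Type*} [Group G] (H : Subgroup G) (R : ι → G) : Prop :=
  ∀ g, ∃! i, g * (R i)⁻¹ ∈ H

section Induced

variable {G ι V : Type*} [Group G] {H : Subgroup G} [AddCommGroup V] [Module ℂ V]
  {ρ : Representation ℂ H V} {R : ι → G}

namespace IsCosetReps

/-- The index of the representative of the coset of `g`. -/
def index (hR : IsCosetReps H R) (g : G) : ι := (hR g).choose

theorem mul_inv_mem (hR : IsCosetReps H R) (g : G) : g * (R (hR.index g))⁻¹ ∈ H :=
  (hR g).choose_spec.1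

theorem index_eq (hR : IsCosetReps H R) {g : G} {i : ι} (h : g * (R i)⁻¹ ∈ H) :
    hR.index g = i :=
  ((hR g).choose_spec.2 i h).symm

theorem index_mul (hR : IsCosetReps H R) (h : H) (g : G) :
    hR.index (h * g) = hR.index g :=
  hR.index_eq (by rw [mul_assoc]; exact H.mul_mem h.2 (hR.mul_inv_mem g))

theorem index_rep (hR : IsCosetReps H R) (i : ι) : hR.index (R i) = i :=
  hR.index_eq (by simp [H.one_mem])

/-- A function in the induced representation is determined by its values at the coset
representatives, and these are arbitrary. -/
def evalEquiv (hR : IsCosetReps H R) (ρ : Representation ℂ H V) :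
    Representation.coindV H.subtype ρ ≃ₗ[ℂ] (ι → V) where
  toFun f i := f.1 (R i)
  map_add' _ _ := rfl
  map_smul' _ _ := rfl
  invFun φ := ⟨fun g => ρ ⟨_, hR.mul_inv_mem g⟩ (φ (hR.index g)), fun h g => by
    have hi := hR.index_mul h g
    have : (⟨_, hR.mul_inv_mem (h * g)⟩ : H) = h * ⟨_, hR.mul_inv_mem g⟩ := by
      ext; simp [hi, mul_assoc]
    simp only [Subgroup.subtype_apply]
    rw [this, hi, map_mul, Module.End.mul_apply]⟩
  left_inv f := by
    ext g
    have := f.2 ⟨_, hR.mul_inv_mem g⟩ (R (hR.index g))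
    simp only [Subgroup.subtype_apply, inv_mul_cancel_right] at this
    exact this.symm
  right_inv φ := by
    ext i
    have hi := hR.index_rep i
    have : (⟨_, hR.mul_inv_mem (R i)⟩ : H) = 1 := by ext; simp [hi]
    simp only
    rw [this, hi]
    simp

open Classical in
/-- The formula for an induced character: the trace is the sum over the cosets fixed by `g`. -/
theorem character_coind [Fintype ι] [FiniteDimensional ℂ V] (hR : IsCosetReps H R)
    (ρ : Representation ℂ H V) (g : G) :
    (Representation.coind H.subtype ρ).character g
      = ∑ i, if h : R i * g * (R i)⁻¹ ∈ H then ρ.character ⟨_, h⟩ else 0 := by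
  rw [Representation.character, ← LinearMap.trace_conj' _ (hR.evalEquiv ρ), trace_pi_eq_sum]
  refine Finset.sum_congr rfl fun i _ => ?_
  have key : ∀ v : V, (LinearMap.proj i ∘ₗ (hR.evalEquiv ρ).conj
      (Representation.coind H.subtype ρ g) ∘ₗ LinearMap.single ℂ (fun _ => V) i) v
      = ρ ⟨_, hR.mul_inv_mem (R i * g)⟩
        ((Pi.single i v : ι → V) (hR.index (R i * g))) := fun v => rfl
  split_ifs with h
  · have hi := hR.index_eq h
    rw [Representation.character]
    congr 1
    ext v
    rw [key]
    have : (⟨_, hR.mul_inv_mem (R i * g)⟩ : H) = ⟨_, h⟩ := by ext; simp [hi]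
    rw [this, hi, Pi.single_eq_same]
  · have : hR.index (R i * g) ≠ i := fun hi => h (by
      have := hR.mul_inv_mem (R i * g)
      rwa [hi] at this)
    convert (LinearMap.trace ℂ V).map_zero using 2
    ext v
    rw [key, Pi.single_eq_of_ne this, map_zero, LinearMap.zero_apply]

end IsCosetReps

end Induced

theorem character_twist {H V : Type*} [Group H] [AddCommGroup V] [Module ℂ V]
    (α : H →* ℂˣ) (ρ : Representation ℂ H V) (h : H) :
    (twist α ρ).character h = (α h : ℂ) * ρ.character h := by
  simp [Representation.character, twist]

theorem character_trivial {H : Type*} [Group H] (h : H) :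
    (Representation.trivial ℂ H ℂ).character h = 1 := by
  simp [Representation.character, Representation.trivial]

theorem character_of_isConj {G V : Type*} [Group G] [AddCommGroup V] [Module ℂ V]
    (ρ : Representation ℂ G V) {g h : G} (hgh : IsConj g h) : ρ.character g = ρ.character h := by
  obtain ⟨c, rfl⟩ := isConj_iff.mp hgh
  exact (Representation.char_conj ρ g c).symm

/-! ### Coset representatives of the Siegel and Klingen parabolic subgroups -/

section Reps

variable {F : Type*} [Field F]

theorem mat_ofMatrix (M : Matrix (Fin 4) (Fin 4) F) (c : Fˣ) (h : Mᵀ * J F * M = (c : F) • J F) :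
    mat (ofMatrix M c h) = M := rfl

theorem mat_mul_mat_inv (g : GSp4 F) : mat g * mat g⁻¹ = 1 := by
  rw [← mat_mul, mul_inv_cancel, mat_one]

theorem mat_inv_mul_mat (g : GSp4 F) : mat g⁻¹ * mat g = 1 := by
  rw [← mat_mul, inv_mul_cancel, mat_one]

theorem mat_inv_eq {g : GSp4 F} {N : Matrix (Fin 4) (Fin 4) F} (h : mat g * N = 1) :
    mat g⁻¹ = N := by
  calc mat g⁻¹ = mat g⁻¹ * (mat g * N) := by rw [h, mul_one]
    _ = N := by rw [← mul_assoc, mat_inv_mul_mat, one_mul]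

theorem mat_injective : Function.Injective (mat : GSp4 F → Matrix (Fin 4) (Fin 4) F) :=
  fun _ _ h => Subtype.ext (Units.ext h)

theorem multiplier_spec (g : GSp4 F) :
    (mat g)ᵀ * J F * mat g = (multiplier g : F) • J F :=
  multiplierVal_spec g

/-- The transposed form of the defining relation of `GSp(4)`. -/
theorem mat_mul_J_mul_transpose (g : GSp4 F) :
    mat g * J F * (mat g)ᵀ = (multiplier g : F) • J F := by
  have h := multiplier_spec g
  have h1 : mat g * (J F * ((mat g)ᵀ * J F * mat g)) = -((multiplier g : F) • mat g) := by
    rw [h, Matrix.mul_smul, J_mul_J, Matrix.mul_smul, Matrix.mul_neg, Matrix.mul_one, smul_neg]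
  have h2 : mat g * J F * (mat g)ᵀ * J F = -((multiplier g : F) • 1) := by
    calc mat g * J F * (mat g)ᵀ * J F
        = (mat g * (J F * ((mat g)ᵀ * J F * mat g))) * mat g⁻¹ := by
          simp only [Matrix.mul_assoc, mat_mul_mat_inv, Matrix.mul_one]
      _ = _ := by rw [h1, Matrix.neg_mul, Matrix.smul_mul, mat_mul_mat_inv]
  calc mat g * J F * (mat g)ᵀ = -(mat g * J F * (mat g)ᵀ * J F * J F) := by
        rw [Matrix.mul_assoc _ (J F) (J F), J_mul_J, Matrix.mul_neg, Matrix.mul_one, neg_neg]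
    _ = _ := by rw [h2, Matrix.neg_mul, neg_neg, Matrix.smul_mul, Matrix.one_mul]

theorem multiplier_ofMatrix (M : Matrix (Fin 4) (Fin 4) F) (c : Fˣ)
    (h : Mᵀ * J F * M = (c : F) • J F) : multiplier (ofMatrix M c h) = c := by
  apply Units.ext
  have h1 := multiplier_spec (ofMatrix M c h)
  rw [mat_ofMatrix, h] at h1
  simpa [J] using (congrFun (congrFun h1 0) 3).symm

theorem multiplier_conj (x g : GSp4 F) : multiplier (x * g * x⁻¹) = multiplier g := by
  rw [map_mul, map_mul, map_inv, mul_comm, inv_mul_cancel_left]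

theorem mem_siegel_iff (h : GSp4 F) : h ∈ siegel F ↔
    mat h 2 0 = 0 ∧ mat h 2 1 = 0 ∧ mat h 3 0 = 0 ∧ mat h 3 1 = 0 := by
  constructor
  · intro hh
    refine ⟨hh ?_, hh ?_, hh ?_, hh ?_⟩ <;> simp
  · rintro ⟨h1, h2, h3, h4⟩ i j hij
    fin_cases i <;> fin_cases j <;> simp_all

/-- The bottom row alone decides whether an element lies in the Klingen subgroup. -/
theorem mem_klingen_iff (h : GSp4 F) : h ∈ klingen F ↔
    mat h 3 0 = 0 ∧ mat h 3 1 = 0 ∧ mat h 3 2 = 0 := by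
  constructor
  · intro hh
    refine ⟨hh ?_, hh ?_, hh ?_⟩ <;> simp
  · rintro ⟨h1, h2, h3⟩
    have hd : mat h 3 3 ≠ 0 := by
      intro h4
      have := congrFun (congrFun (mat_mul_mat_inv h) 3) 3
      simp [Matrix.mul_apply, Fin.sum_univ_four, h1, h2, h3, h4] at this
    have hJ := mat_mul_J_mul_transpose h
    have e1 := congrFun (congrFun hJ 1) 3
    have e2 := congrFun (congrFun hJ 2) 3
    simp [Matrix.mul_apply, Fin.sum_univ_four, J, h1, h2, h3, hd] at e1 e2
    intro i j hij
    fin_cases i <;> fin_cases j <;> simp_all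

/-- The isotropy of the span of the two bottom rows. -/
theorem bottom_isotropic (g : GSp4 F) : mat g 2 0 * mat g 3 3 + mat g 2 1 * mat g 3 2
    - mat g 2 2 * mat g 3 1 - mat g 2 3 * mat g 3 0 = 0 := by
  have e := congrFun (congrFun (mat_mul_J_mul_transpose g) 2) 3
  simp [Matrix.mul_apply, Fin.sum_univ_four, J] at e
  linear_combination e

/-- Parameters of the Lagrangian planes in `F⁴`, by Bruhat cells. -/
abbrev SiegelCell (F : Type*) := Unit ⊕ F ⊕ (F × F) ⊕ (F × F × F)

/-- Parameters of the lines in `F⁴`, by Bruhat cells. -/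
abbrev KlingenCell (F : Type*) := Unit ⊕ F ⊕ (F × F) ⊕ (F × F × F)

/-- Representatives of the cosets of the Siegel subgroup, the product of a Weyl group element
and a unipotent upper triangular matrix. The two bottom rows span the Lagrangian plane that
belongs to the coset. -/
def siegelRep : SiegelCell F → GSp4 F
  | .inl _ => 1
  | .inr (.inl t) => ofMatrix !![1, 0, 0, 0; 0, 0, 1, 0; 0, -1, -t, 0; 0, 0, 0, 1] 1 (by
      ext i j; fin_cases i <;> fin_cases j <;> simp [J, Matrix.mul_apply, Fin.sum_univ_four])
  | .inr (.inr (.inl (s, u))) =>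
    ofMatrix !![0, 0, 0, 1; 0, 1, 0, 0; 0, 0, 1, -s; -1, -s, 0, -u] 1 (by
      ext i j; fin_cases i <;> fin_cases j <;> simp [J, Matrix.mul_apply, Fin.sum_univ_four])
  | .inr (.inr (.inr (a, b, c))) =>
    ofMatrix !![0, 0, 1, 0; 0, 0, 0, 1; -1, 0, -a, -b; 0, -1, -c, -a] 1 (by
      ext i j; fin_cases i <;> fin_cases j <;> simp [J, Matrix.mul_apply, Fin.sum_univ_four])

/-- The matrices inverse to `siegelRep`. -/
def siegelRepInv : SiegelCell F → Matrix (Fin 4) (Fin 4) F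
  | .inl _ => 1
  | .inr (.inl t) => !![1, 0, 0, 0; 0, -t, -1, 0; 0, 1, 0, 0; 0, 0, 0, 1]
  | .inr (.inr (.inl (s, u))) => !![-u, -s, 0, -1; 0, 1, 0, 0; s, 0, 1, 0; 1, 0, 0, 0]
  | .inr (.inr (.inr (a, b, c))) => !![-a, -b, -1, 0; -c, -a, 0, -1; 1, 0, 0, 0; 0, 1, 0, 0]

theorem mat_siegelRep_inv (i : SiegelCell F) : mat (siegelRep i)⁻¹ = siegelRepInv i := by
  apply mat_inv_eq
  rcases i with _ | t | ⟨s, u⟩ | ⟨a, b, c⟩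
  · simp [siegelRep, siegelRepInv, mat_one]
  all_goals
    ext i j
    fin_cases i <;> fin_cases j <;>
      simp [siegelRep, siegelRepInv, mat_ofMatrix, Matrix.mul_apply, Fin.sum_univ_four]

/-- Representatives of the cosets of the Klingen subgroup, the product of a Weyl group element
and a unipotent upper triangular matrix. The bottom row spans the line that belongs to the
coset. -/
def klingenRep : KlingenCell F → GSp4 F
  | .inl _ => 1
  | .inr (.inl t) => ofMatrix !![0, 1, 0, 0; -1, -t, 0, 0; 0, 0, 0, 1; 0, 0, -1, t] (-1) (by
      ext i j; fin_cases i <;> fin_cases j <;> simp [J, Matrix.mul_apply, Fin.sum_univ_four])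
  | .inr (.inr (.inl (s, t))) =>
    ofMatrix !![0, 0, 1, 0; -1, 0, -t, 0; 0, 0, 0, 1; 0, 1, s, t] (-1) (by
      ext i j; fin_cases i <;> fin_cases j <;> simp [J, Matrix.mul_apply, Fin.sum_univ_four])
  | .inr (.inr (.inr (r, s, t))) =>
    ofMatrix !![0, 0, 0, 1; 0, 1, 0, s; 0, 0, 1, -r; -1, -r, -s, -t] 1 (by
      ext i j; fin_cases i <;> fin_cases j <;>
        simp [J, Matrix.mul_apply, Fin.sum_univ_four] <;> ring)

/-- The matrices inverse to `klingenRep`. -/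
def klingenRepInv : KlingenCell F → Matrix (Fin 4) (Fin 4) F
  | .inl _ => 1
  | .inr (.inl t) => !![-t, -1, 0, 0; 1, 0, 0, 0; 0, 0, t, -1; 0, 0, 1, 0]
  | .inr (.inr (.inl (s, t))) => !![-t, -1, 0, 0; -s, 0, -t, 1; 1, 0, 0, 0; 0, 0, 1, 0]
  | .inr (.inr (.inr (r, s, t))) => !![-t, -r, -s, -1; -s, 1, 0, 0; r, 0, 1, 0; 1, 0, 0, 0]

theorem mat_klingenRep_inv (i : KlingenCell F) : mat (klingenRep i)⁻¹ = klingenRepInv i := by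
  apply mat_inv_eq
  rcases i with _ | t | ⟨s, u⟩ | ⟨a, b, c⟩
  · simp [klingenRep, klingenRepInv, mat_one]
  all_goals
    ext i j
    fin_cases i <;> fin_cases j <;>
      simp [klingenRep, klingenRepInv, mat_ofMatrix, Matrix.mul_apply, Fin.sum_univ_four] <;> ring

/-- To check `IsCosetReps`, uniqueness need only be checked at the representatives. -/
theorem isCosetReps_of {G ι : Type*} [Group G] {H : Subgroup G} {R : ι → G}
    (h1 : ∀ g, ∃ i, g * (R i)⁻¹ ∈ H) (h2 : ∀ i j, R i * (R j)⁻¹ ∈ H → i = j) :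
    IsCosetReps H R := fun g => by
  obtain ⟨i, hi⟩ := h1 g
  refine ⟨i, hi, fun j hj => h2 _ _ ?_⟩
  have := H.mul_mem (H.inv_mem hj) hi
  simpa using this

theorem isCosetReps_siegelRep : IsCosetReps (siegel F) (siegelRep (F := F)) := by
  refine isCosetReps_of (fun g => ?_) fun i j h => ?_
  · simp only [mem_siegel_iff, mat_mul, mat_siegelRep_inv]
    have hiso := bottom_isotropic g
    generalize mat g = M at hiso ⊢
    -- the plane is given by its echelon form
    have main : ∀ p n : Fin 4 → F, (p 0 ≠ 0 ∨ p 1 ≠ 0) → n 0 = 0 → n 1 = 0 →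
        p 0 * n 3 + p 1 * n 2 = 0 → ∃ i : SiegelCell F,
          (∑ k, p k * siegelRepInv i k 0) = 0 ∧ (∑ k, p k * siegelRepInv i k 1) = 0 ∧
          (∑ k, n k * siegelRepInv i k 0) = 0 ∧ (∑ k, n k * siegelRepInv i k 1) = 0 := by
      intro p n hp h0 h1 h
      by_cases hp0 : p 0 = 0
      · have hp1 : p 1 ≠ 0 := by tauto
        have hn : n 2 = 0 := by simpa [hp0, hp1] using h
        refine ⟨.inr (.inl (p 2 / p 1)), ?_⟩
        simp [siegelRepInv, Fin.sum_univ_four, h0, h1, hp0, hn]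
        field_simp
        ring
      · refine ⟨.inr (.inr (.inl (p 1 / p 0, (p 3 + p 1 / p 0 * p 2) / p 0))), ?_⟩
        simp [siegelRepInv, Fin.sum_univ_four, h0, h1]
        refine ⟨?_, ?_, ?_⟩ <;> field_simp <;> first | ring1 | linear_combination h
    by_cases hdet : M 2 0 * M 3 1 - M 2 1 * M 3 0 = 0
    · by_cases h2 : M 2 0 = 0 ∧ M 2 1 = 0
      · by_cases h3 : M 3 0 = 0 ∧ M 3 1 = 0
        · exact ⟨.inl (), by simp [siegelRepInv, h2, h3]⟩
        · obtain ⟨i, e⟩ := main (M 3) (M 2) (by tauto) h2.1 h2.2 (by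
            linear_combination -hiso + M 3 3 * h2.1 + M 3 2 * h2.2)
          exact ⟨i, by simpa only [Matrix.mul_apply] using ⟨e.2.2.1, e.2.2.2, e.1, e.2.1⟩⟩
      · obtain ⟨β, hβ0, hβ1⟩ : ∃ β, M 3 0 = β * M 2 0 ∧ M 3 1 = β * M 2 1 := by
          by_cases h20 : M 2 0 = 0
          · have h21 : M 2 1 ≠ 0 := by tauto
            refine ⟨M 3 1 / M 2 1, ?_, by field_simp⟩
            have : M 3 0 = 0 := by simpa [h20, h21] using hdet
            simp [h20, this]
          · refine ⟨M 3 0 / M 2 0, by field_simp, ?_⟩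
            field_simp
            linear_combination hdet
        obtain ⟨i, e1, e2, e3, e4⟩ := main (M 2) (fun k => M 3 k - β * M 2 k) (by tauto)
          (by simp [hβ0]) (by simp [hβ1]) (by
            linear_combination hiso + M 2 2 * hβ1 + M 2 3 * hβ0)
        refine ⟨i, ?_⟩
        simp only [sub_mul, Finset.sum_sub_distrib, mul_assoc, ← Finset.mul_sum, e1, e2, mul_zero,
          sub_zero] at e3 e4
        simpa only [Matrix.mul_apply] using ⟨e1, e2, e3, e4⟩
    · obtain ⟨d, hd⟩ : ∃ d, d = M 2 0 * M 3 1 - M 2 1 * M 3 0 := ⟨_, rfl⟩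
      rw [← hd] at hdet
      refine ⟨.inr (.inr (.inr ((M 2 2 * M 3 1 - M 2 1 * M 3 2) / d,
        (M 2 3 * M 3 1 - M 2 1 * M 3 3) / d, (M 2 0 * M 3 2 - M 2 2 * M 3 0) / d))), ?_⟩
      simp [siegelRepInv, Matrix.mul_apply, Fin.sum_univ_four]
      refine ⟨?_, ?_, ?_, ?_⟩ <;> field_simp
      · linear_combination (M 2 2) * hd
      · linear_combination (M 2 1) * hiso + (M 2 3) * hd
      · linear_combination (M 3 2) * hd
      · linear_combination (M 3 1) * hiso + (M 3 3) * hd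
  · rw [mem_siegel_iff, mat_mul, mat_siegelRep_inv] at h
    rcases i with _ | t | ⟨s, u⟩ | ⟨a, b, c⟩ <;> rcases j with _ | t | ⟨s, u⟩ | ⟨a, b, c⟩ <;>
      simp [siegelRep, siegelRepInv, mat_one, mat_ofMatrix, Matrix.mul_apply,
        Fin.sum_univ_four] at h ⊢
    all_goals grind

theorem isCosetReps_klingenRep : IsCosetReps (klingen F) (klingenRep (F := F)) := by
  refine isCosetReps_of (fun g => ?_) fun i j h => ?_
  · simp only [mem_klingen_iff, mat_mul, mat_klingenRep_inv]
    generalize mat g = M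
    by_cases h0 : M 3 0 = 0
    · by_cases h1 : M 3 1 = 0
      · by_cases h2 : M 3 2 = 0
        · exact ⟨.inl (), by simp [klingenRepInv, h0, h1, h2]⟩
        · refine ⟨.inr (.inl (-(M 3 3 / M 3 2))), ?_⟩
          simp [klingenRepInv, Matrix.mul_apply, Fin.sum_univ_four, h0, h1]
          field_simp
          ring
      · refine ⟨.inr (.inr (.inl (M 3 2 / M 3 1, M 3 3 / M 3 1))), ?_⟩
        simp [klingenRepInv, Matrix.mul_apply, Fin.sum_univ_four, h0]
        constructor <;> field_simp <;> ring
    · refine ⟨.inr (.inr (.inr (M 3 1 / M 3 0, M 3 2 / M 3 0, M 3 3 / M 3 0))), ?_⟩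
      simp [klingenRepInv, Matrix.mul_apply, Fin.sum_univ_four]
      refine ⟨?_, ?_, ?_⟩ <;> field_simp <;> ring
  · rw [mem_klingen_iff, mat_mul, mat_klingenRep_inv] at h
    rcases i with _ | t | ⟨s, u⟩ | ⟨a, b, c⟩ <;> rcases j with _ | t | ⟨s, u⟩ | ⟨a, b, c⟩ <;>
      simp [klingenRep, klingenRepInv, mat_one, mat_ofMatrix, Matrix.mul_apply,
        Fin.sum_univ_four] at h ⊢
    all_goals grind

end Reps

/-! ### Sums over the fixed cosets -/

section FixedCosets

variable {F : Type*} [Field F]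

/-- A function on `GL(2)` that is constant on conjugacy classes. -/
def IsClassFun (ψ : GL (Fin 2) F → ℂ) : Prop := ∀ A B, ψ (B * A * B⁻¹) = ψ A

open Classical in
/-- The extension by zero of a function on `GL(2)` to all matrices. -/
def extendGL (ψ : GL (Fin 2) F → ℂ) (M : Matrix (Fin 2) (Fin 2) F) : ℂ :=
  if h : M.det ≠ 0 then ψ (Matrix.GeneralLinearGroup.mkOfDetNeZero M h) else 0

theorem extendGL_val (ψ : GL (Fin 2) F → ℂ) (A : GL (Fin 2) F) : extendGL ψ A.1 = ψ A := by
  have h : A.1.det ≠ 0 := (Matrix.isUnit_iff_isUnit_det _).mp A.isUnit |>.ne_zero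
  rw [extendGL, dif_pos h]
  congr 1
  exact Units.ext rfl

theorem extendGL_eq (ψ : GL (Fin 2) F → ℂ) {M : Matrix (Fin 2) (Fin 2) F} (A : GL (Fin 2) F)
    (h : M = A.1) : extendGL ψ M = ψ A := by
  rw [h, extendGL_val]

theorem extendGL_conj {ψ : GL (Fin 2) F → ℂ} (hψ : IsClassFun ψ)
    {M : Matrix (Fin 2) (Fin 2) F} (A B : GL (Fin 2) F) (h : M * B.1 = B.1 * A.1) :
    extendGL ψ M = ψ A := by
  rw [← hψ A B]
  apply extendGL_eq
  have : B.1 * (B⁻¹).1 = 1 := by rw [← Units.val_mul, mul_inv_cancel, Units.val_one]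
  rw [Units.val_mul, Units.val_mul, ← h, Matrix.mul_assoc, this, Matrix.mul_one]

theorem dg_val (a b : Fˣ) : (dg a b).1 = !![(a : F), 0; 0, (b : F)] := rfl

theorem jd_val (a : Fˣ) : (jd a).1 = !![(a : F), 1; 0, (a : F)] := rfl

theorem classFun_dg_comm {ψ : GL (Fin 2) F → ℂ} (hψ : IsClassFun ψ) (a b : Fˣ) :
    ψ (dg a b) = ψ (dg b a) := by
  rw [← extendGL_val ψ (dg a b)]
  refine extendGL_conj hψ _ (Matrix.GeneralLinearGroup.mkOfDetNeZero !![0, 1; 1, 0] (by simp)) ?_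
  ext i j
  fin_cases i <;> fin_cases j <;>
    simp [dg, Matrix.GeneralLinearGroup.mkOfDetNeZero, Matrix.mul_apply]

theorem extendGL_diag (ψ : GL (Fin 2) F → ℂ) (a b : Fˣ) :
    extendGL ψ !![(a : F), 0; 0, (b : F)] = ψ (dg a b) := extendGL_eq ψ _ rfl

theorem extendGL_upper {ψ : GL (Fin 2) F → ℂ} (hψ : IsClassFun ψ) {a b : Fˣ} (hab : a ≠ b)
    (p : F) : extendGL ψ !![(a : F), p; 0, (b : F)] = ψ (dg a b) := by
  have h : (b : F) - a ≠ 0 := sub_ne_zero.mpr fun h => hab (Units.ext h.symm)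
  refine extendGL_conj hψ _
    (Matrix.GeneralLinearGroup.mkOfDetNeZero !![1, p / (b - a); 0, 1] (by simp)) ?_
  ext i j
  fin_cases i <;> fin_cases j <;>
    simp [dg, Matrix.GeneralLinearGroup.mkOfDetNeZero, Matrix.mul_apply]
  field_simp
  ring

theorem extendGL_upper_self {ψ : GL (Fin 2) F → ℂ} (hψ : IsClassFun ψ) (a : Fˣ) {p : F}
    (hp : p ≠ 0) : extendGL ψ !![(a : F), p; 0, (a : F)] = ψ (jd a) := by
  refine extendGL_conj hψ _
    (Matrix.GeneralLinearGroup.mkOfDetNeZero !![p, 0; 0, 1] (by simpa using hp)) ?_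
  ext i j
  fin_cases i <;> fin_cases j <;>
    simp [jd, Matrix.GeneralLinearGroup.mkOfDetNeZero, Matrix.mul_apply, mul_comm]

theorem extendGL_lower_self {ψ : GL (Fin 2) F → ℂ} (hψ : IsClassFun ψ) (a : Fˣ) {p : F}
    (hp : p ≠ 0) : extendGL ψ !![(a : F), 0; p, (a : F)] = ψ (jd a) := by
  refine extendGL_conj hψ _
    (Matrix.GeneralLinearGroup.mkOfDetNeZero !![0, 1; p, 0] (by simpa using hp)) ?_
  ext i j
  fin_cases i <;> fin_cases j <;>
    simp [jd, Matrix.GeneralLinearGroup.mkOfDetNeZero, Matrix.mul_apply, mul_comm]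

open Classical in
/-- The contribution of the coset `i` to `siegelSum` at `g`, up to the factor from the
multiplier. -/
def siegelTerm (ψ : GL (Fin 2) F → ℂ) (i : SiegelCell F) (g : Matrix (Fin 4) (Fin 4) F) : ℂ :=
  let M := mat (siegelRep i) * g * siegelRepInv i
  if M 2 0 = 0 ∧ M 2 1 = 0 ∧ M 3 0 = 0 ∧ M 3 1 = 0 then
    extendGL ψ !![M 0 0, M 0 1; M 1 0, M 1 1] else 0

/-- The value at `g` of the class function of `GSp(4)` induced from the class function
`σ(c) ψ(A)` of the Siegel subgroup. -/
def siegelSum [Fintype F] (ψ : GL (Fin 2) F → ℂ) (σ : Fˣ →* ℂˣ) (g : GSp4 F) : ℂ :=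
  ev σ (multiplier g) * ∑ i, siegelTerm ψ i (mat g)

open Classical in
/-- The contribution of the coset `i` to `klingenSum` at `g`. -/
def klingenTerm (χ : Fˣ →* ℂˣ) (ψ : GL (Fin 2) F → ℂ) (i : KlingenCell F)
    (g : Matrix (Fin 4) (Fin 4) F) : ℂ :=
  let M := mat (klingenRep i) * g * klingenRepInv i
  if M 3 0 = 0 ∧ M 3 1 = 0 ∧ M 3 2 = 0 then
    MulChar.ofUnitHom χ (M 0 0) * extendGL ψ !![M 1 1, M 1 2; M 2 1, M 2 2] else 0

/-- The value at `g` of the class function of `GSp(4)` induced from the class function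
`χ(t) ψ(A)` of the Klingen subgroup. -/
def klingenSum [Fintype F] (χ : Fˣ →* ℂˣ) (ψ : GL (Fin 2) F → ℂ) (g : GSp4 F) : ℂ :=
  ∑ i, klingenTerm χ ψ i (mat g)

theorem mat_siegel_conj (i : SiegelCell F) (g : GSp4 F) :
    mat (siegelRep i * g * (siegelRep i)⁻¹) = mat (siegelRep i) * mat g * siegelRepInv i := by
  rw [mat_mul, mat_mul, mat_siegelRep_inv]

theorem mat_klingen_conj (i : KlingenCell F) (g : GSp4 F) :
    mat (klingenRep i * g * (klingenRep i)⁻¹)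
      = mat (klingenRep i) * mat g * klingenRepInv i := by
  rw [mat_mul, mat_mul, mat_klingenRep_inv]

open Classical in
theorem siegelSum_eq [Fintype F] (ψ : GL (Fin 2) F → ℂ) (σ : Fˣ →* ℂˣ) (g : GSp4 F) :
    siegelSum ψ σ g = ∑ i, if h : siegelRep i * g * (siegelRep i)⁻¹ ∈ siegel F then
      ev σ (multiplier g) * ψ (siegelBlock ⟨_, h⟩) else 0 := by
  rw [siegelSum, Finset.mul_sum]
  refine Finset.sum_congr rfl fun i _ => ?_
  by_cases h : siegelRep i * g * (siegelRep i)⁻¹ ∈ siegel F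
  · have h' := (mem_siegel_iff _).mp h
    rw [mat_siegel_conj] at h'
    rw [dif_pos h, siegelTerm, if_pos h']
    congr 1
    apply extendGL_eq
    rw [← mat_siegel_conj]
    rfl
  · have h' := mt (mem_siegel_iff _).mpr h
    rw [mat_siegel_conj] at h'
    rw [dif_neg h, siegelTerm, if_neg h', mul_zero]

open Classical in
theorem klingenSum_eq [Fintype F] (χ : Fˣ →* ℂˣ) (ψ : GL (Fin 2) F → ℂ) (g : GSp4 F) :
    klingenSum χ ψ g = ∑ i, if h : klingenRep i * g * (klingenRep i)⁻¹ ∈ klingen F then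
      ev χ (klingenFst ⟨_, h⟩) * ψ (klingenBlock ⟨_, h⟩) else 0 := by
  rw [klingenSum]
  refine Finset.sum_congr rfl fun i _ => ?_
  by_cases h : klingenRep i * g * (klingenRep i)⁻¹ ∈ klingen F
  · have h' := (mem_klingen_iff _).mp h
    rw [mat_klingen_conj] at h'
    rw [dif_pos h, klingenTerm, if_pos h', ← mat_klingen_conj]
    congr 1
    · exact MulChar.ofUnitHom_coe χ (klingenFst ⟨_, h⟩)
    · exact extendGL_eq _ _ rfl
  · have h' := mt (mem_klingen_iff _).mpr h
    rw [mat_klingen_conj] at h'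
    rw [dif_neg h, klingenTerm, if_neg h']

theorem siegelSum_eq_zero [Fintype F] (ψ : GL (Fin 2) F → ℂ) (σ : Fˣ →* ℂˣ) (g : GSp4 F)
    (h : ∀ x : GSp4 F, x * g * x⁻¹ ∉ siegel F) : siegelSum ψ σ g = 0 := by
  classical
  rw [siegelSum_eq]
  exact Finset.sum_eq_zero fun i _ => dif_neg (h _)

theorem klingenSum_eq_zero [Fintype F] (χ : Fˣ →* ℂˣ) (ψ : GL (Fin 2) F → ℂ) (g : GSp4 F)
    (h : ∀ x : GSp4 F, x * g * x⁻¹ ∉ klingen F) : klingenSum χ ψ g = 0 := by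
  classical
  rw [klingenSum_eq]
  exact Finset.sum_eq_zero fun i _ => dif_neg (h _)

section Solutions

variable [Fintype F]

open Classical in
/-- The number of solutions `t` of `t α = β`. -/
def numSol (α β : F) : ℂ := ∑ t : F, if t * α = β then 1 else 0

theorem numSol_of_ne {α : F} (h : α ≠ 0) (β : F) : numSol α β = 1 := by
  classical
  rw [numSol, Finset.sum_eq_single (β / α)]
  · simp [h]
  · intro t _ ht
    rw [if_neg]
    rintro rfl
    exact ht (by field_simp)
  · simp

theorem numSol_zero_zero : numSol (0 : F) 0 = Fintype.card F := by
  simp [numSol]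

theorem numSol_zero {β : F} (h : β ≠ 0) : numSol 0 β = 0 := by
  simp [numSol, h.symm]

end Solutions

end FixedCosets

/-! ### Split elements -/

section Split

theorem ite_eq_ite_mul {p q : Prop} [Decidable p] [Decidable q] {x y : ℂ} (h : p ↔ q)
    (hxy : p → x = y) : (if p then x else 0) = (if q then 1 else 0) * y := by
  by_cases hp : p
  · rw [if_pos hp, if_pos (h.mp hp), one_mul, hxy hp]
  · rw [if_neg hp, if_neg (mt h.mpr hp), zero_mul]

theorem ite_eq_ite_mul₂ {p q₁ q₂ : Prop} [Decidable p] [Decidable q₁] [Decidable q₂] {x y : ℂ}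
    (h : p ↔ q₁ ∧ q₂) (hxy : p → x = y) :
    (if p then x else 0) = (if q₁ then 1 else 0) * (if q₂ then 1 else 0) * y := by
  rw [ite_eq_ite_mul h hxy, ite_and]
  split_ifs <;> simp

theorem ite_eq_ite_mul₃ {p q₁ q₂ q₃ : Prop} [Decidable p] [Decidable q₁] [Decidable q₂]
    [Decidable q₃] {x y : ℂ} (h : p ↔ q₁ ∧ q₂ ∧ q₃) (hxy : p → x = y) :
    (if p then x else 0)
      = (if q₁ then 1 else 0) * ((if q₂ then 1 else 0) * (if q₃ then 1 else 0)) * y := by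
  rw [ite_eq_ite_mul h hxy, ite_and, ite_and]
  split_ifs <;> simp

theorem add_four_congr {a b c d a' b' c' d' : ℂ} (ha : a = a') (hb : b = b') (hc : c = c')
    (hd : d = d') : a + b + c + d = a' + b' + c' + d' := by
  rw [ha, hb, hc, hd]

theorem sum_cells {F : Type*} [Fintype F] (f : SiegelCell F → ℂ) :
    ∑ i, f i = f (.inl ()) + ∑ t, f (.inr (.inl t))
    + ∑ s, ∑ u, f (.inr (.inr (.inl (s, u))))
    + ∑ a, ∑ b, ∑ c, f (.inr (.inr (.inr (a, b, c)))) := by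
  simp only [Fintype.sum_sum_type, Fintype.sum_prod_type, add_assoc, Finset.univ_unique,
    Finset.sum_singleton]

variable {F : Type*} [Field F] [Fintype F]

/-- The matrices with an upper triangular `2 × 2` matrix in the corners and another one in the
middle, the other entries being zero. -/
def cornerMat (a b d e : Fˣ) (κ x : F) : Matrix (Fin 4) (Fin 4) F :=
  !![(a : F), 0, 0, κ; 0, (b : F), x, 0; 0, 0, (d : F), 0; 0, 0, 0, (e : F)]

/-- One summand for each cell; every factor `numSol` counts the values of a parameter of the cell
for which the plane is fixed. -/
theorem siegelSum_corner (ψ : GL (Fin 2) F → ℂ) (σ : Fˣ →* ℂˣ) {g : GSp4 F}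
    {a b d e : Fˣ} {κ x : F} (hg : mat g = cornerMat a b d e κ x) (h : a * e = b * d)
    (hab : a ≠ b) :
    siegelSum ψ σ g = ev σ (multiplier g) * (ψ (dg a b)
      + numSol (b - d : F) x * ψ (dg a d) + numSol (a - e : F) κ * ψ (dg e b)
      + numSol (a - d : F) 0 * (numSol (a - e : F) κ * numSol (b - d : F) x) * ψ (dg d e)) := by
  classical
  have hab' : (a : F) - b ≠ 0 := sub_ne_zero.mpr fun h => hab (Units.ext h)
  have h' : (a : F) * e = b * d := by exact_mod_cast congrArg Units.val h
  have hb := b.ne_zero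
  have ha := a.ne_zero
  rw [siegelSum, hg, sum_cells]
  refine congrArg _ (add_four_congr ?_ ?_ ?_ ?_)
  · simp [siegelTerm, siegelRep, siegelRepInv, mat_one, cornerMat, extendGL_diag]
  · rw [numSol, Finset.sum_mul]
    refine Finset.sum_congr rfl fun t _ => ite_eq_ite_mul ?_ fun _ => ?_
    · simp [siegelRep, siegelRepInv, mat_ofMatrix, cornerMat, Matrix.mul_apply,
        Fin.sum_univ_four]
      grind
    · simp [siegelRep, siegelRepInv, mat_ofMatrix, cornerMat, Matrix.mul_apply,
        Fin.sum_univ_four, extendGL_diag]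
  · rw [numSol, Finset.sum_mul, Finset.sum_eq_single 0]
    · refine Finset.sum_congr rfl fun t _ => ite_eq_ite_mul ?_ fun _ => ?_
      · simp [siegelRep, siegelRepInv, mat_ofMatrix, cornerMat, Matrix.mul_apply,
          Fin.sum_univ_four]
        grind
      · simp [siegelRep, siegelRepInv, mat_ofMatrix, cornerMat, Matrix.mul_apply,
          Fin.sum_univ_four, extendGL_diag]
    · intro s _ hs
      refine Finset.sum_eq_zero fun t _ => if_neg ?_
      simp [siegelRep, siegelRepInv, mat_ofMatrix, cornerMat, Matrix.mul_apply,
        Fin.sum_univ_four]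
      grind
    · simp
  · simp_rw [numSol, Finset.sum_mul_sum, Finset.sum_mul]
    refine Finset.sum_congr rfl fun m _ => ?_
    simp_rw [Finset.mul_sum, Finset.sum_mul]
    refine Finset.sum_congr rfl fun k _ => ?_
    refine Finset.sum_congr rfl fun y _ => ite_eq_ite_mul₃ ?_ fun _ => ?_
    · simp [siegelRep, siegelRepInv, mat_ofMatrix, cornerMat, Matrix.mul_apply,
        Fin.sum_univ_four]
      have h1 : (a * m + -(m * d) : F) = 0 → (b * m + -(m * e) : F) = 0 := fun h => by
        apply (mul_eq_zero_iff_left ha).mp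
        linear_combination (b : F) * h - m * h'
      grind
    · simp [siegelRep, siegelRepInv, mat_ofMatrix, cornerMat, Matrix.mul_apply,
        Fin.sum_univ_four, extendGL_diag]

/-- In contrast to `siegelSum_corner`, the fixed planes in the two-dimensional cell are not confined
to `s = 0`, and the block by which the element acts on them need not be diagonal. -/
theorem siegelSum_corner_self (ψ : GL (Fin 2) F → ℂ) (σ : Fˣ →* ℂˣ)
    {g : GSp4 F} {a d : Fˣ} {κ x : F} (hg : mat g = cornerMat a a d d κ x) :
    siegelSum ψ σ g = ev σ (multiplier g) * (ψ (dg a a)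
      + numSol (a - d : F) x * ψ (dg a d)
      + (∑ s, numSol (a - d : F) (κ + s ^ 2 * x) * extendGL ψ !![(d : F), 0; s * x, (a : F)])
      + numSol (a - d : F) 0 * (numSol (a - d : F) κ * numSol (a - d : F) x) * ψ (dg d d)) := by
  classical
  rw [siegelSum, hg, sum_cells]
  refine congrArg _ (add_four_congr ?_ ?_ ?_ ?_)
  · simp [siegelTerm, siegelRep, siegelRepInv, mat_one, cornerMat, extendGL_diag]
  · rw [numSol, Finset.sum_mul]
    refine Finset.sum_congr rfl fun t _ => ite_eq_ite_mul ?_ fun _ => ?_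
    · simp [siegelRep, siegelRepInv, mat_ofMatrix, cornerMat, Matrix.mul_apply,
        Fin.sum_univ_four]
      grind
    · simp [siegelRep, siegelRepInv, mat_ofMatrix, cornerMat, Matrix.mul_apply,
        Fin.sum_univ_four, extendGL_diag]
  · refine Finset.sum_congr rfl fun s _ => ?_
    rw [numSol, Finset.sum_mul]
    refine Finset.sum_congr rfl fun t _ => ite_eq_ite_mul ?_ fun _ => ?_
    · simp [siegelRep, siegelRepInv, mat_ofMatrix, cornerMat, Matrix.mul_apply,
        Fin.sum_univ_four]
      grind
    · simp [siegelRep, siegelRepInv, mat_ofMatrix, cornerMat, Matrix.mul_apply,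
        Fin.sum_univ_four, mul_comm x s]
  · simp_rw [numSol, Finset.sum_mul_sum, Finset.sum_mul]
    refine Finset.sum_congr rfl fun m _ => ?_
    simp_rw [Finset.mul_sum, Finset.sum_mul]
    refine Finset.sum_congr rfl fun k _ => ?_
    refine Finset.sum_congr rfl fun y _ => ite_eq_ite_mul₃ ?_ fun _ => ?_
    · simp [siegelRep, siegelRepInv, mat_ofMatrix, cornerMat, Matrix.mul_apply,
        Fin.sum_univ_four]
      grind
    · simp [siegelRep, siegelRepInv, mat_ofMatrix, cornerMat, Matrix.mul_apply,
        Fin.sum_univ_four, extendGL_diag]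

/-- One summand for each cell. Where `χ` is evaluated at an eigenvalue of the corners, the block is
the one in the middle, and vice versa. -/
theorem klingenSum_corner (χ : Fˣ →* ℂˣ) (ψ : GL (Fin 2) F → ℂ) {g : GSp4 F}
    {a b d e : Fˣ} {κ x : F} (hg : mat g = cornerMat a b d e κ x) (h : a * e = b * d)
    (hab : a ≠ b) :
    klingenSum χ ψ g = ev χ a * extendGL ψ !![(b : F), x; 0, (d : F)]
      + ev χ b * extendGL ψ !![(a : F), -κ; 0, (e : F)]
      + numSol (b - d : F) x * numSol (b - e : F) 0
        * (ev χ d * extendGL ψ !![(a : F), -κ; 0, (e : F)])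
      + numSol (a - d : F) 0 * numSol (a - e : F) κ
        * (ev χ e * extendGL ψ !![(b : F), x; 0, (d : F)]) := by
  classical
  have hab' : (a : F) - b ≠ 0 := sub_ne_zero.mpr fun h => hab (Units.ext h)
  have h' : (a : F) * e = b * d := by exact_mod_cast congrArg Units.val h
  have hb := b.ne_zero
  have ha := a.ne_zero
  have hde : (e : F) - d ≠ 0 := by
    intro hde
    apply hab'
    apply mul_right_cancel₀ d.ne_zero
    linear_combination h' - (a : F) * hde
  rw [klingenSum, hg]
  refine (sum_cells _).trans (add_four_congr ?_ ?_ ?_ ?_)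
  · simp [klingenTerm, klingenRep, klingenRepInv, mat_one, cornerMat]
  · rw [Finset.sum_eq_single 0]
    · simp [klingenTerm, klingenRep, klingenRepInv, mat_ofMatrix, cornerMat, Matrix.mul_apply,
        Fin.sum_univ_four]
    · intro s _ hs
      refine if_neg ?_
      simp [klingenRep, klingenRepInv, mat_ofMatrix, cornerMat, Matrix.mul_apply,
        Fin.sum_univ_four]
      grind
    · simp
  · simp_rw [numSol, Finset.sum_mul_sum, Finset.sum_mul]
    refine Finset.sum_congr rfl fun s _ => ?_
    refine Finset.sum_congr rfl fun t _ => ite_eq_ite_mul₂ ?_ fun _ => ?_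
    · simp [klingenRep, klingenRepInv, mat_ofMatrix, cornerMat, Matrix.mul_apply,
        Fin.sum_univ_four]
      grind
    · simp [klingenRep, klingenRepInv, mat_ofMatrix, cornerMat, Matrix.mul_apply,
        Fin.sum_univ_four]
  · rw [Finset.sum_eq_single 0]
    · simp_rw [numSol, Finset.sum_mul_sum, Finset.sum_mul]
      refine Finset.sum_congr rfl fun s _ => ?_
      refine Finset.sum_congr rfl fun t _ => ite_eq_ite_mul₂ ?_ fun _ => ?_
      · simp [klingenRep, klingenRepInv, mat_ofMatrix, cornerMat, Matrix.mul_apply,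
          Fin.sum_univ_four]
        grind
      · simp [klingenRep, klingenRepInv, mat_ofMatrix, cornerMat, Matrix.mul_apply,
          Fin.sum_univ_four]
    · intro s _ hs
      refine Finset.sum_eq_zero fun t _ => Finset.sum_eq_zero fun t _ => if_neg ?_
      simp [klingenRep, klingenRepInv, mat_ofMatrix, cornerMat, Matrix.mul_apply,
        Fin.sum_univ_four]
      grind
    · simp

theorem klingenSum_corner_self (χ : Fˣ →* ℂˣ) (ψ : GL (Fin 2) F → ℂ) {g : GSp4 F}
    {a d : Fˣ} {κ x : F} (hg : mat g = cornerMat a a d d κ x) :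
    klingenSum χ ψ g = ev χ a * extendGL ψ !![(a : F), x; 0, (d : F)]
      + (∑ t, ev χ a * extendGL ψ !![(a : F), -(κ + t ^ 2 * x); 0, (d : F)])
      + numSol (a - d : F) x * numSol (a - d : F) 0
        * (ev χ d * extendGL ψ !![(a : F), -κ; 0, (d : F)])
      + ∑ r, numSol (a - d : F) (r * x) * numSol (a - d : F) κ
        * (ev χ d * extendGL ψ !![(a : F), x; 0, (d : F)]) := by
  classical
  rw [klingenSum, hg]
  refine (sum_cells _).trans (add_four_congr ?_ ?_ ?_ ?_)
  · simp [klingenTerm, klingenRep, klingenRepInv, mat_one, cornerMat]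
  · refine Finset.sum_congr rfl fun t _ => ?_
    rw [klingenTerm, if_pos]
    · congr 2
      · simp [klingenRep, klingenRepInv, mat_ofMatrix, cornerMat, Matrix.mul_apply,
          Fin.sum_univ_four]
      · simp [klingenRep, klingenRepInv, mat_ofMatrix, cornerMat, Matrix.mul_apply,
          Fin.sum_univ_four]
        ring
    · simp [klingenRep, klingenRepInv, mat_ofMatrix, cornerMat, Matrix.mul_apply,
        Fin.sum_univ_four]
      ring
  · simp_rw [numSol, Finset.sum_mul_sum, Finset.sum_mul]
    refine Finset.sum_congr rfl fun s _ => ?_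
    refine Finset.sum_congr rfl fun t _ => ite_eq_ite_mul₂ ?_ fun _ => ?_
    · simp [klingenRep, klingenRepInv, mat_ofMatrix, cornerMat, Matrix.mul_apply,
        Fin.sum_univ_four]
      grind
    · simp [klingenRep, klingenRepInv, mat_ofMatrix, cornerMat, Matrix.mul_apply,
        Fin.sum_univ_four]
  · refine Finset.sum_congr rfl fun r _ => ?_
    simp_rw [numSol, Finset.sum_mul_sum, Finset.sum_mul]
    refine Finset.sum_congr rfl fun s _ => ?_
    refine Finset.sum_congr rfl fun t _ => ite_eq_ite_mul₂ ?_ fun _ => ?_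
    · simp [klingenRep, klingenRepInv, mat_ofMatrix, cornerMat, Matrix.mul_apply,
        Fin.sum_univ_four]
      constructor
      · rintro ⟨h1, -, h3⟩
        exact ⟨by linear_combination h3, by linear_combination h1 - r * h3⟩
      · rintro ⟨h1, h2⟩
        exact ⟨by linear_combination h2 + r * h1, by ring, by linear_combination h1⟩
    · simp [klingenRep, klingenRepInv, mat_ofMatrix, cornerMat, Matrix.mul_apply,
        Fin.sum_univ_four]

end Split

/-! ### Elements with a Jordan block in the Siegel Levi subgroup -/

section Jordan

variable {F : Type*} [Field F]

/-- The matrix of the product of `siegelLevi (jd a) (a * d)` and `siegelUnip 0 0 x`. -/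
def jordanMat (a d : Fˣ) (x : F) : Matrix (Fin 4) (Fin 4) F :=
  !![(a : F), 1, x, 0; 0, (a : F), a * x, 0; 0, 0, (d : F), -(d / a); 0, 0, 0, (d : F)]

variable [Fintype F]

theorem siegelSum_jordan {ψ : GL (Fin 2) F → ℂ} (hψ : IsClassFun ψ) (σ : Fˣ →* ℂˣ) {g : GSp4 F}
    {a d : Fˣ} (hg : mat g = jordanMat a d 0) (had : a ≠ d) :
    siegelSum ψ σ g = ev σ (multiplier g) * (ψ (jd a) + ψ (jd d) + ψ (dg a d)) := by
  classical
  have had' : (a : F) - d ≠ 0 := sub_ne_zero.mpr fun h => had (Units.ext h)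
  have ha := a.ne_zero
  have hd := d.ne_zero
  rw [siegelSum, hg, sum_cells]
  refine congrArg _ ((add_four_congr (a' := ψ (jd a)) (b' := ψ (dg a d)) (c' := 0)
    (d' := ψ (jd d)) ?_ ?_ ?_ ?_).trans (by ring))
  · simp [siegelTerm, siegelRep, siegelRepInv, mat_one, jordanMat]
    exact extendGL_eq ψ _ rfl
  · rw [Finset.sum_eq_single 0]
    · simp [siegelTerm, siegelRep, siegelRepInv, mat_ofMatrix, jordanMat, Matrix.mul_apply,
        Fin.sum_univ_four, extendGL_upper hψ had]
    · intro t _ ht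
      refine if_neg ?_
      simp [siegelRep, siegelRepInv, mat_ofMatrix, jordanMat, Matrix.mul_apply,
        Fin.sum_univ_four]
      grind
    · simp
  · refine Finset.sum_eq_zero fun s _ => Finset.sum_eq_zero fun u _ => if_neg ?_
    simp [siegelRep, siegelRepInv, mat_ofMatrix, jordanMat, Matrix.mul_apply,
        Fin.sum_univ_four]
    grind
  · have hz : ∀ m k y : F, (m, k, y) ≠ (0, 0, 0) →
        siegelTerm ψ (.inr (.inr (.inr (m, k, y)))) (jordanMat a d 0) = 0 := by
      intro m k y hne
      refine if_neg fun h => hne ?_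
      simp [siegelRep, siegelRepInv, mat_ofMatrix, jordanMat, Matrix.mul_apply,
        Fin.sum_univ_four] at h
      obtain ⟨h1, h2, h3, h4⟩ := h
      have hy : y = 0 := by grind
      subst hy
      have hm : m = 0 := by grind
      subst hm
      have hk : k = 0 := by grind
      rw [hk]
    rw [Finset.sum_eq_single 0, Finset.sum_eq_single 0, Finset.sum_eq_single 0]
    · simp [siegelTerm, siegelRep, siegelRepInv, mat_ofMatrix, jordanMat, Matrix.mul_apply,
        Fin.sum_univ_four]
      exact extendGL_upper_self hψ d (neg_ne_zero.mpr (div_ne_zero hd ha))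
    · intro y _ hy
      exact hz _ _ _ (by simpa using hy)
    · simp
    · intro y _ hy
      exact Finset.sum_eq_zero fun _ _ => hz _ _ _ (by simp [hy])
    · simp
    · intro y _ hy
      exact Finset.sum_eq_zero fun _ _ => Finset.sum_eq_zero fun _ _ => hz _ _ _ (by simp [hy])
    · simp

theorem siegelSum_jordan_self (ψ : GL (Fin 2) F → ℂ) (σ : Fˣ →* ℂˣ) {g : GSp4 F}
    {a : Fˣ} {x : F} (hg : mat g = jordanMat a a x) (hx : x ≠ 0) :
    siegelSum ψ σ g = ev σ (multiplier g) * ψ (jd a) := by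
  classical
  have ha := a.ne_zero
  rw [siegelSum, hg, sum_cells]
  refine congrArg _ ((add_four_congr (a' := ψ (jd a)) (b' := 0) (c' := 0)
    (d' := 0) ?_ ?_ ?_ ?_).trans (by ring))
  · simp [siegelTerm, siegelRep, siegelRepInv, mat_one, jordanMat]
    exact extendGL_eq ψ _ rfl
  · refine Finset.sum_eq_zero fun s _ => if_neg ?_
    simp [siegelRep, siegelRepInv, mat_ofMatrix, jordanMat, Matrix.mul_apply,
        Fin.sum_univ_four]
    grind
  · refine Finset.sum_eq_zero fun s _ => Finset.sum_eq_zero fun u _ => if_neg ?_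
    simp [siegelRep, siegelRepInv, mat_ofMatrix, jordanMat, Matrix.mul_apply,
        Fin.sum_univ_four]
    grind
  · refine Finset.sum_eq_zero fun s _ => Finset.sum_eq_zero fun u _ =>
      Finset.sum_eq_zero fun u _ => if_neg ?_
    simp [siegelRep, siegelRepInv, mat_ofMatrix, jordanMat, Matrix.mul_apply,
        Fin.sum_univ_four]
    grind

theorem klingenSum_jordan (χ : Fˣ →* ℂˣ) {ψ : GL (Fin 2) F → ℂ} (hψ : IsClassFun ψ) {g : GSp4 F}
    {a d : Fˣ} (hg : mat g = jordanMat a d 0) (had : a ≠ d) :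
    klingenSum χ ψ g = (ev χ a + ev χ d) * ψ (dg a d) := by
  classical
  have had' : (a : F) - d ≠ 0 := sub_ne_zero.mpr fun h => had (Units.ext h)
  have ha := a.ne_zero
  have hd := d.ne_zero
  rw [klingenSum, hg]
  refine (sum_cells _).trans ((add_four_congr (a' := ev χ a * ψ (dg a d)) (b' := 0)
    (c' := ev χ d * ψ (dg a d)) (d' := 0) ?_ ?_ ?_ ?_).trans (by ring))
  · simp [klingenTerm, klingenRep, klingenRepInv, mat_one, jordanMat, extendGL_diag]
  · refine Finset.sum_eq_zero fun s _ => if_neg ?_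
    simp [klingenRep, klingenRepInv, mat_ofMatrix, jordanMat, Matrix.mul_apply,
        Fin.sum_univ_four]
    grind
  · have hz : ∀ m k : F, (m, k) ≠ (0, 0) →
        klingenTerm χ ψ (.inr (.inr (.inl (m, k)))) (jordanMat a d 0) = 0 := by
      intro m k hne
      refine if_neg fun h => hne ?_
      simp [klingenRep, klingenRepInv, mat_ofMatrix, jordanMat, Matrix.mul_apply,
        Fin.sum_univ_four] at h
      obtain ⟨h1, h2⟩ := h
      have hm : m = 0 := by grind
      subst hm
      have hk : k = 0 := by grind
      rw [hk]
    rw [Finset.sum_eq_single 0, Finset.sum_eq_single 0]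
    · simp [klingenTerm, klingenRep, klingenRepInv, mat_ofMatrix, jordanMat, Matrix.mul_apply,
        Fin.sum_univ_four]
      exact extendGL_upper hψ had _
    · intro y _ hy
      exact hz _ _ (by simpa using hy)
    · simp
    · intro y _ hy
      exact Finset.sum_eq_zero fun _ _ => hz _ _ (by simp [hy])
    · simp
  · refine Finset.sum_eq_zero fun s _ => Finset.sum_eq_zero fun u _ =>
      Finset.sum_eq_zero fun u _ => if_neg ?_
    simp [klingenRep, klingenRepInv, mat_ofMatrix, jordanMat, Matrix.mul_apply,
        Fin.sum_univ_four]
    grind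

theorem klingenSum_jordan_self (χ : Fˣ →* ℂˣ) {ψ : GL (Fin 2) F → ℂ} (hψ : IsClassFun ψ)
    {g : GSp4 F} {a : Fˣ} {x : F} (hg : mat g = jordanMat a a x) (hx : x ≠ 0) :
    klingenSum χ ψ g = ev χ a * ψ (jd a) := by
  classical
  have ha := a.ne_zero
  rw [klingenSum, hg]
  refine (sum_cells _).trans ((add_four_congr (a' := ev χ a * ψ (jd a)) (b' := 0)
    (c' := 0) (d' := 0) ?_ ?_ ?_ ?_).trans (by ring))
  · simp [klingenTerm, klingenRep, klingenRepInv, mat_one, jordanMat]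
    exact extendGL_upper_self hψ a (mul_ne_zero ha hx)
  · refine Finset.sum_eq_zero fun s _ => if_neg ?_
    simp [klingenRep, klingenRepInv, mat_ofMatrix, jordanMat, Matrix.mul_apply,
        Fin.sum_univ_four]
    grind
  · refine Finset.sum_eq_zero fun s _ => Finset.sum_eq_zero fun u _ => if_neg ?_
    simp [klingenRep, klingenRepInv, mat_ofMatrix, jordanMat, Matrix.mul_apply,
        Fin.sum_univ_four]
    grind
  · refine Finset.sum_eq_zero fun s _ => Finset.sum_eq_zero fun u _ =>
      Finset.sum_eq_zero fun u _ => if_neg ?_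
    simp [klingenRep, klingenRepInv, mat_ofMatrix, jordanMat, Matrix.mul_apply,
        Fin.sum_univ_four]
    grind

end Jordan

/-! ### Elements with an elliptic block -/

section EllipticSums

variable {F : Type*} [Field F]

/-- The companion matrix of `X² - T X + N`. -/
def companion (N : Fˣ) (T : F) : GL (Fin 2) F :=
  Matrix.GeneralLinearGroup.mkOfDetNeZero !![0, -(N : F); 1, T] (by simp)

theorem companion_val (N : Fˣ) (T : F) : (companion N T).1 = !![0, -(N : F); 1, T] := rfl

/-- The matrix of the product of `siegelLevi (companion N T) (r * N)` and
`siegelUnip μ κ y`. -/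
def ellSiegelMat (N r : Fˣ) (T μ κ y : F) : Matrix (Fin 4) (Fin 4) F :=
  !![0, -(N : F), -(N * y), -(N * μ); 1, T, μ + T * y, κ + T * μ;
    0, 0, 0, r * N; 0, 0, -(r : F), r * T]

/-- The matrix of the product of `klingenLevi t (companion N T)` and `siegelUnip 0 κ 0`. -/
def ellKlingenMat (t N : Fˣ) (T κ : F) : Matrix (Fin 4) (Fin 4) F :=
  !![(t : F), 0, 0, t * κ; 0, 0, -(N : F), 0; 0, 1, T, 0; 0, 0, 0, N / t]

variable [Fintype F]

open Classical in
/-- The number of solutions of the equation saying that a Lagrangian plane in the open cell is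
fixed by `ellSiegelMat N r T μ κ y`. -/
def ellSiegelCount (N r : Fˣ) (T μ κ y : F) : ℂ :=
  ∑ m : F, ∑ k : F, ∑ z : F,
    if N * z - r * k = N * y ∧ (1 + r) * N * m + r * T * k = N * μ ∧
      (1 + r) * m + T * z = μ + T * y ∧ k + T * m - r * (z * N + m * T) = κ + T * μ
    then 1 else 0

/-- The intermediate cells contain no fixed plane, as the block has no eigenvalue in `F`. -/
theorem siegelSum_ell {ψ : GL (Fin 2) F → ℂ} (hψ : IsClassFun ψ) (σ : Fˣ →* ℂˣ) {g : GSp4 F}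
    {N r : Fˣ} {T μ κ y : F} (hirr : ∀ s : F, s ^ 2 - T * s + N ≠ 0)
    (hg : mat g = ellSiegelMat N r T μ κ y) :
    siegelSum ψ σ g = ev σ (multiplier g) * (ψ (companion N T)
      + ellSiegelCount N r T μ κ y * ψ (companion (r ^ 2 * N) (r * T))) := by
  classical
  have hN := N.ne_zero
  have hr := r.ne_zero
  rw [siegelSum, hg, sum_cells]
  refine congrArg _ ((add_four_congr (a' := ψ (companion N T)) (b' := 0) (c' := 0)
    (d' := ellSiegelCount N r T μ κ y * ψ (companion (r ^ 2 * N) (r * T)))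
    ?_ ?_ ?_ ?_).trans (by ring))
  · simp [siegelTerm, siegelRep, siegelRepInv, mat_one, ellSiegelMat]
    exact extendGL_eq ψ _ rfl
  · refine Finset.sum_eq_zero fun s _ => if_neg ?_
    simp [siegelRep, siegelRepInv, mat_ofMatrix, ellSiegelMat, Matrix.mul_apply,
        Fin.sum_univ_four]
  · refine Finset.sum_eq_zero fun s _ => Finset.sum_eq_zero fun u _ => if_neg ?_
    simp [siegelRep, siegelRepInv, mat_ofMatrix, ellSiegelMat, Matrix.mul_apply,
        Fin.sum_univ_four]
    intro h
    refine absurd ?_ (hirr s)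
    apply (mul_eq_zero_iff_left hr).mp
    linear_combination h
  · rw [ellSiegelCount, Finset.sum_mul]
    refine Finset.sum_congr rfl fun m _ => ?_
    rw [Finset.sum_mul]
    refine Finset.sum_congr rfl fun k _ => ?_
    rw [Finset.sum_mul]
    refine Finset.sum_congr rfl fun z _ => ite_eq_ite_mul ?_ fun _ => ?_
    · simp [siegelRep, siegelRepInv, mat_ofMatrix, ellSiegelMat, Matrix.mul_apply,
        Fin.sum_univ_four]
      grind
    · refine extendGL_conj hψ _
        (Matrix.GeneralLinearGroup.mkOfDetNeZero !![-(r : F)⁻¹, 0; 0, 1] (by simp)) ?_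
      ext i j
      fin_cases i <;> fin_cases j <;>
        simp [siegelRep, siegelRepInv, mat_ofMatrix, ellSiegelMat, Matrix.mul_apply,
          Fin.sum_univ_four, companion, Matrix.GeneralLinearGroup.mkOfDetNeZero]
      field_simp

/-- An element acting on a Lagrangian plane and on the quotient by matrices without eigenvalues in
`F` fixes no line. -/
theorem klingenSum_ell (χ : Fˣ →* ℂˣ) (ψ : GL (Fin 2) F → ℂ) {g : GSp4 F}
    {N r : Fˣ} {T μ κ y : F} (hirr : ∀ s : F, s ^ 2 - T * s + N ≠ 0)
    (hg : mat g = ellSiegelMat N r T μ κ y) : klingenSum χ ψ g = 0 := by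
  classical
  have hN := N.ne_zero
  have hr := r.ne_zero
  rw [klingenSum, hg]
  refine (sum_cells _).trans ((add_four_congr (a' := 0) (b' := 0) (c' := 0) (d' := 0)
    ?_ ?_ ?_ ?_).trans (by ring))
  · simp [klingenTerm, klingenRep, klingenRepInv, mat_one, ellSiegelMat]
  · refine Finset.sum_eq_zero fun s _ => if_neg ?_
    simp [klingenRep, klingenRepInv, mat_ofMatrix, ellSiegelMat, Matrix.mul_apply,
        Fin.sum_univ_four]
    have := hirr s
    grind
  · refine Finset.sum_eq_zero fun s _ => Finset.sum_eq_zero fun u _ => if_neg ?_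
    simp [klingenRep, klingenRepInv, mat_ofMatrix, ellSiegelMat, Matrix.mul_apply,
        Fin.sum_univ_four]
  · refine Finset.sum_eq_zero fun s _ => Finset.sum_eq_zero fun u _ =>
      Finset.sum_eq_zero fun u _ => if_neg ?_
    simp [klingenRep, klingenRepInv, mat_ofMatrix, ellSiegelMat, Matrix.mul_apply,
        Fin.sum_univ_four]
    have := hirr s
    grind

/-- The composition factors have dimensions `1`, `2`, `1`, while those of a Lagrangian plane and of
the quotient by it would have equal dimensions. -/
theorem siegelSum_ellKlingen (ψ : GL (Fin 2) F → ℂ) (σ : Fˣ →* ℂˣ) {g : GSp4 F}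
    {t N : Fˣ} {T κ : F} (hirr : ∀ s : F, s ^ 2 - T * s + N ≠ 0)
    (hg : mat g = ellKlingenMat t N T κ) : siegelSum ψ σ g = 0 := by
  classical
  rw [siegelSum, hg, sum_cells]
  refine (congrArg _ ((add_four_congr (a' := 0) (b' := 0) (c' := 0) (d' := 0)
    ?_ ?_ ?_ ?_).trans (by ring))).trans (mul_zero _)
  · simp [siegelTerm, siegelRep, siegelRepInv, mat_one, ellKlingenMat]
  · refine Finset.sum_eq_zero fun s _ => if_neg ?_
    simp [siegelRep, siegelRepInv, mat_ofMatrix, ellKlingenMat, Matrix.mul_apply,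
        Fin.sum_univ_four]
    have := hirr s
    grind
  · refine Finset.sum_eq_zero fun s _ => Finset.sum_eq_zero fun u _ => if_neg ?_
    simp [siegelRep, siegelRepInv, mat_ofMatrix, ellKlingenMat, Matrix.mul_apply,
        Fin.sum_univ_four]
  · refine Finset.sum_eq_zero fun s _ => Finset.sum_eq_zero fun u _ =>
      Finset.sum_eq_zero fun c _ => if_neg ?_
    simp [siegelRep, siegelRepInv, mat_ofMatrix, ellKlingenMat, Matrix.mul_apply,
        Fin.sum_univ_four]
    have := hirr c
    grind

/-- The fixed lines lie in the span of the first and last coordinates. -/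
theorem klingenSum_ellKlingen (χ : Fˣ →* ℂˣ) (ψ : GL (Fin 2) F → ℂ) {g : GSp4 F}
    {t N : Fˣ} {T κ : F} (hirr : ∀ s : F, s ^ 2 - T * s + N ≠ 0)
    (hg : mat g = ellKlingenMat t N T κ) :
    klingenSum χ ψ g = (ev χ t + numSol (t - N / t : F) (t * κ) * ev χ (N / t))
      * ψ (companion N T) := by
  classical
  have ht := t.ne_zero
  rw [klingenSum, hg]
  refine (sum_cells _).trans ((add_four_congr (a' := ev χ t * ψ (companion N T)) (b' := 0)
    (c' := 0) (d' := numSol (t - N / t : F) (t * κ) * (ev χ (N / t) * ψ (companion N T)))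
    ?_ ?_ ?_ ?_).trans (by ring))
  · simp [klingenTerm, klingenRep, klingenRepInv, mat_one, ellKlingenMat]
    exact extendGL_eq ψ _ rfl
  · refine Finset.sum_eq_zero fun s _ => if_neg ?_
    simp [klingenRep, klingenRepInv, mat_ofMatrix, ellKlingenMat, Matrix.mul_apply,
        Fin.sum_univ_four]
  · refine Finset.sum_eq_zero fun s _ => Finset.sum_eq_zero fun u _ => if_neg ?_
    simp [klingenRep, klingenRepInv, mat_ofMatrix, ellKlingenMat, Matrix.mul_apply,
        Fin.sum_univ_four]
    have := hirr s
    grind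
  · have hz : ∀ r s u : F, (r, s) ≠ (0, 0) →
        klingenTerm χ ψ (.inr (.inr (.inr (r, s, u)))) (ellKlingenMat t N T κ) = 0 := by
      intro r s u hne
      refine if_neg fun h => hne ?_
      simp [klingenRep, klingenRepInv, mat_ofMatrix, ellKlingenMat, Matrix.mul_apply,
        Fin.sum_univ_four] at h
      obtain ⟨h1, h2, h3⟩ := h
      have hs : s = t * r := by linear_combination -h2
      subst hs
      have hr : r * ((t : F) ^ 2 - T * t + N) = 0 := by linear_combination h3
      have : r = 0 := by simpa [hirr] using hr
      simp [this]
    rw [Finset.sum_eq_single 0, Finset.sum_eq_single 0]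
    · rw [numSol, Finset.sum_mul]
      refine Finset.sum_congr rfl fun u _ => ite_eq_ite_mul ?_ fun _ => ?_
      · simp [klingenRep, klingenRepInv, mat_ofMatrix, ellKlingenMat, Matrix.mul_apply,
          Fin.sum_univ_four]
        grind
      · congr 1
        · refine Eq.trans ?_ (MulChar.ofUnitHom_coe χ (N / t))
          simp [klingenRep, klingenRepInv, mat_ofMatrix, ellKlingenMat, Matrix.mul_apply,
            Fin.sum_univ_four]
        · refine extendGL_eq ψ _ ?_
          simp [klingenRep, klingenRepInv, mat_ofMatrix, ellKlingenMat, Matrix.mul_apply,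
            Fin.sum_univ_four, companion_val]
    · intro y _ hy
      exact Finset.sum_eq_zero fun _ _ => hz _ _ _ (by simpa using hy)
    · simp
    · intro y _ hy
      exact Finset.sum_eq_zero fun _ _ => Finset.sum_eq_zero fun _ _ => hz _ _ _ (by simp [hy])
    · simp

end EllipticSums

section Counts

variable {F : Type*} [Field F] [Fintype F]

theorem two_ne_zero_of_odd_card (hq : Odd (Fintype.card F)) : (2 : F) ≠ 0 :=
  Ring.two_ne_zero fun h => by
    have := FiniteField.even_card_of_char_two h
    rw [Nat.odd_iff] at hq
    omega

omit [Fintype F] in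
/-- If `x`, `x'` are the eigenvalues of one block and `r x`, `r x'` those of the other, the blocks
have no eigenvalue in common unless `r = 1`, or `r = -1` and `x' = -x`; the expression is, up to a
factor, the resultant of the two characteristic polynomials. -/
theorem ell_resultant_ne_zero {N r : Fˣ} {T : F} (hirr : ∀ s : F, s ^ 2 - T * s + N ≠ 0)
    (h2 : r = -1 → T ≠ 0) : (1 + r : F) ^ 2 * N - r * T ^ 2 ≠ 0 := by
  have hr := r.ne_zero
  intro h
  by_cases hr1 : (1 + r : F) = 0
  · have hr2 : r = -1 := Units.ext (by rw [Units.val_neg, Units.val_one]; linear_combination hr1)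
    refine h2 hr2 ?_
    have : (r : F) * T ^ 2 = 0 := by linear_combination (1 + r : F) * N * hr1 - h
    simpa [hr] using this
  · apply hirr (T / (1 + r))
    field_simp
    linear_combination h

/-- If the blocks have no eigenvalue in common, exactly one Lagrangian plane in the open cell is
fixed. -/
theorem ellSiegelCount_eq_one {N r : Fˣ} {T : F} (hirr : ∀ s : F, s ^ 2 - T * s + N ≠ 0)
    (h1 : r ≠ 1) (h2 : r = -1 → T ≠ 0) : ellSiegelCount N r T 0 0 0 = 1 := by
  classical
  have hN := N.ne_zero
  have hr := r.ne_zero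
  have h1' : (r : F) - 1 ≠ 0 := sub_ne_zero.mpr fun h => h1 (Units.ext h)
  have hres := ell_resultant_ne_zero hirr h2
  have key : ∀ m k z : F, (N * z - r * k = N * 0 ∧ (1 + r) * N * m + r * T * k = N * 0 ∧
      (1 + r) * m + T * z = 0 + T * 0 ∧ k + T * m - r * (z * N + m * T) = 0 + T * 0) ↔
      (z = 0 ∧ k = 0 ∧ m = 0) := by
    intro m k z
    constructor
    · rintro ⟨e1, -, e3, e4⟩
      have e5 : ((r : F) - 1) * ((1 + r) * N * z + r * T * m) = 0 := by
        linear_combination -e1 - r * e4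
      have e6 : (1 + r : F) * N * z + r * T * m = 0 := by simpa [h1'] using e5
      have hz : ((1 + r : F) ^ 2 * N - r * T ^ 2) * z = 0 := by
        linear_combination (1 + r : F) * e6 - r * T * e3
      have hz : z = 0 := by simpa [hres] using hz
      have hm : ((1 + r : F) ^ 2 * N - r * T ^ 2) * m = 0 := by
        linear_combination (1 + r : F) * N * e3 - T * e6
      have hm : m = 0 := by simpa [hres] using hm
      have hk : (r : F) * k = 0 := by linear_combination -e1 + N * hz
      exact ⟨hz, by simpa [hr] using hk, hm⟩
    · rintro ⟨rfl, rfl, rfl⟩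
      simp
  simp only [ellSiegelCount, key, ite_and]
  simp

/-- The fixed planes in the open cell are parametrized by the symmetric bilinear forms that the
block multiplies by its determinant; these are the multiples of the norm form. -/
theorem ellSiegelCount_one (hq : Odd (Fintype.card F)) {N : Fˣ} {T : F} :
    ellSiegelCount N 1 T 0 0 0 = Fintype.card F := by
  classical
  have h2 := two_ne_zero_of_odd_card hq
  have hN := N.ne_zero
  have key : ∀ m k z : F, (N * z - (1 : Fˣ) * k = N * 0 ∧
      (1 + (1 : Fˣ)) * N * m + (1 : Fˣ) * T * k = N * 0 ∧
      (1 + (1 : Fˣ)) * m + T * z = 0 + T * 0 ∧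
      k + T * m - (1 : Fˣ) * (z * N + m * T) = 0 + T * 0) ↔
      (m = -(T * z) / 2 ∧ k = N * z) := by
    intro m k z
    simp only [Units.val_one]
    rw [eq_div_iff h2]
    constructor
    · rintro ⟨e1, e2, e3, e4⟩
      exact ⟨by linear_combination e3, by linear_combination -e1⟩
    · rintro ⟨e1, rfl⟩
      exact ⟨by ring, by linear_combination N * e1, by linear_combination e1, by ring⟩
  simp only [ellSiegelCount, key]
  have : ∀ m : F, (∑ k : F, ∑ z : F, if m = -(T * z) / 2 ∧ k = N * z then (1 : ℂ) else 0)
      = ∑ z : F, if m = -(T * z) / 2 then (1 : ℂ) else 0 := by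
    intro m
    rw [Finset.sum_comm]
    refine Finset.sum_congr rfl fun z _ => ?_
    simp only [ite_and]
    split_ifs <;> simp
  simp only [this]
  rw [Finset.sum_comm]
  simp

theorem ellSiegelCount_one_of_ne (hq : Odd (Fintype.card F)) {N : Fˣ} {T y : F} (hy : y ≠ 0) :
    ellSiegelCount N 1 T 0 0 y = 0 := by
  have h2 := two_ne_zero_of_odd_card hq
  have hN := N.ne_zero
  refine Finset.sum_eq_zero fun m _ => Finset.sum_eq_zero fun k _ =>
    Finset.sum_eq_zero fun z _ => if_neg ?_
  rintro ⟨e1, e2, e3, e4⟩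
  simp only [Units.val_one] at *
  have : N * y = (0 : F) := by linear_combination -e1 - e4
  simp_all

/-- If the block has trace zero, its negative has the same eigenvalues, and the fixed planes in the
open cell form a space of dimension two. -/
theorem ellSiegelCount_neg_one {N : Fˣ} :
    ellSiegelCount N (-1) 0 0 0 0 = (Fintype.card F : ℂ) ^ 2 := by
  classical
  have key : ∀ m k z : F, (N * z - (-1 : Fˣ) * k = N * 0 ∧
      (1 + (-1 : Fˣ)) * N * m + (-1 : Fˣ) * 0 * k = N * 0 ∧
      (1 + (-1 : Fˣ)) * m + 0 * z = 0 + 0 * 0 ∧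
      k + 0 * m - (-1 : Fˣ) * (z * N + m * 0) = (0 : F) + 0 * 0) ↔ (k = -(N * z)) := by
    intro m k z
    simp only [Units.val_one, Units.val_neg]
    constructor
    · rintro ⟨e1, e2, e3, e4⟩
      linear_combination e1
    · rintro rfl
      exact ⟨by ring, by ring, by ring, by ring⟩
  simp only [ellSiegelCount, key]
  simp only [Finset.sum_comm (s := (Finset.univ : Finset F)) (t := (Finset.univ : Finset F))
    (f := fun k z => if k = -(N * z) then (1 : ℂ) else 0)]
  simp [pow_two]

theorem ellSiegelCount_neg_one_of_ne (hq : Odd (Fintype.card F)) {N : Fˣ} {a b : F}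
    (hab : a ≠ 0 ∨ b ≠ 0) : ellSiegelCount N (-1) 0 a (-(b * N)) b = 0 := by
  have h2 := two_ne_zero_of_odd_card hq
  have hN := N.ne_zero
  refine Finset.sum_eq_zero fun m _ => Finset.sum_eq_zero fun k _ =>
    Finset.sum_eq_zero fun z _ => if_neg ?_
  rintro ⟨e1, e2, e3, e4⟩
  simp only [Units.val_one, Units.val_neg] at *
  have ha : a = 0 := by linear_combination -e3
  have : 2 * N * b = (0 : F) := by linear_combination e4 - e1
  simp_all

end Counts

/-! ### The quadratic extension -/

section Quadratic

variable {F E : Type*} [Field F] [Field E] [Algebra F E]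

/-- The norm of a unit. -/
def normUnit (F : Type*) {E : Type*} [Field F] [Field E] [Algebra F E] : Eˣ →* Fˣ :=
  Units.map (Algebra.norm F)

theorem normUnit_val (x : Eˣ) : (normUnit F x : F) = Algebra.norm F (x : E) := rfl

variable [FiniteDimensional F E]

theorem ell_eq_companion (x : Eˣ) :
    ell (F := F) x = companion (normUnit F x) (Algebra.trace F E (x : E)) := rfl

variable [Fintype F] (hE : Module.finrank F E = 2)

include hE

theorem algebraMap_trace (x : E) :
    algebraMap F E (Algebra.trace F E x) = x + x ^ Fintype.card F := by
  have := Module.finite_of_finite F (M := E)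
  rw [FiniteField.algebraMap_trace_eq_sum_pow, hE, Nat.card_eq_fintype_card]
  simp [Finset.sum_range_succ]

theorem algebraMap_norm (x : E) :
    algebraMap F E (Algebra.norm F x) = x ^ (Fintype.card F + 1) := by
  have := Module.finite_of_finite F (M := E)
  rw [FiniteField.algebraMap_norm_eq_pow_sum, hE, Nat.card_eq_fintype_card]
  simp [Finset.sum_range_succ, add_comm]

theorem quadratic_factor (x : E) (s : F) : algebraMap F E (s ^ 2 - Algebra.trace F E x * s
    + Algebra.norm F x) = (algebraMap F E s - x) * (algebraMap F E s - x ^ Fintype.card F) := by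
  rw [map_add, map_sub, map_mul, map_pow, algebraMap_trace hE, algebraMap_norm hE]
  ring

/-- An element of `E` outside `F` is not an eigenvalue in `F` of its companion matrix. -/
theorem charpoly_ne_zero {x : Eˣ} (hx : x ^ (Fintype.card F - 1) ≠ 1) (s : F) :
    s ^ 2 - Algebra.trace F E (x : E) * s + normUnit F x ≠ 0 := by
  have hq : Fintype.card F - 1 + 1 = Fintype.card F :=
    Nat.sub_add_cancel Fintype.card_pos
  have hx' : (x : E) ^ Fintype.card F ≠ x := by
    intro h
    apply hx
    apply Units.ext
    rw [← hq, pow_succ] at h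
    rw [Units.val_pow_eq_pow_val, Units.val_one]
    exact (mul_eq_right₀ x.ne_zero).mp h
  intro h
  have h1 := quadratic_factor hE (x : E) s
  rw [← normUnit_val, h, map_zero, eq_comm, mul_eq_zero, sub_eq_zero, sub_eq_zero] at h1
  have h2 : algebraMap F E s ^ Fintype.card F = algebraMap F E s := by
    rw [← map_pow, FiniteField.pow_card]
  have hE' : Fintype.card F ^ 2 = Nat.card E := by
    have := Module.finite_of_finite F (M := E)
    rw [Module.natCard_eq_pow_finrank (K := F) (V := E), hE, Nat.card_eq_fintype_card]
  rcases h1 with h1 | h1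
  · rw [h1] at h2
    exact hx' h2
  · apply hx'
    have : Finite E := Module.finite_of_finite F (M := E)
    have : Fintype E := Fintype.ofFinite E
    rw [← h1, ← h2, h1, ← pow_mul, ← pow_two, hE', Nat.card_eq_fintype_card, FiniteField.pow_card]

theorem trace_eq_zero_iff {x : Eˣ} :
    Algebra.trace F E (x : E) = 0 ↔ x ^ (Fintype.card F - 1) = -1 := by
  have hq : Fintype.card F - 1 + 1 = Fintype.card F :=
    Nat.sub_add_cancel Fintype.card_pos
  have h : algebraMap F E (Algebra.trace F E (x : E)) = x * (1 + x ^ (Fintype.card F - 1)) := by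
    rw [algebraMap_trace hE]
    rw [mul_add, mul_one, ← pow_succ', hq]
  rw [← (algebraMap F E).injective.eq_iff, h, map_zero, mul_eq_zero_iff_left x.ne_zero,
    Units.ext_iff]
  push_cast
  constructor <;> intro h <;> linear_combination h

omit [FiniteDimensional F E] [Fintype F] in
theorem normUnit_up (a : Fˣ) : normUnit F (up E a) = a ^ 2 := by
  apply Units.ext
  rw [normUnit_val, up, Units.coe_map, MonoidHom.coe_coe, Algebra.norm_algebraMap, hE]
  rfl

variable {θ : Eˣ} {γ : Fˣ} (hγ : algebraMap F E (γ : F) = (θ : E) ^ (Fintype.card F + 1))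

include hγ

theorem normUnit_generator : normUnit F θ = γ := by
  apply Units.ext
  apply (algebraMap F E).injective
  rw [normUnit_val, algebraMap_norm hE, hγ]

theorem normUnit_eta : normUnit F (eta F θ) = 1 := by
  rw [eta, map_pow, normUnit_generator hE hγ]
  exact Units.ext (by simpa using FiniteField.pow_card_sub_one_eq_one _ γ.ne_zero)

omit [FiniteDimensional F E] hγ hE in
theorem up_pow_card_sub_one (a : Fˣ) : (up E a) ^ (Fintype.card F - 1) = 1 := by
  rw [up, ← map_pow]
  have : a ^ (Fintype.card F - 1) = 1 :=
    Units.ext (by simpa using FiniteField.pow_card_sub_one_eq_one _ a.ne_zero)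
  rw [this, map_one]

omit [FiniteDimensional F E] hγ hE in
theorem pow_card_sub_one_theta (a : Fˣ) (i : ℤ) :
    (up E a * θ ^ i) ^ (Fintype.card F - 1) = eta F θ ^ i := by
  rw [mul_pow, up_pow_card_sub_one, one_mul, eta, ← zpow_natCast, ← zpow_natCast, ← _root_.zpow_mul,
    ← _root_.zpow_mul, mul_comm]

omit [FiniteDimensional F E] hE in
theorem eta_pow_card_add_one : eta F θ ^ (Fintype.card F + 1) = 1 := by
  have h := FiniteField.pow_card_sub_one_eq_one _ γ.ne_zero
  rw [eta, ← pow_mul, mul_comm, pow_mul]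
  apply Units.ext
  push_cast
  rw [← hγ, ← map_pow, h, map_one]

omit [FiniteDimensional F E] hE in
theorem pow_card_sub_one_eta (a : Fˣ) (i : ℤ) :
    (up E a * eta F θ ^ i) ^ (Fintype.card F - 1) = (eta F θ ^ i * eta F θ ^ i)⁻¹ := by
  have h : (eta F θ ^ i) ^ (Fintype.card F - 1) * (eta F θ ^ i * eta F θ ^ i) = 1 := by
    rw [← pow_two, ← pow_add]
    have : Fintype.card F - 1 + 2 = Fintype.card F + 1 := by
      have := Fintype.card_pos (α := F)
      omega
    rw [this, ← zpow_natCast, ← _root_.zpow_mul, mul_comm, _root_.zpow_mul, zpow_natCast,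
      eta_pow_card_add_one hγ, _root_.one_zpow]
  rw [mul_pow, up_pow_card_sub_one, one_mul]
  exact eq_inv_of_mul_eq_one_left h

variable (hq : Odd (Fintype.card F)) (hθ : ∀ x : Eˣ, x ∈ Subgroup.zpowers θ)

include hθ

omit hγ in
theorem orderOf_generator : orderOf θ = (Fintype.card F + 1) * (Fintype.card F - 1) := by
  have := Module.finite_of_finite F (M := E)
  rw [orderOf_eq_card_of_forall_mem_zpowers hθ, Nat.card_units,
    Module.natCard_eq_pow_finrank (K := F) (V := E), hE, Nat.card_eq_fintype_card]
  simpa using Nat.sq_sub_sq (Fintype.card F) 1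

include hq

omit hγ in
/-- `γ^(1/2)` has conjugate `-γ^(1/2)`. -/
theorem half_pow_card_sub_one :
    (θ ^ ((Fintype.card F + 1) / 2)) ^ (Fintype.card F - 1) = -1 := by
  have hcard := orderOf_generator hE hθ
  obtain ⟨m, hm⟩ := hq
  have hm0 : 0 < m := by
    rcases Nat.eq_zero_or_pos m with h | h
    · have := Fintype.one_lt_card (α := F)
      omega
    · exact h
  have e1 : (Fintype.card F + 1) / 2 = m + 1 := by omega
  have e2 : Fintype.card F - 1 = 2 * m := by omega
  have e3 : Fintype.card F + 1 = 2 * (m + 1) := by omega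
  rw [e2, e3] at hcard
  rw [e1, e2, ← pow_mul]
  have h1 : (θ ^ ((m + 1) * (2 * m))) ^ 2 = 1 := by
    rw [← pow_mul, ← pow_orderOf_eq_one θ, hcard]
    congr 1
    ring
  have h2 : θ ^ ((m + 1) * (2 * m)) ≠ 1 := by
    intro h
    have := Nat.le_of_dvd (by positivity) (orderOf_dvd_of_pow_eq_one h)
    rw [hcard] at this
    nlinarith
  have h3 : ((θ ^ ((m + 1) * (2 * m)) : Eˣ) : E) ^ 2 = 1 := by
    rw [← Units.val_pow_eq_pow_val, h1, Units.val_one]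
  rcases mul_self_eq_one_iff.mp ((pow_two _).symm.trans h3) with h | h
  · exact absurd (Units.ext h) h2
  · exact Units.ext h

theorem normUnit_half : normUnit F (θ ^ ((Fintype.card F + 1) / 2)) = -γ := by
  have h := half_pow_card_sub_one hE hq hθ
  apply Units.ext
  apply (algebraMap F E).injective
  obtain ⟨m, hm⟩ := hq
  have e1 : (Fintype.card F + 1) / 2 = m + 1 := by omega
  have e2 : Fintype.card F - 1 = 2 * m := by omega
  rw [normUnit_val, algebraMap_norm hE, Units.val_neg, map_neg, hγ]
  have h' := congrArg Units.val h
  rw [e1, e2] at h'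
  rw [e1, hm]
  push_cast at h' ⊢
  have : ((θ : E) ^ (m + 1)) ^ (2 * m + 1 + 1)
      = ((θ : E) ^ (m + 1)) ^ (2 * m) * (θ : E) ^ (2 * m + 1 + 1) := by
    ring
  rw [this, h']
  ring

end Quadratic

/-! ### The representatives as explicit matrices -/

section RepMatrices

variable {F : Type*} [Field F]

theorem multiplier_siegelLevi (A : GL (Fin 2) F) (c : Fˣ) : multiplier (siegelLevi A c) = c :=
  multiplier_ofMatrix _ _ _

theorem multiplier_siegelUnip (μ κ x : F) : multiplier (siegelUnip μ κ x) = 1 :=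
  multiplier_ofMatrix _ _ _

theorem multiplier_klingenLevi (t : Fˣ) (A : GL (Fin 2) F) :
    multiplier (klingenLevi t A) = A.det :=
  multiplier_ofMatrix _ _ _

theorem mat_siegelLevi_mul_siegelUnip (A : GL (Fin 2) F) (c : Fˣ) (μ κ x : F) :
    mat (siegelLevi A c * siegelUnip μ κ x) =
    !![A.1 0 0, A.1 0 1, A.1 0 0 * μ + A.1 0 1 * x, A.1 0 0 * κ + A.1 0 1 * μ;
       A.1 1 0, A.1 1 1, A.1 1 0 * μ + A.1 1 1 * x, A.1 1 0 * κ + A.1 1 1 * μ;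
       0, 0, c * A.1 0 0 / A.1.det, -(c * A.1 0 1 / A.1.det);
       0, 0, -(c * A.1 1 0 / A.1.det), c * A.1 1 1 / A.1.det] := by
  rw [mat_mul]
  ext i j
  fin_cases i <;> fin_cases j <;>
    simp [siegelLevi, siegelUnip, mat_ofMatrix, Matrix.mul_apply, Fin.sum_univ_four]

theorem siegelUnip_zero : siegelUnip (0 : F) 0 0 = 1 := by
  apply mat_injective
  rw [mat_one]
  ext i j
  fin_cases i <;> fin_cases j <;> simp [siegelUnip, mat_ofMatrix]

theorem mat_dg_unip {a b c d e : Fˣ} (hd : c = b * d) (he : c = a * e) (κ x : F) :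
    mat (siegelLevi (dg a b) c * siegelUnip 0 κ x) = cornerMat a b d e (a * κ) (b * x) := by
  have hd' : (c : F) = b * d := by rw [hd, Units.val_mul]
  have he' : (c : F) = a * e := by rw [he, Units.val_mul]
  have ha := a.ne_zero
  have hb := b.ne_zero
  rw [mat_siegelLevi_mul_siegelUnip]
  simp only [dg_val, cornerMat, Matrix.det_fin_two_of]
  congr 1
  simp
  constructor
  · field_simp
    linear_combination hd'
  · field_simp
    linear_combination he'

theorem mat_dg {a b c d e : Fˣ} (hd : c = b * d) (he : c = a * e) :
    mat (siegelLevi (dg a b) c) = cornerMat a b d e 0 0 := by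
  simpa [siegelUnip_zero] using mat_dg_unip hd he 0 0

theorem mat_jd_unip {a c d : Fˣ} (hd : c = a * d) (x : F) :
    mat (siegelLevi (jd a) c * siegelUnip 0 0 x) = jordanMat a d x := by
  have hd' : (c : F) = a * d := by rw [hd, Units.val_mul]
  have ha := a.ne_zero
  rw [mat_siegelLevi_mul_siegelUnip]
  simp only [jd_val, jordanMat, Matrix.det_fin_two_of]
  congr 1
  simp
  refine ⟨⟨?_, ?_⟩, ?_⟩ <;> field_simp <;> linear_combination hd'

theorem mat_jd {a c d : Fˣ} (hd : c = a * d) :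
    mat (siegelLevi (jd a) c) = jordanMat a d 0 := by
  simpa [siegelUnip_zero] using mat_jd_unip hd 0

theorem mat_klingenLevi_dg {t a e : Fˣ} (he : a * a = t * e) :
    mat (klingenLevi t (dg a a)) = cornerMat t a a e 0 0 := by
  have he' : (a : F) * a = t * e := by exact_mod_cast congrArg Units.val he
  have ht := t.ne_zero
  rw [klingenLevi, mat_ofMatrix]
  simp only [dg_val, cornerMat, Matrix.det_fin_two_of]
  congr 1
  simp
  field_simp
  linear_combination he'

theorem mat_klingenLevi_jd {t a e : Fˣ} (he : a * a = t * e) :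
    mat (klingenLevi t (jd a)) = cornerMat t a a e 0 1 := by
  have he' : (a : F) * a = t * e := by exact_mod_cast congrArg Units.val he
  have ht := t.ne_zero
  rw [klingenLevi, mat_ofMatrix]
  simp only [jd_val, cornerMat, Matrix.det_fin_two_of]
  congr 1
  simp
  field_simp
  linear_combination he'

theorem mat_companion_unip {N r c : Fˣ} (hc : c = r * N) (T μ κ y : F) :
    mat (siegelLevi (companion N T) c * siegelUnip μ κ y) = ellSiegelMat N r T μ κ y := by
  have hc' : (c : F) = r * N := by rw [hc, Units.val_mul]
  have hN := N.ne_zero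
  rw [mat_siegelLevi_mul_siegelUnip]
  simp only [companion_val, ellSiegelMat, Matrix.det_fin_two_of]
  congr 1
  simp
  refine ⟨?_, ?_, ?_⟩
  · field_simp
    linear_combination hc'
  · field_simp
    linear_combination hc'
  · field_simp
    linear_combination T * hc'

theorem mat_companion {N r c : Fˣ} (hc : c = r * N) (T : F) :
    mat (siegelLevi (companion N T) c) = ellSiegelMat N r T 0 0 0 := by
  simpa [siegelUnip_zero] using mat_companion_unip hc T 0 0 0

theorem mat_klingen_companion_unip (t N : Fˣ) (T κ : F) :
    mat (klingenLevi t (companion N T) * siegelUnip 0 κ 0) = ellKlingenMat t N T κ := by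
  have ht := t.ne_zero
  rw [mat_mul]
  ext i j
  fin_cases i <;> fin_cases j <;>
    simp [klingenLevi, siegelUnip, mat_ofMatrix, Matrix.mul_apply, Fin.sum_univ_four,
      ellKlingenMat, companion_val, Matrix.det_fin_two_of]

theorem mat_klingen_companion (t N : Fˣ) (T : F) :
    mat (klingenLevi t (companion N T)) = ellKlingenMat t N T 0 := by
  simpa [siegelUnip_zero] using mat_klingen_companion_unip t N T 0

theorem det_dg (a b : Fˣ) : (dg a b).det = a * b :=
  Units.ext (by simp [dg_val, Matrix.det_fin_two_of])

theorem det_jd (a : Fˣ) : (jd a).det = a * a :=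
  Units.ext (by simp [jd_val, Matrix.det_fin_two_of])

end RepMatrices

/-! ### The Siegel table -/

section SiegelTable

variable {F : Type*} [Field F] [Fintype F]

omit [Fintype F] in
theorem units_sub_ne_zero {a b : Fˣ} (h : a ≠ b) : (a : F) - b ≠ 0 :=
  sub_ne_zero.mpr fun h' => h (Units.ext h')

theorem unit_ne_neg (hq : Odd (Fintype.card F)) (u : Fˣ) : u ≠ -u := by
  intro h
  have h2 := two_ne_zero_of_odd_card hq
  have := congrArg Units.val h
  rw [Units.val_neg] at this
  have h3 : 2 * (u : F) = 0 := by linear_combination this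
  simp [h2] at h3

variable {ψ : GL (Fin 2) F → ℂ} (hψ : IsClassFun ψ) (σ : Fˣ →* ℂˣ) (u v w : Fˣ)

include hψ

omit hψ in
theorem siegelSum_A1 : siegelSum ψ σ (siegelLevi (dg u u) (u * u))
    = ((Fintype.card F : ℂ) ^ 2 + 1) * (Fintype.card F + 1) * ev σ (u * u) * ψ (dg u u) := by
  rw [siegelSum_corner_self ψ σ (mat_dg rfl rfl), multiplier_siegelLevi]
  simp [numSol_zero_zero, extendGL_diag]
  ring

omit hψ in
theorem siegelSum_A2 : siegelSum ψ σ (siegelLevi (dg u u) (u * u) * siegelUnip 0 1 0)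
    = (Fintype.card F + 1) * ev σ (u * u) * ψ (dg u u) := by
  rw [siegelSum_corner_self ψ σ (mat_dg_unip rfl rfl _ _), map_mul, multiplier_siegelLevi,
    multiplier_siegelUnip, mul_one]
  simp [numSol_zero_zero, numSol_zero]
  ring

/-- The unipotent part gives a split quadratic form; its two isotropic lines account for `2 q` fixed
planes on which the element is not a scalar. -/
theorem siegelSum_A31 (hq : Odd (Fintype.card F)) :
    siegelSum ψ σ (siegelLevi (dg u u) (u * u) * siegelUnip 0 1 (-1))
    = ev σ (u * u) * (ψ (dg u u) + 2 * Fintype.card F * ψ (jd u)) := by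
  classical
  have h2 := two_ne_zero_of_odd_card hq
  rw [siegelSum_corner_self ψ σ (mat_dg_unip rfl rfl _ _), map_mul, multiplier_siegelLevi,
    multiplier_siegelUnip, mul_one]
  have h1 : (1 : F) ≠ -1 := by
    intro h
    exact h2 (by linear_combination h)
  rw [Finset.sum_eq_add_of_mem 1 (-1) (Finset.mem_univ _) (Finset.mem_univ _) h1]
  · rw [extendGL_lower_self hψ u (by simp), extendGL_lower_self hψ u (by simp)]
    simp [numSol_zero_zero, numSol_zero]
    ring
  · intro s _ hs
    rw [sub_self, numSol_zero, zero_mul]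
    intro h
    have h3 : (u : F) * ((s - 1) * (s + 1)) = 0 := by linear_combination -h
    have h4 : s + 1 ≠ 0 := fun h => hs.2 (by linear_combination h)
    simp [sub_eq_zero, hs.1, h4] at h3

omit hψ in
/-- The unipotent part gives an anisotropic quadratic form, and only one plane is fixed. -/
theorem siegelSum_A32 {γ : Fˣ} (hγ : ¬ IsSquare (γ : F)) :
    siegelSum ψ σ (siegelLevi (dg u u) (u * u) * siegelUnip 0 1 (-(γ : F)))
    = ev σ (u * u) * ψ (dg u u) := by
  rw [siegelSum_corner_self ψ σ (mat_dg_unip rfl rfl _ _), map_mul, multiplier_siegelLevi,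
    multiplier_siegelUnip, mul_one]
  rw [Finset.sum_eq_zero]
  · simp [numSol_zero]
  · intro s _
    rw [sub_self, numSol_zero, zero_mul]
    intro h
    have h3 : (u : F) * (1 - s ^ 2 * γ) = 0 := by linear_combination h
    have h4 : (1 - s ^ 2 * γ : F) = 0 := by simpa using h3
    have hs : s ≠ 0 := by
      rintro rfl
      simp at h4
    exact hγ ⟨1 / s, by field_simp; linear_combination -h4⟩

theorem siegelSum_C1 (hv : v ≠ 1) : siegelSum ψ σ (siegelLevi (dg u u) (u * u * v))
    = ev σ (u * u * v) * (ψ (dg u u) + ψ (dg (u * v) (u * v))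
      + (Fintype.card F + 1) * ψ (dg u (u * v))) := by
  have h : (u : F) - (u * v : Fˣ) ≠ 0 := units_sub_ne_zero (by simpa using hv)
  rw [siegelSum_corner_self ψ σ (mat_dg (mul_assoc u u v) (mul_assoc u u v)),
    multiplier_siegelLevi]
  simp only [numSol_of_ne h, mul_zero, extendGL_diag, Finset.sum_const, Finset.card_univ,
    nsmul_eq_mul, classFun_dg_comm hψ (u * v) u]
  ring

omit hψ in
theorem siegelSum_A5 : siegelSum ψ σ (siegelLevi (jd u) (u * u) * siegelUnip 0 0 1)
    = ev σ (u * u) * ψ (jd u) := by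
  rw [siegelSum_jordan_self ψ σ (mat_jd_unip rfl _) one_ne_zero, map_mul, multiplier_siegelLevi,
    multiplier_siegelUnip, mul_one]

theorem siegelSum_C3 (hv : v ≠ 1) : siegelSum ψ σ (siegelLevi (jd u) (u * u * v))
    = ev σ (u * u * v) * (ψ (jd u) + ψ (jd (u * v)) + ψ (dg u (u * v))) := by
  rw [siegelSum_jordan hψ σ (mat_jd (mul_assoc u u v)) (by simpa using hv),
    multiplier_siegelLevi]

/-- The four families of classes with eigenvalues `u`, `-u`, `-u`, `u`. -/
theorem siegelSum_B (hq : Odd (Fintype.card F)) (κ x : F) :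
    siegelSum ψ σ (siegelLevi (dg u (-u)) (u * u) * siegelUnip 0 κ x)
    = ev σ (u * u) * ((1 + numSol 0 κ) * (1 + numSol 0 x) * ψ (dg u (-u))) := by
  classical
  have h := units_sub_ne_zero (unit_ne_neg hq u)
  have hsol : ∀ (a : Fˣ) (t : F), numSol 0 (a * t) = numSol 0 t := by
    intro a t
    by_cases ht : t = 0
    · simp [ht]
    · rw [numSol_zero ht, numSol_zero (by simpa using ht)]
  rw [siegelSum_corner ψ σ (mat_dg_unip (d := -u) (e := u) (by simp) rfl _ _) (by simp)
    (unit_ne_neg hq u), map_mul, multiplier_siegelLevi, multiplier_siegelUnip, mul_one,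
    numSol_of_ne h, sub_self, sub_self, hsol, hsol, classFun_dg_comm hψ (-u) u]
  ring

theorem siegelSum_C21 (hq : Odd (Fintype.card F)) (hv : v ≠ 1) (hv' : v ≠ -1) :
    siegelSum ψ σ (siegelLevi (dg u (-u)) (-(u * u * v)))
    = ev σ (-(u * u * v)) * (ψ (dg u (-u)) + ψ (dg (u * v) (-(u * v))) + ψ (dg u (u * v))
      + ψ (dg (-u) (-(u * v)))) := by
  have h1 : ((-u : Fˣ) : F) - (u * v : Fˣ) ≠ 0 := units_sub_ne_zero fun h => hv' (by
    rw [← mul_right_inj u, ← h]; simp)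
  have h2 : (u : F) - (-(u * v) : Fˣ) ≠ 0 := units_sub_ne_zero fun h => hv' (by
    rw [← mul_right_inj u, mul_neg_one]; exact neg_eq_iff_eq_neg.mp h.symm)
  have h3 : (u : F) - (u * v : Fˣ) ≠ 0 := units_sub_ne_zero (by simpa using hv)
  rw [siegelSum_corner ψ σ (mat_dg (d := u * v) (e := -(u * v)) (by simp [mul_assoc])
    (by simp [mul_assoc])) (by simp) (unit_ne_neg hq u), multiplier_siegelLevi,
    numSol_of_ne h1, numSol_of_ne h2, numSol_of_ne h3, classFun_dg_comm hψ (-(u * v)) (-u)]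
  ring

omit hψ [Fintype F] in
theorem mul_mul_inv_eq : u * u = u * v * (u * v⁻¹) := by
  rw [mul_mul_mul_comm, mul_inv_cancel, mul_one]

omit hψ [Fintype F] in
theorem units_inv_ne_self (hv : v ≠ 1) (hv' : v ≠ -1) : v ≠ v⁻¹ := by
  intro h
  have h1 : (v : F) * v = 1 := by
    rw [← Units.val_mul]
    nth_rw 2 [h]
    simp
  rcases mul_self_eq_one_iff.mp h1 with h2 | h2
  · exact hv (Units.ext h2)
  · exact hv' (Units.ext h2)

theorem siegelSum_C4 (hv : v ≠ 1) (hv' : v ≠ -1) : siegelSum ψ σ (klingenLevi (u * v) (jd u))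
    = ev σ (u * u) * (ψ (dg u (u * v)) + ψ (dg u (u * v⁻¹))) := by
  have h1 : (u * v : Fˣ) ≠ u := by simpa using hv
  have h3 : ((u * v : Fˣ) : F) - (u * v⁻¹ : Fˣ) ≠ 0 :=
    units_sub_ne_zero (by simpa using units_inv_ne_self v hv hv')
  rw [siegelSum_corner ψ σ (mat_klingenLevi_jd (mul_mul_inv_eq u v)) (mul_mul_inv_eq u v).symm
    h1, multiplier_klingenLevi, det_jd, sub_self, numSol_zero one_ne_zero, numSol_of_ne h3,
    classFun_dg_comm hψ (u * v) u, classFun_dg_comm hψ (u * v⁻¹) u]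
  ring

theorem siegelSum_C5 (hv : v ≠ 1) (hv' : v ≠ -1) :
    siegelSum ψ σ (klingenLevi (u * v) (dg u u))
    = (Fintype.card F + 1) * ev σ (u * u) * (ψ (dg u (u * v)) + ψ (dg u (u * v⁻¹))) := by
  have h1 : (u * v : Fˣ) ≠ u := by simpa using hv
  have h3 : ((u * v : Fˣ) : F) - (u * v⁻¹ : Fˣ) ≠ 0 :=
    units_sub_ne_zero (by simpa using units_inv_ne_self v hv hv')
  rw [siegelSum_corner ψ σ (mat_klingenLevi_dg (mul_mul_inv_eq u v)) (mul_mul_inv_eq u v).symm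
    h1, multiplier_klingenLevi, det_dg, sub_self, numSol_zero_zero, numSol_of_ne h3,
    numSol_of_ne (units_sub_ne_zero h1),
    classFun_dg_comm hψ (u * v) u, classFun_dg_comm hψ (u * v⁻¹) u]
  ring

theorem siegelSum_C6 (hv : v ≠ 1) (hw : w ≠ 1) (hvw : v ≠ w) (hvw' : v * w ≠ 1) :
    siegelSum ψ σ (siegelLevi (dg u (u * v)) (u * u * v * w))
    = ev σ (u * u * v * w) * (ψ (dg u (u * v)) + ψ (dg u (u * w)) + ψ (dg (u * v) (u * v * w))
      + ψ (dg (u * w) (u * v * w))) := by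
  have h1 : ((u * v : Fˣ) : F) - (u * w : Fˣ) ≠ 0 := units_sub_ne_zero (by simpa using hvw)
  have h2 : (u : F) - (u * v * w : Fˣ) ≠ 0 := units_sub_ne_zero (by
    simpa [mul_assoc] using hvw')
  have h3 : (u : F) - (u * w : Fˣ) ≠ 0 := units_sub_ne_zero (by simpa using hw)
  rw [siegelSum_corner ψ σ (mat_dg (d := u * w) (e := u * v * w) (by
      rw [mul_mul_mul_comm]; simp only [mul_assoc]) (by simp only [mul_assoc])) (by
      rw [mul_mul_mul_comm]; simp only [mul_assoc]) (by simpa using hv),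
    multiplier_siegelLevi, numSol_of_ne h1, numSol_of_ne h2, numSol_of_ne h3,
    classFun_dg_comm hψ (u * v * w) (u * v)]
  ring

end SiegelTable

section SiegelElliptic

variable {F E : Type*} [Field F] [Fintype F] [Field E] [Algebra F E] [FiniteDimensional F E]
  {ψ : GL (Fin 2) F → ℂ} (hE : Module.finrank F E = 2) (hψ : IsClassFun ψ) (σ : Fˣ →* ℂˣ)
  {x : Eˣ} (hx : x ^ (Fintype.card F - 1) ≠ 1)

include hE

omit [Fintype F] in
theorem ell_up_mul (r : Fˣ) (x : Eˣ) : ell (F := F) (up E r * x)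
    = companion (r ^ 2 * normUnit F x) (r * Algebra.trace F E (x : E)) := by
  rw [ell_eq_companion, map_mul, normUnit_up hE]
  congr 1
  have h : ((up E r * x : Eˣ) : E) = (r : F) • (x : E) := by
    rw [Algebra.smul_def]
    rfl
  rw [h, map_smul, smul_eq_mul]

include hψ hx

theorem siegelSum_ell_unip {r c : Fˣ} (hc : c = r * normUnit F x) (μ κ y : F) :
    siegelSum ψ σ (siegelLevi (ell x) c * siegelUnip μ κ y) = ev σ c * (ψ (ell x)
      + ellSiegelCount (normUnit F x) r (Algebra.trace F E (x : E)) μ κ y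
        * ψ (ell (up E r * x))) := by
  rw [ell_up_mul hE]
  rw [ell_eq_companion]
  rw [siegelSum_ell hψ σ (charpoly_ne_zero hE hx) (mat_companion_unip hc _ _ _ _), map_mul,
    multiplier_siegelLevi, multiplier_siegelUnip, mul_one]

theorem siegelSum_ell_levi {r c : Fˣ} (hc : c = r * normUnit F x) :
    siegelSum ψ σ (siegelLevi (ell x) c) = ev σ c * (ψ (ell x)
      + ellSiegelCount (normUnit F x) r (Algebra.trace F E (x : E)) 0 0 0
        * ψ (ell (up E r * x))) := by
  simpa [siegelUnip_zero] using siegelSum_ell_unip hE hψ σ hx hc 0 0 0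

end SiegelElliptic

section SiegelTable

variable {F E : Type*} [Field F] [Fintype F] [Field E] [Algebra F E] [FiniteDimensional F E]

omit [Fintype F] [FiniteDimensional F E] in
theorem up_one : up E (1 : Fˣ) = 1 := map_one _

omit [Fintype F] [FiniteDimensional F E] in
theorem up_neg_one : up E (-1 : Fˣ) = -1 := Units.ext (by simp [up])

omit [Fintype F] [FiniteDimensional F E] in
theorem up_mul (a b : Fˣ) : up E (a * b) = up E a * up E b := map_mul _ a b

variable (hE : Module.finrank F E = 2) {θ : Eˣ} {γ : Fˣ}
  (hγ : algebraMap F E (γ : F) = (θ : E) ^ (Fintype.card F + 1))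
  (hq : Odd (Fintype.card F)) (hθ : ∀ x : Eˣ, x ∈ Subgroup.zpowers θ)

include hE hγ

theorem normUnit_theta (k i : ℤ) :
    normUnit F (up E (γ ^ k) * θ ^ i) = γ ^ k * γ ^ k * γ ^ i := by
  rw [map_mul, normUnit_up hE, map_zpow, normUnit_generator hE hγ, pow_two]

theorem normUnit_eta_zpow (k i : ℤ) :
    normUnit F (up E (γ ^ k) * eta F θ ^ i) = γ ^ k * γ ^ k := by
  rw [map_mul, normUnit_up hE, map_zpow, normUnit_eta hE hγ, _root_.one_zpow, pow_two, mul_one]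

omit [FiniteDimensional F E] hE in
theorem pow_card_sub_one_eta_ne_one (k i : ℤ) (h : eta F θ ^ i ≠ 1) (h' : eta F θ ^ i ≠ -1) :
    (up E (γ ^ k) * eta F θ ^ i) ^ (Fintype.card F - 1) ≠ 1 := by
  rw [pow_card_sub_one_eta hγ]
  intro h1
  rw [inv_eq_one] at h1
  have h2 := congrArg (fun u : Eˣ => (u : E)) h1
  rcases mul_self_eq_one_iff.mp h2 with h3 | h3
  · exact h (Units.ext h3)
  · exact h' (Units.ext h3)

omit [Fintype F] hγ in
theorem ell_up_neg_one {x : Eˣ} (hx : Algebra.trace F E (x : E) = 0) :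
    ell (F := F) (up E (-1 : Fˣ) * x) = ell x := by
  rw [ell_up_mul hE, ell_eq_companion, hx]
  simp

include hq hθ

/-- A generator of `Fˣ` is not a square. -/
theorem not_isSquare_generator : ¬ IsSquare (γ : F) := by
  rintro ⟨s, hs⟩
  have hs0 : s ≠ 0 := by
    rintro rfl
    simp at hs
  have h1 := normUnit_half hE hγ hq hθ
  have h2 : γ ^ ((Fintype.card F + 1) / 2) = -γ := by
    rw [← h1, map_pow, normUnit_generator hE hγ]
  have h3 := congrArg Units.val h2
  have hq1 : (Fintype.card F + 1) / 2 * 2 = Fintype.card F + 1 := by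
    obtain ⟨m, hm⟩ := hq
    omega
  rw [Units.val_pow_eq_pow_val, Units.val_neg, hs, ← pow_two, ← pow_mul, mul_comm 2, hq1,
    pow_succ, FiniteField.pow_card] at h3
  have h4 : 2 * (s * s) = 0 := by linear_combination h3
  simp [two_ne_zero_of_odd_card hq, hs0] at h4

theorem normUnit_ellHalf (k : ℤ) :
    normUnit F (up E (γ ^ k) * θ ^ ((Fintype.card F + 1) / 2)) = -(γ ^ k * γ ^ k * γ) := by
  rw [map_mul, normUnit_up hE, normUnit_half hE hγ hq hθ, pow_two, mul_neg]

omit hγ in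
theorem pow_card_sub_one_ellHalf (a : Fˣ) :
    (up E a * θ ^ ((Fintype.card F + 1) / 2)) ^ (Fintype.card F - 1) = -1 := by
  rw [mul_pow, up_pow_card_sub_one, half_pow_card_sub_one hE hq hθ, one_mul]

omit [FiniteDimensional F E] hE hγ hθ in
theorem neg_one_ne_one_units : (-1 : Eˣ) ≠ 1 := by
  intro h
  have h1 := congrArg (fun u : Eˣ => (u : E)) h
  have h2 : algebraMap F E 2 = 0 := by
    rw [map_ofNat]
    push_cast at h1
    linear_combination -h1
  exact two_ne_zero_of_odd_card hq ((map_eq_zero _).mp h2)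

set_option maxHeartbeats 1000000 in
/-- The character table for induction from the Siegel subgroup, for an arbitrary class function. -/
theorem siegelSum_rep {ψ : GL (Fin 2) F → ℂ} (hψ : IsClassFun ψ) (σ : Fˣ →* ℂˣ) (c : Cls F)
    (hc : c.Valid θ γ) : siegelSum ψ σ (c.rep θ γ) = siegelTable ψ σ θ γ c := by
  have hhalf : ∀ k : ℤ,
      (up E (γ ^ k) * θ ^ ((Fintype.card F + 1) / 2)) ^ (Fintype.card F - 1) ≠ 1 := fun k => by
    rw [pow_card_sub_one_ellHalf hE hq hθ]
    exact neg_one_ne_one_units hq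
  have htr : ∀ k : ℤ,
      Algebra.trace F E ((up E (γ ^ k) * θ ^ ((Fintype.card F + 1) / 2) : Eˣ) : E) = 0 :=
    fun k => (trace_eq_zero_iff hE).mpr (pow_card_sub_one_ellHalf hE hq hθ _)
  have hθp : ∀ k i : ℤ, (up E (γ ^ k) * θ ^ i) ^ (Fintype.card F - 1) = eta F θ ^ i :=
    fun k i => pow_card_sub_one_theta _ _
  have hx : ∀ k i : ℤ, eta F θ ^ i ≠ 1 →
      (up E (γ ^ k) * θ ^ i) ^ (Fintype.card F - 1) ≠ 1 := fun k i h => by rwa [hθp k i]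
  have heta := pow_card_sub_one_eta_ne_one hγ
  have h2k : ∀ k : ℤ, γ ^ (2 * k) = γ ^ k * γ ^ k := fun k => by
    rw [_root_.two_mul, _root_.zpow_add]
  have hm : (-1 : Fˣ) ≠ 1 := (unit_ne_neg hq 1).symm
  have hnh := normUnit_ellHalf hE hγ hq hθ
  have hnt := normUnit_theta hE hγ
  have hne := normUnit_eta_zpow hE hγ
  have hB := fun k : ℤ => siegelSum_B hψ σ (γ ^ k) hq
  cases c <;> simp only [Cls.rep, siegelTable, _root_.zpow_add, h2k, _root_.zpow_sub,
    _root_.zpow_one] <;>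
    simp only [Cls.Valid, _root_.zpow_add, h2k, _root_.zpow_one] at hc
  case A1 k => exact siegelSum_A1 σ _
  case A2 k => exact siegelSum_A2 σ _
  case A31 k => exact siegelSum_A31 hψ σ _ hq
  case A32 k => exact siegelSum_A32 σ _ (not_isSquare_generator hE hγ hq hθ)
  case A5 k => exact siegelSum_A5 σ _
  case B11 k =>
    have := hB k 0 0
    rw [siegelUnip_zero, mul_one] at this
    rw [this, numSol_zero_zero]
    ring
  case B3 k =>
    rw [hB, numSol_zero_zero, numSol_zero one_ne_zero]
    ring
  case B41 k =>
    rw [hB, numSol_zero one_ne_zero]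
    ring
  case B42 k =>
    rw [hB, numSol_zero one_ne_zero, numSol_zero γ.ne_zero]
    ring
  case B21 k =>
    have := siegelSum_C1 hψ σ (γ ^ k) (-1) hm
    simp only [mul_neg, mul_one] at this
    rw [this]
  case B51 k =>
    have := siegelSum_C3 hψ σ (γ ^ k) (-1) hm
    simp only [mul_neg, mul_one] at this
    rw [this]
    ring
  case C1 i k => exact siegelSum_C1 hψ σ _ _ hc.1
  case C3 i k => exact siegelSum_C3 hψ σ _ _ hc.1
  case C21 i k => exact siegelSum_C21 hψ σ _ _ hq hc.1 hc.2
  case C4 i k => exact siegelSum_C4 hψ σ _ _ hc.1 hc.2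
  case C5 i k => exact siegelSum_C5 hψ σ _ _ hc.1 hc.2
  case C6 i j k => exact siegelSum_C6 hψ σ _ _ _ hc.1 hc.2.2.1 hc.2.2.2.2.1 hc.2.2.2.2.2
  case B12 k =>
    rw [ellHalf, siegelSum_ell_levi hE hψ σ (hhalf k) (r := -1) (by rw [hnh]; simp), htr,
      ell_up_neg_one hE (htr k), ellSiegelCount_neg_one]
    ring
  case B22 k =>
    rw [ellHalf, siegelSum_ell_levi hE hψ σ (hhalf k) (r := 1) (by rw [hnh, one_mul]),
      up_one, one_mul, ellSiegelCount_one hq]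
    ring
  case B43 k =>
    have h0 := ellSiegelCount_neg_one_of_ne hq
      (N := normUnit F (up E (γ ^ k) * θ ^ ((Fintype.card F + 1) / 2))) (a := 1) (b := 0)
      (Or.inl one_ne_zero)
    rw [zero_mul, neg_zero] at h0
    rw [ellHalf, siegelSum_ell_unip hE hψ σ (hhalf k) (r := -1) (by rw [hnh]; simp), htr, h0,
      zero_mul, add_zero]
  case B44 k a b =>
    have hab : a ≠ 0 ∨ b ≠ 0 := by
      by_contra! h
      exact hc ⟨0, by simp [h.1, h.2]⟩
    have h0 := ellSiegelCount_neg_one_of_ne hq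
      (N := normUnit F (up E (γ ^ k) * θ ^ ((Fintype.card F + 1) / 2))) hab
    have h1 : b * ((γ ^ k * γ ^ k * γ : Fˣ) : F) = -(b * (normUnit F
        (up E (γ ^ k) * θ ^ ((Fintype.card F + 1) / 2)) : Fˣ)) := by
      rw [hnh]
      push_cast
      ring
    rw [ellHalf, siegelSum_ell_unip hE hψ σ (hhalf k) (r := -1) (by rw [hnh]; simp), htr, h1,
      h0, zero_mul, add_zero]
  case B52 k =>
    rw [ellHalf, siegelSum_ell_unip hE hψ σ (hhalf k) (r := 1) (by rw [hnh, one_mul]),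
      ellSiegelCount_one_of_ne hq one_ne_zero, zero_mul, add_zero]
  case C22 i k =>
    rw [ellHalf, siegelSum_ell_levi hE hψ σ (hhalf k) (r := γ ^ i) (by
        rw [hnh, mul_neg]
        congr 1
        simp only [mul_comm, mul_left_comm]),
      ellSiegelCount_eq_one (charpoly_ne_zero hE (hhalf k)) hc.1
        (fun h => absurd h hc.2), one_mul, ellHalf, _root_.zpow_add, up_mul, ← mul_assoc,
        mul_comm (up E (γ ^ i))]
  case D1 i k =>
    exact siegelSum_ellKlingen ψ σ (charpoly_ne_zero hE (hx k i hc.1))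
      (by rw [ellTheta, ell_eq_companion, mat_klingen_companion])
  case D2 i k =>
    rw [ellTheta, siegelSum_ell_levi hE hψ σ (hx k i hc.1) (r := 1)
      (by rw [hnt, one_mul]), up_one, one_mul, ellSiegelCount_one hq]
    ring
  case D31 i k =>
    rw [ellTheta, siegelSum_ell_levi hE hψ σ (hx k i hc.1) (r := -1)
      (by rw [hnt, neg_one_mul]), up_neg_one, neg_one_mul,
      ellSiegelCount_eq_one (charpoly_ne_zero hE (hx k i hc.1)) hm
      (fun _ h => hc.2 (by rw [← hθp k i, (trace_eq_zero_iff hE).mp h])), one_mul]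
  case D4 i j k =>
    rw [ellTheta, siegelSum_ell_levi hE hψ σ (hx k i hc.1) (r := γ ^ j)
      (by rw [hnt, mul_comm (γ ^ j)]),
      ellSiegelCount_eq_one (charpoly_ne_zero hE (hx k i hc.1)) hc.2.2.1
      (fun h => absurd h hc.2.2.2), one_mul, ellTheta, _root_.zpow_add, up_mul, ← mul_assoc,
        mul_comm (up E (γ ^ j))]
  case D5 i k =>
    rw [ellTheta, siegelSum_ell_unip hE hψ σ (hx k i hc.1) (r := 1)
      (by rw [hnt, one_mul]), ellSiegelCount_one_of_ne hq one_ne_zero, zero_mul, add_zero]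
  case D6 i k =>
    exact siegelSum_ellKlingen ψ σ (charpoly_ne_zero hE (heta k i hc.1 hc.2))
      (by rw [ellEta, ell_eq_companion, mat_klingen_companion])
  case D8 i k =>
    exact siegelSum_ellKlingen ψ σ (charpoly_ne_zero hE (heta k i hc.1 hc.2))
      (by rw [ellEta, ell_eq_companion, mat_klingen_companion_unip])

end SiegelTable

/-! ### The Klingen table -/

section KlingenTable

variable {F : Type*} [Field F] [Fintype F]

omit [Fintype F] in
theorem ev_mul (χ : Fˣ →* ℂˣ) (a b : Fˣ) : ev χ (a * b) = ev χ a * ev χ b := by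
  rw [ev, map_mul, Units.val_mul]

omit [Fintype F] in
theorem ev_neg (χ : Fˣ →* ℂˣ) (a : Fˣ) : ev χ (-a) = ev χ a * ev χ (-1) := by
  rw [← ev_mul, mul_neg_one]

variable (χ : Fˣ →* ℂˣ) {ψ : GL (Fin 2) F → ℂ} (hψ : IsClassFun ψ) (u v w : Fˣ)

theorem klingenSum_A1 : klingenSum χ ψ (siegelLevi (dg u u) (u * u))
    = ((Fintype.card F : ℂ) ^ 2 + 1) * (Fintype.card F + 1) * ev χ u * ψ (dg u u) := by
  rw [klingenSum_corner_self χ ψ (mat_dg rfl rfl)]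
  simp [numSol_zero_zero, extendGL_diag]
  ring

include hψ

theorem klingenSum_A2 : klingenSum χ ψ (siegelLevi (dg u u) (u * u) * siegelUnip 0 1 0)
    = ev χ u * (ψ (dg u u) + Fintype.card F * (Fintype.card F + 1) * ψ (jd u)) := by
  rw [klingenSum_corner_self χ ψ (mat_dg_unip rfl rfl _ _)]
  have h : extendGL ψ !![(u : F), -u; 0, u] = ψ (jd u) :=
    extendGL_upper_self hψ u (neg_ne_zero.mpr u.ne_zero)
  simp [numSol_zero_zero, extendGL_diag, numSol_zero, h]
  ring

/-- The two isotropic lines on which the unipotent part acts trivially contribute `ψ (dg u u)`,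
and `q - 1` others contribute `ψ (jd u)`. -/
theorem klingenSum_A31 (hq : Odd (Fintype.card F)) :
    klingenSum χ ψ (siegelLevi (dg u u) (u * u) * siegelUnip 0 1 (-1))
    = 2 * ev χ u * (ψ (dg u u) + (Fintype.card F - 1) / 2 * ψ (jd u)) := by
  classical
  have h2 := two_ne_zero_of_odd_card hq
  have h1 : (1 : F) ≠ -1 := by
    intro h
    exact h2 (by linear_combination h)
  rw [klingenSum_corner_self χ ψ (mat_dg_unip rfl rfl _ _)]
  have ht : ∀ t : F, extendGL ψ !![(u : F), -(u * 1 + t ^ 2 * (u * -1)); 0, u]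
      = ψ (jd u) + ((if t = 1 then 1 else 0) + (if t = -1 then 1 else 0))
        * (ψ (dg u u) - ψ (jd u)) := by
    intro t
    by_cases h : t = 1 ∨ t = -1
    · have e : -((u : F) * 1 + t ^ 2 * (u * -1)) = 0 := by
        rcases h with rfl | rfl <;> ring
      rw [e, extendGL_diag]
      rcases h with rfl | rfl
      · rw [if_pos rfl, if_neg h1]
        ring
      · rw [if_neg h1.symm, if_pos rfl]
        ring
    · rw [if_neg (fun h' => h (Or.inl h')), if_neg (fun h' => h (Or.inr h')),
        extendGL_upper_self hψ u]
      · ring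
      · intro e
        have e' : (u : F) * ((t - 1) * (t + 1)) = 0 := by linear_combination e
        rcases mul_eq_zero.mp ((mul_eq_zero_iff_left u.ne_zero).mp e') with e' | e'
        · exact h (Or.inl (by linear_combination e'))
        · exact h (Or.inr (by linear_combination e'))
  have h0 : extendGL ψ !![(u : F), u * -1; 0, u] = ψ (jd u) :=
    extendGL_upper_self hψ u (by simp)
  simp only [ht, h0, ← Finset.mul_sum, Finset.sum_add_distrib, ← Finset.sum_mul]
  simp [numSol_zero]
  ring

theorem klingenSum_A32 {γ : Fˣ} (hγ : ¬ IsSquare (γ : F)) :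
    klingenSum χ ψ (siegelLevi (dg u u) (u * u) * siegelUnip 0 1 (-(γ : F)))
    = (Fintype.card F + 1) * ev χ u * ψ (jd u) := by
  rw [klingenSum_corner_self χ ψ (mat_dg_unip rfl rfl _ _)]
  have ht : ∀ t : F, extendGL ψ !![(u : F), -(u * 1 + t ^ 2 * (u * -γ)); 0, u] = ψ (jd u) := by
    intro t
    apply extendGL_upper_self hψ u
    intro e
    have e' : (u : F) * (t ^ 2 * γ - 1) = 0 := by linear_combination e
    have e'' := (mul_eq_zero_iff_left u.ne_zero).mp e'
    have ht : t ≠ 0 := by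
      rintro rfl
      simp at e''
    refine hγ ⟨t⁻¹, ?_⟩
    field_simp
    linear_combination e''
  have h0 : extendGL ψ !![(u : F), u * -γ; 0, u] = ψ (jd u) :=
    extendGL_upper_self hψ u (by simp)
  simp only [ht, h0]
  simp [numSol_zero]
  ring

theorem klingenSum_C1 (hv : v ≠ 1) : klingenSum χ ψ (siegelLevi (dg u u) (u * u * v))
    = (Fintype.card F + 1) * ev χ u * (1 + ev χ v) * ψ (dg u (u * v)) := by
  have h' : u ≠ u * v := by simpa using hv
  have h := units_sub_ne_zero h'
  rw [klingenSum_corner_self χ ψ (mat_dg (mul_assoc u u v) (mul_assoc u u v))]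
  simp only [numSol_of_ne h, extendGL_upper hψ h', Finset.sum_const, Finset.card_univ,
    nsmul_eq_mul, ev_mul]
  ring

theorem klingenSum_A5 : klingenSum χ ψ (siegelLevi (jd u) (u * u) * siegelUnip 0 0 1)
    = ev χ u * ψ (jd u) :=
  klingenSum_jordan_self χ hψ (mat_jd_unip rfl _) one_ne_zero

theorem klingenSum_C3 (hv : v ≠ 1) : klingenSum χ ψ (siegelLevi (jd u) (u * u * v))
    = ev χ u * (1 + ev χ v) * ψ (dg u (u * v)) := by
  rw [klingenSum_jordan χ hψ (mat_jd (mul_assoc u u v)) (by simpa using hv), ev_mul]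
  ring

theorem klingenSum_B (hq : Odd (Fintype.card F)) (κ x : F) :
    klingenSum χ ψ (siegelLevi (dg u (-u)) (u * u) * siegelUnip 0 κ x)
    = ev χ u * ((1 + numSol 0 κ) * extendGL ψ !![((-u : Fˣ) : F), u * x; 0, ((-u : Fˣ) : F)]
      + ev χ (-1) * (1 + numSol 0 x) * extendGL ψ !![(u : F), u * κ; 0, u]) := by
  classical
  have h := units_sub_ne_zero (unit_ne_neg hq u)
  have h' := units_sub_ne_zero (unit_ne_neg hq u).symm
  have hsol : ∀ (a : Fˣ) (t : F), numSol 0 (a * t) = numSol 0 t := by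
    intro a t
    by_cases ht : t = 0
    · simp [ht]
    · rw [numSol_zero ht, numSol_zero (by simpa using ht)]
  have hext : ∀ (a b : Fˣ) (t : F),
      extendGL ψ !![(a : F), -(b * t); 0, a] = extendGL ψ !![(a : F), b * t; 0, a] := by
    intro a b t
    by_cases ht : t = 0
    · simp [ht]
    · rw [extendGL_upper_self hψ, extendGL_upper_self hψ] <;> simp [ht]
  have hx : ((-u : Fˣ) : F) * x = -(u * x) := by push_cast; ring
  rw [klingenSum_corner χ ψ (mat_dg_unip (d := -u) (e := u) (by simp) rfl _ _) (by simp)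
    (unit_ne_neg hq u), numSol_of_ne h, numSol_of_ne h', sub_self, sub_self, hsol, hsol, hx,
    hext, hext, ev_neg χ u]
  ring

theorem klingenSum_C21 (hq : Odd (Fintype.card F)) (hv : v ≠ 1) (hv' : v ≠ -1) :
    klingenSum χ ψ (siegelLevi (dg u (-u)) (-(u * u * v)))
    = ev χ u * ((ev χ v + ev χ (-1)) * ψ (dg u (-(u * v)))
        + (1 + ev χ (-v)) * ψ (dg (-u) (u * v))) := by
  have h1' : -u ≠ u * v := fun h => hv' (by
    rw [← mul_right_inj u, ← h]; simp)
  have h2' : u ≠ -(u * v) := fun h => hv' (by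
    rw [← mul_right_inj u, mul_neg_one]; exact neg_eq_iff_eq_neg.mp h.symm)
  have h3' : u ≠ u * v := by simpa using hv
  have h4' : -u ≠ -(u * v) := fun h => h3' (neg_inj.mp h)
  rw [klingenSum_corner χ ψ (mat_dg (d := u * v) (e := -(u * v)) (by simp [mul_assoc])
    (by simp [mul_assoc])) (by simp) (unit_ne_neg hq u), extendGL_upper hψ h1',
    extendGL_upper hψ h2', numSol_of_ne (units_sub_ne_zero h1'),
    numSol_of_ne (units_sub_ne_zero h2'), numSol_of_ne (units_sub_ne_zero h3'),
    numSol_of_ne (units_sub_ne_zero h4'), ev_neg χ u, ev_neg χ (u * v), ev_neg χ v, ev_mul]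
  ring

theorem klingenSum_C4 (hv : v ≠ 1) (hv' : v ≠ -1) :
    klingenSum χ ψ (klingenLevi (u * v) (jd u))
    = ev χ u * ((ev χ v + ev χ v⁻¹) * ψ (jd u) + ψ (dg (u * v) (u * v⁻¹))) := by
  have h1 : (u * v : Fˣ) ≠ u := by simpa using hv
  have h3 : u * v ≠ u * v⁻¹ := by simpa using units_inv_ne_self v hv hv'
  rw [klingenSum_corner χ ψ (mat_klingenLevi_jd (mul_mul_inv_eq u v)) (mul_mul_inv_eq u v).symm
    h1, sub_self, numSol_zero one_ne_zero, numSol_of_ne (units_sub_ne_zero h1),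
    numSol_of_ne (units_sub_ne_zero h3), extendGL_upper hψ h3,
    extendGL_upper_self hψ u one_ne_zero, ev_mul, ev_mul]
  ring

theorem klingenSum_C5 (hv : v ≠ 1) (hv' : v ≠ -1) :
    klingenSum χ ψ (klingenLevi (u * v) (dg u u))
    = ev χ u * ((ev χ v + ev χ v⁻¹) * ψ (dg u u)
      + (Fintype.card F + 1) * ψ (dg (u * v) (u * v⁻¹))) := by
  have h1 : (u * v : Fˣ) ≠ u := by simpa using hv
  have h2 : u ≠ u * v⁻¹ := by simpa using hv
  have h3 : u * v ≠ u * v⁻¹ := by simpa using units_inv_ne_self v hv hv'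
  rw [klingenSum_corner χ ψ (mat_klingenLevi_dg (mul_mul_inv_eq u v)) (mul_mul_inv_eq u v).symm
    h1, sub_self, numSol_zero_zero, numSol_of_ne (units_sub_ne_zero h1),
    numSol_of_ne (units_sub_ne_zero h2), numSol_of_ne (units_sub_ne_zero h3),
    extendGL_upper hψ h3, extendGL_diag, ev_mul, ev_mul]
  ring

theorem klingenSum_C6 (hv : v ≠ 1) (hw : w ≠ 1) (hvw : v ≠ w) (hvw' : v * w ≠ 1) :
    klingenSum χ ψ (siegelLevi (dg u (u * v)) (u * u * v * w))
    = ev χ u * ((1 + ev χ (v * w)) * ψ (dg (u * v) (u * w))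
      + (ev χ v + ev χ w) * ψ (dg u (u * v * w))) := by
  have h1 : u * v ≠ u * w := by simpa using hvw
  have h2 : u ≠ u * v * w := by simpa [mul_assoc] using hvw'
  have h3 : u ≠ u * w := by simpa using hw
  have h4 : u * v ≠ u * v * w := by simpa using hw
  rw [klingenSum_corner χ ψ (mat_dg (d := u * w) (e := u * v * w) (by
      rw [mul_mul_mul_comm]; simp only [mul_assoc]) (by simp only [mul_assoc])) (by
      rw [mul_mul_mul_comm]; simp only [mul_assoc]) (by simpa using hv),
    numSol_of_ne (units_sub_ne_zero h1), numSol_of_ne (units_sub_ne_zero h2),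
    numSol_of_ne (units_sub_ne_zero h3), numSol_of_ne (units_sub_ne_zero h4),
    extendGL_upper hψ h1, extendGL_upper hψ h2, ev_mul χ (u * v) w, ev_mul, ev_mul, ev_mul]
  ring

end KlingenTable

section KlingenElliptic

variable {F E : Type*} [Field F] [Fintype F] [Field E] [Algebra F E] [FiniteDimensional F E]
  (hE : Module.finrank F E = 2) (χ : Fˣ →* ℂˣ) (ψ : GL (Fin 2) F → ℂ)

include hE

theorem klingenSum_ell_unip {x : Eˣ} (hx : x ^ (Fintype.card F - 1) ≠ 1) (c : Fˣ) (μ κ y : F) :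
    klingenSum χ ψ (siegelLevi (ell x) c * siegelUnip μ κ y) = 0 := by
  rw [ell_eq_companion]
  exact klingenSum_ell χ ψ (charpoly_ne_zero hE hx)
    (mat_companion_unip (r := c / normUnit F x) (by simp) _ _ _ _)

theorem klingenSum_ell_levi {x : Eˣ} (hx : x ^ (Fintype.card F - 1) ≠ 1) (c : Fˣ) :
    klingenSum χ ψ (siegelLevi (ell x) c) = 0 := by
  simpa [siegelUnip_zero] using klingenSum_ell_unip hE χ ψ hx c 0 0 0

variable {θ : Eˣ} {γ : Fˣ}
  (hγ : algebraMap F E (γ : F) = (θ : E) ^ (Fintype.card F + 1))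
  (hq : Odd (Fintype.card F)) (hθ : ∀ x : Eˣ, x ∈ Subgroup.zpowers θ)

include hγ hq hθ

set_option maxHeartbeats 1000000 in
/-- The character table for induction from the Klingen subgroup, for an arbitrary class function. -/
theorem klingenSum_rep (hψ : IsClassFun ψ) (c : Cls F) (hc : c.Valid θ γ) :
    klingenSum χ ψ (c.rep θ γ) = klingenTable χ ψ θ γ c := by
  have hhalf : ∀ k : ℤ,
      (up E (γ ^ k) * θ ^ ((Fintype.card F + 1) / 2)) ^ (Fintype.card F - 1) ≠ 1 := fun k => by
    rw [pow_card_sub_one_ellHalf hE hq hθ]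
    exact neg_one_ne_one_units hq
  have hx : ∀ k i : ℤ, eta F θ ^ i ≠ 1 →
      (up E (γ ^ k) * θ ^ i) ^ (Fintype.card F - 1) ≠ 1 := fun k i h => by
    rwa [pow_card_sub_one_theta]
  have heta := pow_card_sub_one_eta_ne_one hγ
  have h2k : ∀ k : ℤ, γ ^ (2 * k) = γ ^ k * γ ^ k := fun k => by
    rw [_root_.two_mul, _root_.zpow_add]
  have hm : (-1 : Fˣ) ≠ 1 := (unit_ne_neg hq 1).symm
  have hnt := normUnit_theta hE hγ
  have hne := normUnit_eta_zpow hE hγ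
  have hB := fun k : ℤ => klingenSum_B χ hψ (γ ^ k) hq
  have hj : ∀ (a b : Fˣ) (t : F), t ≠ 0 →
      extendGL ψ !![(a : F), b * t; 0, (a : F)] = ψ (jd a) :=
    fun a b t ht => extendGL_upper_self hψ a (mul_ne_zero b.ne_zero ht)
  cases c <;> simp only [Cls.rep, klingenTable, _root_.zpow_add, h2k, _root_.zpow_sub,
    _root_.zpow_one, _root_.zpow_neg] <;>
    simp only [Cls.Valid, _root_.zpow_add, h2k, _root_.zpow_one] at hc
  case A1 k => exact klingenSum_A1 χ _
  case A2 k => exact klingenSum_A2 χ hψ _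
  case A31 k => exact klingenSum_A31 χ hψ _ hq
  case A32 k => exact klingenSum_A32 χ hψ _ (not_isSquare_generator hE hγ hq hθ)
  case A5 k => exact klingenSum_A5 χ hψ _
  case B11 k =>
    have := hB k 0 0
    rw [siegelUnip_zero, mul_one] at this
    rw [this, numSol_zero_zero, mul_zero, extendGL_diag, extendGL_diag]
    ring
  case B3 k =>
    rw [hB, numSol_zero_zero, numSol_zero one_ne_zero, mul_zero, extendGL_diag,
      hj _ _ _ one_ne_zero]
    ring
  case B41 k =>
    rw [hB, numSol_zero one_ne_zero, hj _ _ _ one_ne_zero, hj _ _ _ one_ne_zero]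
    ring
  case B42 k =>
    rw [hB, numSol_zero one_ne_zero, numSol_zero γ.ne_zero, hj _ _ _ γ.ne_zero,
      hj _ _ _ one_ne_zero]
    ring
  case B21 k =>
    have := klingenSum_C1 χ hψ (γ ^ k) (-1) hm
    simp only [mul_neg, mul_one] at this
    rw [this]
  case B51 k =>
    have := klingenSum_C3 χ hψ (γ ^ k) (-1) hm
    simp only [mul_neg, mul_one] at this
    rw [this]
  case C1 i k => exact klingenSum_C1 χ hψ _ _ hc.1
  case C3 i k => exact klingenSum_C3 χ hψ _ _ hc.1
  case C21 i k => exact klingenSum_C21 χ hψ _ _ hq hc.1 hc.2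
  case C4 i k => exact klingenSum_C4 χ hψ _ _ hc.1 hc.2
  case C5 i k => exact klingenSum_C5 χ hψ _ _ hc.1 hc.2
  case C6 i j k => exact klingenSum_C6 χ hψ _ _ _ hc.1 hc.2.2.1 hc.2.2.2.2.1 hc.2.2.2.2.2
  case B12 k => exact klingenSum_ell_levi hE χ ψ (hhalf k) _
  case B22 k => exact klingenSum_ell_levi hE χ ψ (hhalf k) _
  case B43 k => exact klingenSum_ell_unip hE χ ψ (hhalf k) _ _ _ _
  case B44 k a b => exact klingenSum_ell_unip hE χ ψ (hhalf k) _ _ _ _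
  case B52 k => exact klingenSum_ell_unip hE χ ψ (hhalf k) _ _ _ _
  case C22 i k => exact klingenSum_ell_levi hE χ ψ (hhalf k) _
  case D2 i k => exact klingenSum_ell_levi hE χ ψ (hx k i hc.1) _
  case D31 i k => exact klingenSum_ell_levi hE χ ψ (hx k i hc.1) _
  case D4 i j k => exact klingenSum_ell_levi hE χ ψ (hx k i hc.1) _
  case D5 i k => exact klingenSum_ell_unip hE χ ψ (hx k i hc.1) _ _ _ _
  case D1 i k =>
    have hN : normUnit F (up E (γ ^ k) * θ ^ i) / γ ^ k = γ ^ k * γ ^ i := by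
      rw [hnt, mul_assoc, mul_div_cancel_left]
    have h : ((γ ^ k : Fˣ) : F) - (normUnit F (up E (γ ^ k) * θ ^ i) : Fˣ) / (γ ^ k : Fˣ) ≠ 0 := by
      rw [← Units.val_div_eq_div_val, hN]
      exact units_sub_ne_zero (by simpa using hc.2)
    rw [klingenSum_ellKlingen χ ψ (charpoly_ne_zero hE (hx k i hc.1))
      (by rw [ellTheta, ell_eq_companion, mat_klingen_companion]), numSol_of_ne h, hN, ev_mul,
      ellTheta, ell_eq_companion]
    ring
  case D6 i k =>
    have hN : normUnit F (up E (γ ^ k) * eta F θ ^ i) / γ ^ k = γ ^ k := by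
      rw [hne, mul_div_cancel_left]
    rw [klingenSum_ellKlingen χ ψ (charpoly_ne_zero hE (heta k i hc.1 hc.2))
      (by rw [ellEta, ell_eq_companion, mat_klingen_companion]), ← Units.val_div_eq_div_val, hN,
      sub_self, mul_zero, numSol_zero_zero, ellEta, ell_eq_companion]
    ring
  case D8 i k =>
    have hN : normUnit F (up E (γ ^ k) * eta F θ ^ i) / γ ^ k = γ ^ k := by
      rw [hne, mul_div_cancel_left]
    rw [klingenSum_ellKlingen χ ψ (charpoly_ne_zero hE (heta k i hc.1 hc.2))
      (by rw [ellEta, ell_eq_companion, mat_klingen_companion_unip]),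
      ← Units.val_div_eq_div_val, hN, sub_self, mul_one, numSol_zero (Units.ne_zero _),
      ellEta, ell_eq_companion]
    ring

end KlingenElliptic

/-! ### Induction in stages from the Borel subgroup -/

section BorelTwo

variable {F : Type*} [Field F]

/-- The upper triangular subgroup of `GL(2)`. -/
def borelTwo (F : Type*) [Field F] : Subgroup (GL (Fin 2) F) where
  carrier := {A | A.1 1 0 = 0}
  mul_mem' {A B} hA hB := by
    simp only [Set.mem_ofPred_eq] at *
    simp [Matrix.mul_apply, hA, hB]
  one_mem' := by simp
  inv_mem' {A} hA := by
    simp only [Set.mem_ofPred_eq] at *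
    rw [Matrix.coe_units_inv, Matrix.inv_def, Matrix.adjugate_fin_two]
    simp [hA]

theorem mem_borelTwo_iff (A : GL (Fin 2) F) : A ∈ borelTwo F ↔ A.1 1 0 = 0 := Iff.rfl

/-- The first diagonal entry on the upper triangular subgroup. -/
def borelTwoFst : borelTwo F →* Fˣ :=
  MonoidHom.toHomUnits
    { toFun := fun A => A.1.1 0 0
      map_one' := by simp
      map_mul' := fun A B => by
        have h := (mem_borelTwo_iff _).mp B.2
        simp [Matrix.mul_apply, h] }

/-- The second diagonal entry on the upper triangular subgroup. -/
def borelTwoSnd : borelTwo F →* Fˣ :=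
  MonoidHom.toHomUnits
    { toFun := fun A => A.1.1 1 1
      map_one' := by simp
      map_mul' := fun A B => by
        have h := (mem_borelTwo_iff _).mp A.2
        simp [Matrix.mul_apply, h] }

/-- Representatives of the cosets of the upper triangular subgroup, one for each point of the
projective line. -/
def borelTwoRep : Option F → GL (Fin 2) F
  | none => 1
  | some t => Matrix.GeneralLinearGroup.mkOfDetNeZero !![0, 1; 1, t] (by simp)

/-- The inverse of `borelTwoRep y` as a matrix. -/
def borelTwoRepInv : Option F → Matrix (Fin 2) (Fin 2) F
  | none => 1
  | some t => !![-t, 1; 1, 0]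

theorem borelTwoRep_inv_val (y : Option F) : ((borelTwoRep y)⁻¹).1 = borelTwoRepInv y := by
  have h : (borelTwoRep y).1 * borelTwoRepInv y = 1 := by
    rcases y with _ | t
    · simp [borelTwoRep, borelTwoRepInv]
    · ext i j
      fin_cases i <;> fin_cases j <;>
        simp [borelTwoRep, borelTwoRepInv, Matrix.GeneralLinearGroup.mkOfDetNeZero,
          Matrix.mul_apply]
  calc ((borelTwoRep y)⁻¹).1 = ((borelTwoRep y)⁻¹).1 * ((borelTwoRep y).1 * borelTwoRepInv y) := by
        rw [h, mul_one]
    _ = _ := by rw [← mul_assoc, ← Units.val_mul, inv_mul_cancel, Units.val_one, one_mul]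

theorem isCosetReps_borelTwoRep : IsCosetReps (borelTwo F) (borelTwoRep (F := F)) := by
  refine isCosetReps_of (fun A => ?_) fun y y' h => ?_
  · simp only [mem_borelTwo_iff, Units.val_mul, borelTwoRep_inv_val]
    by_cases h : A.1 1 0 = 0
    · exact ⟨none, by simpa [borelTwoRepInv] using h⟩
    · refine ⟨some (A.1 1 1 / A.1 1 0), ?_⟩
      simp [borelTwoRepInv, Matrix.mul_apply]
      field_simp
      ring
  · rw [mem_borelTwo_iff, Units.val_mul, borelTwoRep_inv_val] at h
    rcases y with _ | t <;> rcases y' with _ | t' <;>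
      simp [borelTwoRep, borelTwoRepInv, Matrix.GeneralLinearGroup.mkOfDetNeZero,
          Matrix.mul_apply] at h ⊢
    linear_combination h

/-- The principal series representation of `GL(2)`, induced from `χ₁(a) χ₂(b)`. -/
def principalSeries (χ₁ χ₂ : Fˣ →* ℂˣ) :=
  Representation.coind (borelTwo F).subtype
    (twist ((χ₁.comp borelTwoFst) * (χ₂.comp borelTwoSnd))
      (Representation.trivial ℂ (borelTwo F) ℂ))

variable (χ₁ χ₂ : Fˣ →* ℂˣ)

theorem isClassFun_character {V : Type*} [AddCommGroup V] [Module ℂ V]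
    (π : Representation ℂ (GL (Fin 2) F) V) : IsClassFun π.character :=
  fun A B => Representation.char_conj π A B

variable [Fintype F]

open Classical in
theorem character_principalSeries_eq (A : GL (Fin 2) F) :
    (principalSeries χ₁ χ₂).character A = ∑ y,
      if h : borelTwoRep y * A * (borelTwoRep y)⁻¹ ∈ borelTwo F then
        ev χ₁ (borelTwoFst ⟨_, h⟩) * ev χ₂ (borelTwoSnd ⟨_, h⟩) else 0 := by
  rw [principalSeries, isCosetReps_borelTwoRep.character_coind]
  refine Finset.sum_congr rfl fun y _ => ?_
  split_ifs with h
  · rw [character_twist, character_trivial, mul_one]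
    rfl
  · rfl

open Classical in
theorem character_principalSeries (A : GL (Fin 2) F) :
    (principalSeries χ₁ χ₂).character A =
      (if A.1 1 0 = 0 then
        MulChar.ofUnitHom χ₁ (A.1 0 0) * MulChar.ofUnitHom χ₂ (A.1 1 1) else 0)
      + ∑ t, if A.1 0 1 + t * A.1 1 1 - t * (A.1 0 0 + t * A.1 1 0) = 0 then
        MulChar.ofUnitHom χ₁ (A.1 1 1 - t * A.1 1 0)
          * MulChar.ofUnitHom χ₂ (A.1 0 0 + t * A.1 1 0) else 0 := by
  have key : ∀ y, (if h : borelTwoRep y * A * (borelTwoRep y)⁻¹ ∈ borelTwo F then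
      ev χ₁ (borelTwoFst ⟨_, h⟩) * ev χ₂ (borelTwoSnd ⟨_, h⟩) else 0) =
      if ((borelTwoRep y).1 * A.1 * borelTwoRepInv y) 1 0 = 0 then
        MulChar.ofUnitHom χ₁ (((borelTwoRep y).1 * A.1 * borelTwoRepInv y) 0 0)
          * MulChar.ofUnitHom χ₂ (((borelTwoRep y).1 * A.1 * borelTwoRepInv y) 1 1) else 0 := by
    intro y
    have hm : (borelTwoRep y * A * (borelTwoRep y)⁻¹).1
        = (borelTwoRep y).1 * A.1 * borelTwoRepInv y := by
      rw [Units.val_mul, Units.val_mul, borelTwoRep_inv_val]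
    rw [← hm]
    by_cases h : borelTwoRep y * A * (borelTwoRep y)⁻¹ ∈ borelTwo F
    · rw [dif_pos h, if_pos ((mem_borelTwo_iff _).mp h)]
      congr 1
      · exact (MulChar.ofUnitHom_coe χ₁ (borelTwoFst ⟨_, h⟩)).symm
      · exact (MulChar.ofUnitHom_coe χ₂ (borelTwoSnd ⟨_, h⟩)).symm
    · rw [dif_neg h, if_neg (mt (mem_borelTwo_iff _).mpr h)]
  rw [character_principalSeries_eq]
  simp only [key, Fintype.sum_option]
  congr 1
  · simp [borelTwoRep, borelTwoRepInv]
  · refine Finset.sum_congr rfl fun t _ => ?_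
    have e : (borelTwoRep (some t)).1 * A.1 * borelTwoRepInv (some t)
        = !![A.1 1 1 - t * A.1 1 0, A.1 1 0;
          A.1 0 1 + t * A.1 1 1 - t * (A.1 0 0 + t * A.1 1 0), A.1 0 0 + t * A.1 1 0] := by
      ext i j
      fin_cases i <;> fin_cases j <;>
        simp [borelTwoRep, borelTwoRepInv, Matrix.GeneralLinearGroup.mkOfDetNeZero,
          Matrix.mul_apply, Matrix.vecMul, dotProduct] <;> ring
    rw [e]
    simp

theorem principalSeries_dg_self (a : Fˣ) : (principalSeries χ₁ χ₂).character (dg a a)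
    = (Fintype.card F + 1) * (ev χ₁ a * ev χ₂ a) := by
  rw [character_principalSeries]
  simp [dg_val]
  ring

theorem principalSeries_jd (a : Fˣ) : (principalSeries χ₁ χ₂).character (jd a)
    = ev χ₁ a * ev χ₂ a := by
  rw [character_principalSeries]
  simp [jd_val]

theorem principalSeries_dg {a b : Fˣ} (hab : a ≠ b) :
    (principalSeries χ₁ χ₂).character (dg a b)
    = ev χ₁ a * ev χ₂ b + ev χ₁ b * ev χ₂ a := by
  have h := units_sub_ne_zero hab
  rw [character_principalSeries, Finset.sum_eq_single 0]
  · simp [dg_val]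
  · intro t _ ht
    rw [if_neg]
    simp only [dg_val]
    simp
    intro h'
    have : t * ((a : F) - b) = 0 := by linear_combination -h'
    simp [ht, h] at this
  · simp

/-- An elliptic element fixes no point of the projective line. -/
theorem principalSeries_companion {N : Fˣ} {T : F} (hirr : ∀ s : F, s ^ 2 - T * s + N ≠ 0) :
    (principalSeries χ₁ χ₂).character (companion N T) = 0 := by
  rw [character_principalSeries, Finset.sum_eq_zero]
  · simp [companion_val]
  · intro t _
    rw [if_neg]
    simp only [companion_val]
    simp
    intro h
    exact hirr t (by linear_combination -h)

end BorelTwo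

section Stages

/-- Representatives for the cosets of the preimage `K` in `H` of a subgroup `B` under `f`,
obtained from those of `H` and those of `B`. -/
theorem IsCosetReps.preimage {G L ι κ : Type*} [Group G] [Group L] {H K : Subgroup G}
    {B : Subgroup L} {f : H →* L} (hK : ∀ g, g ∈ K ↔ ∃ h : g ∈ H, f ⟨g, h⟩ ∈ B)
    {R : ι → G} (hR : IsCosetReps H R) {Y : κ → L} (hY : IsCosetReps B Y) {s : κ → H}
    (hs : ∀ y, f (s y) = Y y) :
    IsCosetReps K (fun p : ι × κ => (s p.2 : G) * R p.1) := by
  refine isCosetReps_of (fun g => ?_) ?_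
  · obtain ⟨i, hi, -⟩ := hR g
    obtain ⟨y, hy, -⟩ := hY (f ⟨_, hi⟩)
    refine ⟨(i, y), (hK _).mpr ?_⟩
    have e : g * ((s y : G) * R i)⁻¹ = ((⟨_, hi⟩ * (s y)⁻¹ : H) : G) := by
      simp [mul_assoc]
    simp only [e]
    refine ⟨Subtype.property _, ?_⟩
    rw [Subtype.coe_eta, map_mul, map_inv, hs]
    exact hy
  · rintro ⟨i, y⟩ ⟨j, z⟩ h
    obtain ⟨h1, h2⟩ := (hK _).mp h
    have h3 : R i * (R j)⁻¹ ∈ H := by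
      have := H.mul_mem (H.mul_mem (H.inv_mem (s y).2) h1) (s z).2
      simpa [mul_assoc] using this
    have hij : i = j := (hR (R i)).unique (by simp [H.one_mem]) h3
    subst hij
    have e : (⟨_, h1⟩ : H) = s y * (s z)⁻¹ := by
      ext
      simp [mul_assoc]
    rw [e, map_mul, map_inv, hs, hs] at h2
    have hyz : y = z := (hY (Y y)).unique (by simp [B.one_mem]) h2
    rw [hyz]

variable {F : Type*} [Field F]

theorem siegelLevi_mem_siegel (A : GL (Fin 2) F) (c : Fˣ) : siegelLevi A c ∈ siegel F := by
  rw [mem_siegel_iff]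
  simp [siegelLevi, mat_ofMatrix]

theorem siegelBlock_siegelLevi (A : GL (Fin 2) F) (c : Fˣ) :
    siegelBlock ⟨siegelLevi A c, siegelLevi_mem_siegel A c⟩ = A := by
  apply Units.ext
  exact (Matrix.eta_fin_two A.1).symm

theorem mem_borel_iff (g : GSp4 F) :
    g ∈ borel F ↔ ∃ h : g ∈ siegel F, siegelBlock ⟨g, h⟩ ∈ borelTwo F := by
  constructor
  · intro hg
    refine ⟨(mem_siegel_iff g).mpr ⟨hg ?_, hg ?_, hg ?_, hg ?_⟩, (hg ?_ : mat g 1 0 = 0)⟩ <;> simp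
  · rintro ⟨h, h10⟩
    obtain ⟨h1, h2, h3, h4⟩ := (mem_siegel_iff g).mp h
    have h10' : mat g 1 0 = 0 := h10
    have hdet : mat g 0 0 * mat g 1 1 - mat g 0 1 * mat g 1 0 ≠ 0 := by
      have := (Matrix.isUnit_iff_isUnit_det _).mp (siegelBlock ⟨g, h⟩).isUnit |>.ne_zero
      rwa [Matrix.det_fin_two] at this
    have h11 : mat g 1 1 ≠ 0 := by
      intro h11
      simp [h10', h11] at hdet
    have e := congrFun (congrFun (mat_mul_J_mul_transpose g) 1) 3
    simp [Matrix.mul_apply, Fin.sum_univ_four, J, h3, h4, h10', h11] at e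
    intro i j hij
    fin_cases i <;> fin_cases j <;> simp_all

variable [Fintype F]

/-- Induction in stages: `χ₁ × χ₂ ⋊ σ` is induced from the principal series of the Siegel Levi
subgroup. -/
theorem character_borelInd (χ₁ χ₂ σ : Fˣ →* ℂˣ) (g : GSp4 F) :
    (borelInd χ₁ χ₂ σ).character g = siegelSum (principalSeries χ₁ χ₂).character σ g := by
  classical
  have hreps := isCosetReps_siegelRep.preimage mem_borel_iff
    (isCosetReps_borelTwoRep (F := F))
    (s := fun y => ⟨siegelLevi (borelTwoRep y) 1, siegelLevi_mem_siegel _ _⟩)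
    (fun y => siegelBlock_siegelLevi _ _)
  rw [borelInd, hreps.character_coind, siegelSum_eq, Fintype.sum_prod_type]
  refine Finset.sum_congr rfl fun i _ => ?_
  have hconj : ∀ y, siegelLevi (borelTwoRep y) 1 * siegelRep i * g
      * (siegelLevi (borelTwoRep y) 1 * siegelRep i)⁻¹ = siegelLevi (borelTwoRep y) 1
        * (siegelRep i * g * (siegelRep i)⁻¹) * (siegelLevi (borelTwoRep y) 1)⁻¹ := fun y => by
    simp only [_root_.mul_inv_rev, mul_assoc]
  have hmul := multiplier_conj (siegelRep i) g
  split_ifs with h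
  · rw [character_principalSeries_eq, Finset.mul_sum]
    refine Finset.sum_congr rfl fun y _ => ?_
    have hs := siegelLevi_mem_siegel (borelTwoRep y) 1
    have hmem := (siegel F).mul_mem ((siegel F).mul_mem hs h) ((siegel F).inv_mem hs)
    have hblock : siegelBlock ⟨_, hmem⟩ = borelTwoRep y * siegelBlock ⟨_, h⟩
        * (borelTwoRep y)⁻¹ := by
      have : (⟨_, hmem⟩ : siegel F) = ⟨_, hs⟩ * ⟨_, h⟩ * ⟨_, hs⟩⁻¹ := rfl
      rw [this, map_mul, map_mul, map_inv, siegelBlock_siegelLevi]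
    by_cases hy : borelTwoRep y * siegelBlock ⟨_, h⟩ * (borelTwoRep y)⁻¹ ∈ borelTwo F
    · have hb : siegelLevi (borelTwoRep y) 1 * siegelRep i * g
          * (siegelLevi (borelTwoRep y) 1 * siegelRep i)⁻¹ ∈ borel F := by
        rw [hconj]
        exact (mem_borel_iff _).mpr ⟨hmem, by rwa [hblock]⟩
      rw [dif_pos hy, dif_pos hb, character_twist, character_trivial, mul_one]
      have e1 : borelFst ⟨_, hb⟩ = borelTwoFst ⟨_, hy⟩ := by
        apply Units.ext
        have := congrArg (fun A : GL (Fin 2) F => A.1 0 0) hblock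
        simp only [← hconj] at this
        exact this
      have e2 : borelSnd ⟨_, hb⟩ = borelTwoSnd ⟨_, hy⟩ := by
        apply Units.ext
        have := congrArg (fun A : GL (Fin 2) F => A.1 1 1) hblock
        simp only [← hconj] at this
        exact this
      have e3 : (multiplier.comp (borel F).subtype) ⟨_, hb⟩ = multiplier g :=
        multiplier_conj _ _
      simp only [MonoidHom.mul_apply, MonoidHom.comp_apply, Units.val_mul] at e3 ⊢
      rw [e1, e2, e3]
      ring
    · rw [dif_neg hy, dif_neg, mul_zero]
      intro hb
      simp only [hconj] at hb
      obtain ⟨_, h2⟩ := (mem_borel_iff _).mp hb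
      rw [hblock] at h2
      exact hy h2
  · refine Finset.sum_eq_zero fun y _ => dif_neg fun hb => h ?_
    simp only [hconj] at hb
    obtain ⟨h1, -⟩ := (mem_borel_iff _).mp hb
    have hs := siegelLevi_mem_siegel (borelTwoRep y) 1
    have := (siegel F).mul_mem ((siegel F).mul_mem ((siegel F).inv_mem hs) h1) hs
    simpa [mul_assoc] using this

end Stages

section BorelTable

variable {F E : Type*} [Field F] [Fintype F] [Field E] [Algebra F E] [FiniteDimensional F E]
  (hE : Module.finrank F E = 2) (χ₁ χ₂ σ : Fˣ →* ℂˣ)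

include hE

theorem principalSeries_ell {x : Eˣ} (hx : x ^ (Fintype.card F - 1) ≠ 1) :
    (principalSeries χ₁ χ₂).character (ell x) = 0 := by
  rw [ell_eq_companion]
  exact principalSeries_companion χ₁ χ₂ (charpoly_ne_zero hE hx)

variable {θ : Eˣ} {γ : Fˣ} (hq : Odd (Fintype.card F)) (hθ : ∀ x : Eˣ, x ∈ Subgroup.zpowers θ)

include hq hθ

set_option maxHeartbeats 1000000 in
/-- The Siegel table for the character of a principal series is the Borel table. -/
theorem siegelTable_principalSeries (c : Cls F) (hc : c.Valid θ γ) :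
    siegelTable (principalSeries χ₁ χ₂).character σ θ γ c = borelTable χ₁ χ₂ σ γ c := by
  have hhalf : ∀ k : ℤ, (principalSeries χ₁ χ₂).character (ellHalf θ γ k) = 0 := fun k => by
    refine principalSeries_ell hE χ₁ χ₂ ?_
    rw [pow_card_sub_one_ellHalf hE hq hθ]
    exact neg_one_ne_one_units hq
  have hx : ∀ k i : ℤ, eta F θ ^ i ≠ 1 →
      (up E (γ ^ k) * θ ^ i) ^ (Fintype.card F - 1) ≠ 1 := fun k i h => by
    rwa [pow_card_sub_one_theta]
  have hell : ∀ k i : ℤ, eta F θ ^ i ≠ 1 →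
      (principalSeries χ₁ χ₂).character (ellTheta θ γ k i) = 0 := fun k i h =>
    principalSeries_ell hE χ₁ χ₂ (hx k i h)
  have hneg : ∀ k i : ℤ, eta F θ ^ i ≠ 1 →
      (principalSeries χ₁ χ₂).character (ell (-(up E (γ ^ k) * θ ^ i))) = 0 := fun k i h => by
    refine principalSeries_ell hE χ₁ χ₂ ?_
    have he : Even (Fintype.card F - 1) := hq.tsub_odd odd_one
    rw [he.neg_pow]
    exact hx k i h
  have hn : ∀ u : Fˣ, u ≠ -u := unit_ne_neg hq
  have h1 := principalSeries_dg_self χ₁ χ₂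
  have h2 := principalSeries_jd χ₁ χ₂
  have h3 := fun (a b : Fˣ) (h : a ≠ b) => principalSeries_dg χ₁ χ₂ h
  have en₁ := ev_neg χ₁
  have en₂ := ev_neg χ₂
  have em₁ := ev_mul χ₁
  have em₂ := ev_mul χ₂
  cases c <;> simp only [borelTable, siegelTable, _root_.zpow_add, _root_.zpow_sub,
    _root_.zpow_neg] <;>
    simp only [Cls.Valid, _root_.zpow_add] at hc
  case A1 k => rw [h1]; ring
  case A2 k => rw [h1]; ring
  case A31 k => rw [h1, h2]; ring
  case A32 k => rw [h1]; ring
  case A5 k => rw [h2]; ring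
  case B11 k => rw [h3 _ _ (hn _), en₁ (γ ^ k), en₂ (γ ^ k)]; ring
  case B12 k => rw [hhalf, mul_zero]
  case B21 k =>
    rw [h1, h1, h3 _ _ (hn _), en₁ (γ ^ k), en₂ (γ ^ k)]
    ring
  case B22 k => rw [hhalf, mul_zero]
  case B3 k => rw [h3 _ _ (hn _), en₁ (γ ^ k), en₂ (γ ^ k)]; ring
  case B41 k => rw [h3 _ _ (hn _), en₁ (γ ^ k), en₂ (γ ^ k)]; ring
  case B42 k => rw [h3 _ _ (hn _), en₁ (γ ^ k), en₂ (γ ^ k)]; ring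
  case B43 k => rw [hhalf, mul_zero]
  case B44 k => rw [hhalf, mul_zero]
  case B51 k =>
    rw [h2, h2, h3 _ _ (hn _), en₁ (γ ^ k), en₂ (γ ^ k)]
    ring
  case B52 k => rw [hhalf, mul_zero]
  case C1 i k =>
    rw [h1, h1, h3 _ _ (by simpa using hc.1), em₁ _ (γ ^ i), em₂ _ (γ ^ i)]
    ring
  case C21 i k =>
    have e : γ ^ k ≠ γ ^ k * γ ^ i := by simpa using hc.1
    rw [h3 _ _ (hn _), h3 _ _ (hn _), h3 _ _ e,
      h3 _ _ (fun h => e (neg_inj.mp h)), en₁ (γ ^ k), en₂ (γ ^ k), en₁ (γ ^ k * γ ^ i),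
      en₂ (γ ^ k * γ ^ i), em₁ _ (γ ^ i), em₂ _ (γ ^ i)]
    ring
  case C22 i k => rw [hhalf, ← _root_.zpow_add, hhalf, add_zero, mul_zero]
  case C3 i k =>
    rw [h2, h2, h3 _ _ (by simpa using hc.1), em₁ _ (γ ^ i), em₂ _ (γ ^ i)]
    ring
  case C4 i k =>
    rw [h3 _ _ (by simpa using hc.1), h3 _ _ (by simpa using hc.1), em₁ _ (γ ^ i)⁻¹,
      em₂ _ (γ ^ i)⁻¹, em₁ _ (γ ^ i), em₂ _ (γ ^ i)]
    ring
  case C5 i k =>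
    rw [h3 _ _ (by simpa using hc.1), h3 _ _ (by simpa using hc.1), em₁ _ (γ ^ i)⁻¹,
      em₂ _ (γ ^ i)⁻¹, em₁ _ (γ ^ i), em₂ _ (γ ^ i)]
    ring
  case C6 i j k =>
    rw [h3 _ _ (by simpa using hc.1), h3 _ _ (by simpa using hc.2.2.1),
      h3 _ _ (by simpa using hc.2.2.1),
      h3 _ _ (by simpa [mul_right_comm _ (γ ^ i)] using hc.1)]
    simp only [ev_mul]
    ring
  case D2 i k => rw [hell _ _ hc.1, mul_zero]
  case D31 i k => rw [hell _ _ hc.1, hneg _ _ hc.1, add_zero, mul_zero]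
  case D4 i j k => rw [hell _ _ hc.1, hell _ _ hc.1, add_zero, mul_zero]
  case D5 i k => rw [hell _ _ hc.1, mul_zero]

end BorelTable

/-! ### Normal forms in `GL(2)` and matrices of conjugates -/

section NormalForms

variable {F : Type*} [Field F]

theorem isConj_of_val {A A' P : GL (Fin 2) F} (h : A.1 * P.1 = P.1 * A'.1) : IsConj A' A :=
  isConj_iff.mpr ⟨P, by
    rw [mul_inv_eq_iff_eq_mul]
    exact Units.ext h.symm⟩

/-- A matrix with an eigenvalue `s` is conjugate to an upper triangular one. -/
theorem isConj_upper {A : GL (Fin 2) F} {s : F}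
    (hs : s ^ 2 - (A.1 0 0 + A.1 1 1) * s + A.1.det = 0) :
    ∃ A' : GL (Fin 2) F, IsConj A' A ∧ A'.1 1 0 = 0 := by
  rw [Matrix.det_fin_two] at hs
  by_cases h : A.1 1 0 = 0
  · exact ⟨A, IsConj.refl A, h⟩
  · -- the first column of the base change is an eigenvector
    let P : GL (Fin 2) F := Matrix.GeneralLinearGroup.mkOfDetNeZero
      !![s - A.1 1 1, 1; A.1 1 0, 0] (by simpa using h)
    refine ⟨P⁻¹ * A * P, ?_, ?_⟩
    · rw [isConj_iff]
      exact ⟨P, by group⟩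
    · have hP : P.1 = !![s - A.1 1 1, 1; A.1 1 0, 0] := rfl
      have hPi : (P⁻¹).1 = !![0, (A.1 1 0)⁻¹; 1, -((s - A.1 1 1) / A.1 1 0)] := by
        rw [Matrix.coe_units_inv]
        apply Matrix.inv_eq_right_inv
        rw [hP]
        ext i j
        fin_cases i <;> fin_cases j <;> simp [Matrix.mul_apply, h]
        field_simp
        ring
      rw [Units.val_mul, Units.val_mul, hPi, hP]
      simp [Matrix.mul_apply, Fin.sum_univ_two, Matrix.vecMul, dotProduct]
      field_simp
      linear_combination -hs

/-- Every element of `GL(2)` is conjugate to a diagonal matrix, a Jordan block, or the companion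
matrix of an irreducible polynomial. -/
theorem exists_normal_form (A : GL (Fin 2) F) :
    (∃ a b, IsConj (dg a b) A) ∨ (∃ a, IsConj (jd a) A) ∨
      ∃ (N : Fˣ) (T : F), (∀ s : F, s ^ 2 - T * s + N ≠ 0) ∧ IsConj (companion N T) A := by
  by_cases hirr : ∀ s : F, s ^ 2 - (A.1 0 0 + A.1 1 1) * s + A.1.det ≠ 0
  · right; right
    refine ⟨A.det, A.1 0 0 + A.1 1 1, hirr, ?_⟩
    have h : A.1 1 0 ≠ 0 := by
      intro h
      apply hirr (A.1 0 0)
      rw [Matrix.det_fin_two, h]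
      ring
    have hd : ((A.det : Fˣ) : F) = A.1 0 0 * A.1 1 1 - A.1 0 1 * A.1 1 0 :=
      Matrix.det_fin_two A.1
    refine isConj_of_val (P := Matrix.GeneralLinearGroup.mkOfDetNeZero
      !![1, A.1 0 0; 0, A.1 1 0] (by simpa using h)) ?_
    ext i j
    fin_cases i <;> fin_cases j <;>
      simp [companion_val, Matrix.GeneralLinearGroup.mkOfDetNeZero, Matrix.mul_apply, hd] <;> ring
  · push Not at hirr
    obtain ⟨s, hs⟩ := hirr
    obtain ⟨A', hA', h10⟩ := isConj_upper hs
    have hdet : A'.1.det ≠ 0 := (Matrix.isUnit_iff_isUnit_det _).mp A'.isUnit |>.ne_zero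
    rw [Matrix.det_fin_two, h10, mul_zero, sub_zero] at hdet
    obtain ⟨a, ha⟩ : ∃ a : Fˣ, (a : F) = A'.1 0 0 := ⟨Units.mk0 _ (left_ne_zero_of_mul hdet), rfl⟩
    obtain ⟨b, hb⟩ : ∃ b : Fˣ, (b : F) = A'.1 1 1 := ⟨Units.mk0 _ (right_ne_zero_of_mul hdet), rfl⟩
    have hval : A'.1 = !![(a : F), A'.1 0 1; 0, (b : F)] := by
      ext i j
      fin_cases i <;> fin_cases j <;> simp [ha, hb, h10]
    generalize A'.1 0 1 = p at hval
    by_cases hab : a = b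
    · subst hab
      by_cases hp : p = 0
      · left
        refine ⟨a, a, ?_⟩
        have : dg a a = A' := Units.ext (by rw [hval, hp, dg_val])
        rwa [this]
      · right; left
        refine ⟨a, IsConj.trans (isConj_of_val (P := Matrix.GeneralLinearGroup.mkOfDetNeZero
          !![p, 0; 0, 1] (by simpa using hp)) ?_) hA'⟩
        rw [hval]
        ext i j
        fin_cases i <;> fin_cases j <;>
          simp [jd_val, Matrix.GeneralLinearGroup.mkOfDetNeZero, Matrix.mul_apply, mul_comm]
    · left
      have h : (b : F) - a ≠ 0 := units_sub_ne_zero (Ne.symm hab)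
      refine ⟨a, b, IsConj.trans (isConj_of_val (P := Matrix.GeneralLinearGroup.mkOfDetNeZero
        !![1, p / (b - a); 0, 1] (by simp)) ?_) hA'⟩
      rw [hval]
      ext i j
      fin_cases i <;> fin_cases j <;>
        simp [dg_val, Matrix.GeneralLinearGroup.mkOfDetNeZero, Matrix.mul_apply]
      field_simp
      ring

theorem mat_siegelUnip (μ κ x : F) :
    mat (siegelUnip μ κ x) = !![1, 0, μ, κ; 0, 1, x, μ; 0, 0, 1, 0; 0, 0, 0, 1] := rfl

/-- The Levi decomposition of the Siegel subgroup. -/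
theorem exists_siegelUnip (g : siegel F) : ∃ μ κ x : F,
    (g : GSp4 F) = siegelLevi (siegelBlock g) (multiplier g) * siegelUnip μ κ x := by
  let m : siegel F := ⟨siegelLevi (siegelBlock g) (multiplier g), siegelLevi_mem_siegel _ _⟩
  let u : siegel F := m⁻¹ * g
  have hblock : siegelBlock u = 1 := by
    rw [map_mul, map_inv, siegelBlock_siegelLevi, inv_mul_cancel]
  have hmult : multiplier (u : GSp4 F) = 1 := by
    have : (u : GSp4 F) = (siegelLevi (siegelBlock g) (multiplier g))⁻¹ * g := rfl
    rw [this, map_mul, map_inv, multiplier_siegelLevi, inv_mul_cancel]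
  have hb := congrArg Units.val hblock
  have h00 : mat (u : GSp4 F) 0 0 = 1 := congrFun (congrFun hb 0) 0
  have h01 : mat (u : GSp4 F) 0 1 = 0 := congrFun (congrFun hb 0) 1
  have h10 : mat (u : GSp4 F) 1 0 = 0 := congrFun (congrFun hb 1) 0
  have h11 : mat (u : GSp4 F) 1 1 = 1 := congrFun (congrFun hb 1) 1
  obtain ⟨h20, h21, h30, h31⟩ := (mem_siegel_iff _).mp u.2
  have hJ := mat_mul_J_mul_transpose (u : GSp4 F)
  rw [hmult, Units.val_one, one_smul] at hJ
  have e02 := congrFun (congrFun hJ 0) 2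
  have e03 := congrFun (congrFun hJ 0) 3
  have e12 := congrFun (congrFun hJ 1) 2
  have e13 := congrFun (congrFun hJ 1) 3
  have e01 := congrFun (congrFun hJ 0) 1
  simp [Matrix.mul_apply, Fin.sum_univ_four, J, h00, h01, h10, h11, h20, h21, h30, h31]
    at e02 e03 e12 e13 e01
  refine ⟨mat (u : GSp4 F) 0 2, mat (u : GSp4 F) 0 3, mat (u : GSp4 F) 1 2, ?_⟩
  have hu : (u : GSp4 F) = siegelUnip (mat (u : GSp4 F) 0 2) (mat (u : GSp4 F) 0 3)
      (mat (u : GSp4 F) 1 2) := by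
    apply mat_injective
    rw [mat_siegelUnip]
    ext i j
    fin_cases i <;> fin_cases j <;>
      simp [h00, h01, h10, h11, h20, h21, h30, h31, e02, e03, e12, e13]
    linear_combination e01
  rw [← hu]
  exact (mul_inv_cancel_left _ _).symm

/-- Conjugating inside the Siegel subgroup changes the block into any conjugate of it. -/
theorem exists_conj_siegelLevi {g : GSp4 F} (hg : g ∈ siegel F) {A : GL (Fin 2) F}
    (hA : IsConj A (siegelBlock ⟨g, hg⟩)) : ∃ c : Fˣ, ∃ μ κ x : F,
    IsConj (siegelLevi A c * siegelUnip μ κ x) g := by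
  obtain ⟨B, hB⟩ := isConj_iff.mp hA.symm
  let m : siegel F := ⟨siegelLevi B 1, siegelLevi_mem_siegel _ _⟩
  have hblock : siegelBlock (m * ⟨g, hg⟩ * m⁻¹) = A := by
    rw [map_mul, map_mul, map_inv, siegelBlock_siegelLevi, hB]
  obtain ⟨μ, κ, x, h⟩ := exists_siegelUnip (m * ⟨g, hg⟩ * m⁻¹)
  rw [hblock] at h
  refine ⟨multiplier (m * ⟨g, hg⟩ * m⁻¹ : siegel F), μ, κ, x, ?_⟩
  rw [← h]
  exact IsConj.symm (isConj_iff.mpr ⟨m, rfl⟩)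

end NormalForms

section Represented

variable {F E : Type*} [Field F] [Fintype F] [Field E] [Algebra F E] [FiniteDimensional F E]

/-- Every element of the group whose matrix is `M` is conjugate to the representative of one of the
listed classes. -/
def Represented (θ : Eˣ) (γ : Fˣ) (M : Matrix (Fin 4) (Fin 4) F) : Prop :=
  ∀ g : GSp4 F, mat g = M → ∃ c : Cls F, c.Valid θ γ ∧ IsConj (c.rep θ γ) g

variable {θ : Eˣ} {γ : Fˣ} {M M' : Matrix (Fin 4) (Fin 4) F}

theorem represented_of_rep (c : Cls F) (hc : c.Valid θ γ) (h : mat (c.rep θ γ) = M) :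
    Represented θ γ M := fun g hg =>
  ⟨c, hc, by
    rw [mat_injective (h.trans hg.symm)]⟩

theorem Represented.of_conj (hM' : Represented θ γ M') (x : GSp4 F)
    (h : mat x * M = M' * mat x) : Represented θ γ M := by
  intro g hg
  have hmat : mat (x * g * x⁻¹) = M' := by
    rw [mat_mul, mat_mul, hg, h, Matrix.mul_assoc, mat_mul_mat_inv, Matrix.mul_one]
  obtain ⟨c, hc, hconj⟩ := hM' _ hmat
  exact ⟨c, hc, hconj.trans (IsConj.symm (isConj_iff.mpr ⟨x, rfl⟩))⟩

end Represented

section Elements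

variable {F : Type*} [Field F]

/-- The Weyl element exchanging the first two basis vectors. -/
def weylOuter (F : Type*) [Field F] : GSp4 F :=
  ofMatrix !![0, 1, 0, 0; 1, 0, 0, 0; 0, 0, 0, 1; 0, 0, 1, 0] 1 (by
    ext i j
    fin_cases i <;> fin_cases j <;> simp [J, Matrix.mul_apply, Fin.sum_univ_four])

theorem mat_weylOuter :
    mat (weylOuter F) = !![0, 1, 0, 0; 1, 0, 0, 0; 0, 0, 0, 1; 0, 0, 1, 0] := rfl

/-- The Weyl element exchanging the second and third basis vectors, up to a sign. -/
def weylInner (F : Type*) [Field F] : GSp4 F :=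
  ofMatrix !![1, 0, 0, 0; 0, 0, 1, 0; 0, -1, 0, 0; 0, 0, 0, 1] 1 (by
    ext i j
    fin_cases i <;> fin_cases j <;> simp [J, Matrix.mul_apply, Fin.sum_univ_four])

theorem mat_weylInner :
    mat (weylInner F) = !![1, 0, 0, 0; 0, 0, 1, 0; 0, -1, 0, 0; 0, 0, 0, 1] := rfl

/-- The element of the diagonal torus with first two entries `s`, `t` and multiplier `c`. -/
def torusElt (s t c : Fˣ) : GSp4 F :=
  ofMatrix !![(s : F), 0, 0, 0; 0, t, 0, 0; 0, 0, c / t, 0; 0, 0, 0, c / s] c (by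
    ext i j
    fin_cases i <;> fin_cases j <;> simp [J, Matrix.mul_apply, Fin.sum_univ_four] <;> field_simp)

theorem mat_torusElt (s t c : Fˣ) : mat (torusElt s t c) =
    !![(s : F), 0, 0, 0; 0, t, 0, 0; 0, 0, c / t, 0; 0, 0, 0, c / s] := rfl

/-- The upper unipotent element of the Siegel Levi subgroup. -/
def leviUnip (t : F) : GSp4 F :=
  ofMatrix !![1, t, 0, 0; 0, 1, 0, 0; 0, 0, 1, -t; 0, 0, 0, 1] 1 (by
    ext i j
    fin_cases i <;> fin_cases j <;> simp [J, Matrix.mul_apply, Fin.sum_univ_four])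

theorem mat_leviUnip (t : F) : mat (leviUnip t) =
    !![1, t, 0, 0; 0, 1, 0, 0; 0, 0, 1, -t; 0, 0, 0, 1] := rfl

/-- An element of the unipotent radical of the Klingen subgroup. -/
def klingenUnip (v w : F) : GSp4 F :=
  ofMatrix !![1, v, w, 0; 0, 1, 0, w; 0, 0, 1, -v; 0, 0, 0, 1] 1 (by
    ext i j
    fin_cases i <;> fin_cases j <;> simp [J, Matrix.mul_apply, Fin.sum_univ_four, mul_comm])

theorem mat_klingenUnip (v w : F) : mat (klingenUnip v w) =
    !![1, v, w, 0; 0, 1, 0, w; 0, 0, 1, -v; 0, 0, 0, 1] := rfl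

end Elements

/-! ### The classes of split elements -/

section Generators

variable {F E : Type*} [Field F] [Fintype F] [Field E] [Algebra F E] [FiniteDimensional F E]
  (hE : Module.finrank F E = 2) {θ : Eˣ} {γ : Fˣ}
  (hγ : algebraMap F E (γ : F) = (θ : E) ^ (Fintype.card F + 1))
  (hθ : ∀ x : Eˣ, x ∈ Subgroup.zpowers θ)

include hE hθ

omit [Fintype F] [Field F] [Algebra F E] [FiniteDimensional F E] hE hθ in
theorem card_sub_one_pos [Field F] [Fintype F] : 0 < Fintype.card F - 1 :=
  Nat.sub_pos_of_lt Fintype.one_lt_card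

include hγ

theorem exists_up_of_pow_eq_one {x : Eˣ} (hx : x ^ (Fintype.card F - 1) = 1) :
    ∃ k : ℤ, x = up E (γ ^ k) := by
  obtain ⟨i, rfl⟩ := hθ x
  simp only at hx ⊢
  rw [← zpow_natCast, ← _root_.zpow_mul, ← orderOf_dvd_iff_zpow_eq_one,
    orderOf_generator hE hθ] at hx
  push_cast at hx
  have hpos : ((Fintype.card F - 1 : ℕ) : ℤ) ≠ 0 := by
    exact_mod_cast (card_sub_one_pos (F := F)).ne'
  obtain ⟨m, rfl⟩ := (mul_dvd_mul_iff_right hpos).mp hx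
  refine ⟨m, ?_⟩
  have h : θ ^ (Fintype.card F + 1) = up E γ := Units.ext (by
    rw [Units.val_pow_eq_pow_val, ← hγ]
    rfl)
  have h' : ((Fintype.card F : ℤ) + 1) = ((Fintype.card F + 1 : ℕ) : ℤ) := by push_cast; rfl
  rw [h', _root_.zpow_mul, zpow_natCast, h]
  exact (map_zpow (Units.map (algebraMap F E).toMonoidHom) γ m).symm

theorem exists_zpow_eq (u : Fˣ) : ∃ k : ℤ, γ ^ k = u := by
  obtain ⟨k, hk⟩ := exists_up_of_pow_eq_one hE hγ hθ (up_pow_card_sub_one (E := E) u)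
  refine ⟨k, Units.ext ((algebraMap F E).injective ?_)⟩
  exact congrArg Units.val hk.symm

omit hγ in
/-- Elements of norm one are powers of `η`. -/
theorem exists_eta_zpow {x : Eˣ} (hx : normUnit F x = 1) : ∃ i : ℤ, x = eta F θ ^ i := by
  obtain ⟨i, rfl⟩ := hθ x
  have h1 : (θ ^ i) ^ (Fintype.card F + 1) = 1 := by
    apply Units.ext
    rw [Units.val_pow_eq_pow_val, ← algebraMap_norm hE, ← normUnit_val]
    simp only at hx ⊢
    rw [hx, Units.val_one, map_one, Units.val_one]
  simp only at hx ⊢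
  rw [← zpow_natCast, ← _root_.zpow_mul, ← orderOf_dvd_iff_zpow_eq_one,
    orderOf_generator hE hθ, mul_comm i] at h1
  push_cast at h1
  have hpos : ((Fintype.card F : ℤ) + 1) ≠ 0 := by positivity
  obtain ⟨m, rfl⟩ := (mul_dvd_mul_iff_left hpos).mp h1
  exact ⟨m, by rw [eta, _root_.zpow_mul, zpow_natCast]⟩

/-- Up to squares, every element of `Fˣ` is `1` or `γ`. -/
theorem exists_sq (f : Fˣ) : ∃ s : Fˣ, s ^ 2 = f ∨ s ^ 2 = γ * f := by
  obtain ⟨k, rfl⟩ := exists_zpow_eq hE hγ hθ f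
  rcases Int.even_or_odd' k with ⟨m, rfl | rfl⟩
  · exact ⟨γ ^ m, Or.inl (by rw [← zpow_natCast, ← _root_.zpow_mul, mul_comm]; rfl)⟩
  · refine ⟨γ ^ (m + 1), Or.inr ?_⟩
    rw [← zpow_natCast, ← _root_.zpow_mul, ← _root_.zpow_one_add]
    congr 1
    push_cast
    ring

end Generators

section Moves

variable {F E : Type*} [Field F] [Fintype F] [Field E] [Algebra F E] [FiniteDimensional F E]
  {θ : Eˣ} {γ : Fˣ} {a b d e : Fˣ} {κ x : F}

theorem Represented.corner_outer (h : Represented θ γ (cornerMat b a e d x κ)) :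
    Represented θ γ (cornerMat a b d e κ x) := by
  refine h.of_conj (weylOuter F) ?_
  rw [mat_weylOuter]
  ext i j
  fin_cases i <;> fin_cases j <;>
    simp [cornerMat, Matrix.mul_apply, Fin.sum_univ_four]

theorem Represented.corner_inner (h : Represented θ γ (cornerMat a d b e κ 0)) :
    Represented θ γ (cornerMat a b d e κ 0) := by
  refine h.of_conj (weylInner F) ?_
  rw [mat_weylInner]
  ext i j
  fin_cases i <;> fin_cases j <;>
    simp [cornerMat, Matrix.mul_apply, Fin.sum_univ_four]

/-- Conjugation by the torus changes the entries above the diagonal by a common scalar and by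
independent squares. -/
theorem Represented.corner_scale {κ' x' : F} (h : Represented θ γ (cornerMat a b d e κ' x'))
    (s t c : Fˣ) (hκ : κ' * c = s ^ 2 * κ) (hx : x' * c = t ^ 2 * x) :
    Represented θ γ (cornerMat a b d e κ x) := by
  refine h.of_conj (torusElt s t c) ?_
  have hs := s.ne_zero
  have ht := t.ne_zero
  rw [mat_torusElt]
  ext i j
  fin_cases i <;> fin_cases j <;>
    simp [cornerMat, Matrix.mul_apply, Fin.sum_univ_four, mul_comm]
  · field_simp
    linear_combination -hκ
  · field_simp
    linear_combination -hx

theorem Represented.corner_kill (hbd : b ≠ d) (h : Represented θ γ (cornerMat a b d e κ 0)) :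
    Represented θ γ (cornerMat a b d e κ x) := by
  have hbd' := units_sub_ne_zero hbd
  refine h.of_conj (siegelUnip 0 0 (x / (b - d))) ?_
  rw [mat_siegelUnip]
  ext i j
  fin_cases i <;> fin_cases j <;>
    simp [cornerMat, Matrix.mul_apply, Fin.sum_univ_four]
  field_simp
  ring

theorem Represented.corner_kill_outer (hae : a ≠ e)
    (h : Represented θ γ (cornerMat a b d e 0 x)) :
    Represented θ γ (cornerMat a b d e κ x) :=
  (h.corner_outer.corner_kill hae).corner_outer

end Moves

section Corner

variable {F E : Type*} [Field F] [Fintype F] [Field E] [Algebra F E] [FiniteDimensional F E]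
  (hE : Module.finrank F E = 2) {θ : Eˣ} {γ : Fˣ}
  (hγ : algebraMap F E (γ : F) = (θ : E) ^ (Fintype.card F + 1))
  (hq : Odd (Fintype.card F)) (hθ : ∀ x : Eˣ, x ∈ Subgroup.zpowers θ)

omit [Fintype F] in
theorem zpow_two_mul_eq {u : Fˣ} {k : ℤ} (hk : γ ^ k = u) : γ ^ (2 * k) = u * u := by
  rw [_root_.two_mul, _root_.zpow_add, hk]

include hE hγ hθ

theorem exists_scale {κ x : F} (hκ : κ ≠ 0) (hx : x ≠ 0) :
    ∃ s : Fˣ, -κ = (s : F) ^ 2 * x ∨ -(γ * κ) = (s : F) ^ 2 * x := by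
  obtain ⟨s, hs⟩ := exists_sq hE hγ hθ (Units.mk0 (-κ / x) (by simp [hκ, hx]))
  refine ⟨s, hs.imp (fun h => ?_) fun h => ?_⟩
  all_goals
    have h' := congrArg Units.val h
    simp only [Units.val_pow_eq_pow_val, Units.val_mul, Units.val_mk0] at h'
    rw [h']
    field_simp

/-- Unipotent up to a scalar: the quadratic form `κ X² + x Y²` is normalized by scaling. -/
theorem represented_corner_one (u : Fˣ) (κ x : F) :
    Represented θ γ (cornerMat u u u u κ x) := by
  obtain ⟨k, hk⟩ := exists_zpow_eq hE hγ hθ u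
  have hu := u.ne_zero
  have h2 := zpow_two_mul_eq hk
  have hA2 : ∀ y : F, y ≠ 0 → Represented θ γ (cornerMat u u u u y 0) := by
    intro y hy
    refine Represented.corner_scale (κ' := u) (x' := 0) ?_ 1 1 (Units.mk0 (y / u) (by simp [hy]))
      (by simp; field_simp) (by simp)
    refine represented_of_rep (.A2 k) trivial ?_
    rw [Cls.rep, h2, hk, mat_dg_unip rfl rfl, mul_one, mul_zero]
  by_cases hκ : κ = 0
  · by_cases hx : x = 0
    · refine represented_of_rep (.A1 k) trivial ?_
      rw [Cls.rep, h2, hk, mat_dg rfl rfl, hκ, hx]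
    · rw [hκ]
      exact (hA2 x hx).corner_outer
  · by_cases hx : x = 0
    · rw [hx]
      exact hA2 κ hκ
    · obtain ⟨s, hs⟩ := exists_scale hE hγ hθ hκ hx
      rcases hs with hs | hs
      · refine Represented.corner_scale (κ' := u) (x' := u * -1) ?_ 1 s
          (Units.mk0 (κ / u) (by simp [hκ])) (by simp; field_simp) ?_
        · refine represented_of_rep (.A31 k) trivial ?_
          rw [Cls.rep, h2, hk, mat_dg_unip rfl rfl, mul_one]
        · rw [← hs, Units.val_mk0]
          field_simp
      · refine Represented.corner_scale (κ' := u) (x' := u * -γ) ?_ 1 s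
          (Units.mk0 (κ / u) (by simp [hκ])) (by simp; field_simp) ?_
        · refine represented_of_rep (.A32 k) trivial ?_
          rw [Cls.rep, h2, hk, mat_dg_unip rfl rfl, mul_one]
        · rw [← hs, Units.val_mk0]
          field_simp

/-- Eigenvalues `u`, `-u`, each on a nondegenerate plane. -/
theorem represented_corner_neg (u : Fˣ) (κ x : F) :
    Represented θ γ (cornerMat u (-u) (-u) u κ x) := by
  have hB3 : ∀ (u : Fˣ) (y : F), y ≠ 0 → Represented θ γ (cornerMat u (-u) (-u) u 0 y) := by
    intro u y hy
    obtain ⟨k, hk⟩ := exists_zpow_eq hE hγ hθ u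
    have hu := u.ne_zero
    refine Represented.corner_scale (κ' := 0) (x' := (-u : Fˣ) * 1) ?_ 1 1
      (Units.mk0 (y / -u) (by simp [hy])) (by simp) (by simp; field_simp)
    refine represented_of_rep (.B3 k) trivial ?_
    rw [Cls.rep, zpow_two_mul_eq hk, hk, mat_dg_unip (d := -u) (e := u) (by simp) rfl, mul_zero]
  obtain ⟨k, hk⟩ := exists_zpow_eq hE hγ hθ u
  have hu := u.ne_zero
  have h2 := zpow_two_mul_eq hk
  by_cases hκ : κ = 0
  · by_cases hx : x = 0
    · refine represented_of_rep (.B11 k) trivial ?_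
      rw [Cls.rep, h2, hk, mat_dg (d := -u) (e := u) (by simp) rfl, hκ, hx]
    · rw [hκ]
      exact hB3 u x hx
  · by_cases hx : x = 0
    · have := hB3 (-u) κ hκ
      rw [neg_neg] at this
      rw [hx]
      exact this.corner_outer
    · obtain ⟨s, hs⟩ := exists_scale hE hγ hθ hκ hx
      rcases hs with hs | hs
      · refine Represented.corner_scale (κ' := u * 1) (x' := (-u : Fˣ) * 1) ?_ 1 s
          (Units.mk0 (κ / u) (by simp [hκ])) (by simp; field_simp) ?_
        · refine represented_of_rep (.B41 k) trivial ?_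
          rw [Cls.rep, h2, hk, mat_dg_unip (d := -u) (e := u) (by simp) rfl]
        · rw [← hs, Units.val_mk0]
          push_cast
          field_simp
      · refine Represented.corner_scale (κ' := u * 1) (x' := (-u : Fˣ) * γ) ?_ 1 s
          (Units.mk0 (κ / u) (by simp [hκ])) (by simp; field_simp) ?_
        · refine represented_of_rep (.B42 k) trivial ?_
          rw [Cls.rep, h2, hk, mat_dg_unip (d := -u) (e := u) (by simp) rfl]
        · rw [← hs, Units.val_mk0]
          push_cast
          field_simp

/-- The middle block has only one eigenvalue, different from those of the corners. -/
theorem represented_corner_middle {a b e : Fˣ} (h : a * e = b * b) (hab : a ≠ b) (hab' : a ≠ -b)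
    (x : F) : Represented θ γ (cornerMat a b b e 0 x) := by
  obtain ⟨k, hk⟩ := exists_zpow_eq hE hγ hθ b
  obtain ⟨i, hi⟩ := exists_zpow_eq hE hγ hθ (a / b)
  have hki : γ ^ (k + i) = a := by rw [_root_.zpow_add, hk, hi, mul_div_cancel]
  have hv : γ ^ i ≠ 1 ∧ γ ^ i ≠ -1 := by
    rw [hi]
    refine ⟨fun h => hab (div_eq_one.mp h), fun h => hab' ?_⟩
    rw [div_eq_iff_eq_mul] at h
    simpa using h
  by_cases hx : x = 0
  · refine represented_of_rep (.C5 i k) hv ?_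
    rw [Cls.rep, hki, hk, mat_klingenLevi_dg h.symm, hx]
  · refine Represented.corner_scale (κ' := 0) (x' := 1) ?_ 1 1 (Units.mk0 x hx) (by simp)
      (by simp)
    refine represented_of_rep (.C4 i k) hv ?_
    rw [Cls.rep, hki, hk, mat_klingenLevi_jd h.symm]

theorem represented_corner_pair {a d : Fˣ} (had : a ≠ d) :
    Represented θ γ (cornerMat a a d d 0 0) := by
  obtain ⟨k, hk⟩ := exists_zpow_eq hE hγ hθ a
  by_cases h : d = -a
  · refine represented_of_rep (.B21 k) trivial ?_
    rw [Cls.rep, zpow_two_mul_eq hk, hk, mat_dg (d := d) (e := d)] <;> simp [h]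
  · obtain ⟨i, hi⟩ := exists_zpow_eq hE hγ hθ (d / a)
    refine represented_of_rep (.C1 i k) ?_ ?_
    · rw [Cls.Valid, hi]
      refine ⟨fun h' => had (div_eq_one.mp h').symm, fun h' => h ?_⟩
      rw [div_eq_iff_eq_mul] at h'
      simpa using h'
    · have : γ ^ (2 * k + i) = a * d := by
        rw [_root_.zpow_add, zpow_two_mul_eq hk, hi, mul_assoc, mul_div_cancel]
      rw [Cls.rep, this, hk, mat_dg rfl rfl]

theorem represented_corner_opposite {a d : Fˣ} (had : a ≠ d) (had' : d ≠ -a) :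
    Represented θ γ (cornerMat a (-a) d (-d) 0 0) := by
  obtain ⟨k, hk⟩ := exists_zpow_eq hE hγ hθ a
  obtain ⟨i, hi⟩ := exists_zpow_eq hE hγ hθ (d / a)
  refine represented_of_rep (.C21 i k) ?_ ?_
  · rw [Cls.Valid, hi]
    refine ⟨fun h' => had (div_eq_one.mp h').symm, fun h' => had' ?_⟩
    rw [div_eq_iff_eq_mul] at h'
    simpa using h'
  · have : γ ^ (2 * k + i) = a * d := by
      rw [_root_.zpow_add, zpow_two_mul_eq hk, hi, mul_assoc, mul_div_cancel]
    rw [Cls.rep, this, hk, mat_dg (d := d) (e := -d)] <;> simp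

/-- The diagonal elements without an eigenvalue of multiplicity two on a nondegenerate plane. -/
theorem represented_corner_diag {a b d e : Fˣ} (h : a * e = b * d) (hae : a ≠ e) (hbd : b ≠ d) :
    Represented θ γ (cornerMat a b d e 0 0) := by
  by_cases hab : a = b
  · subst hab
    rw [mul_right_inj] at h
    subst h
    exact represented_corner_pair hE hγ hθ hae
  by_cases had : a = d
  · subst had
    rw [mul_comm, mul_left_inj] at h
    subst h
    exact (represented_corner_pair hE hγ hθ hae).corner_inner
  by_cases hab' : b = -a
  · subst hab'
    have he : e = -d := by
      rw [neg_mul, ← mul_neg, mul_right_inj] at h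
      exact h
    subst he
    exact represented_corner_opposite hE hγ hθ had (Ne.symm hbd)
  by_cases had' : d = -a
  · subst had'
    have he : e = -b := by
      rw [mul_neg, mul_comm b, ← mul_neg, mul_right_inj] at h
      exact h
    subst he
    exact (represented_corner_opposite hE hγ hθ hab hab').corner_inner
  obtain ⟨k, hk⟩ := exists_zpow_eq hE hγ hθ a
  obtain ⟨i, hi⟩ := exists_zpow_eq hE hγ hθ (b / a)
  obtain ⟨j, hj⟩ := exists_zpow_eq hE hγ hθ (d / a)
  have hne : ∀ {y : Fˣ}, a ≠ y → y / a ≠ 1 := fun h h' => h (div_eq_one.mp h').symm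
  have hne' : ∀ {y : Fˣ}, y ≠ -a → y / a ≠ -1 := fun h h' => h (by
    rw [div_eq_iff_eq_mul] at h'
    simpa using h')
  have hb : γ ^ (k + i) = b := by rw [_root_.zpow_add, hk, hi, mul_div_cancel]
  have hc : γ ^ (2 * k + i + j) = b * d := by
    rw [_root_.zpow_add, _root_.zpow_add, zpow_two_mul_eq hk, hi, hj, mul_assoc a,
      mul_div_cancel, mul_right_comm, mul_div_cancel, mul_comm]
  refine represented_of_rep (.C6 i j k) ?_ ?_
  · rw [Cls.Valid, _root_.zpow_add, hi, hj]
    refine ⟨hne hab, hne' hab', hne had, hne' had', fun h' => hbd (div_left_injective h'),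
      fun h' => hae ?_⟩
    rw [div_mul_div_comm, div_eq_one, ← h, mul_right_inj] at h'
    exact h'.symm
  · rw [Cls.rep, hc, hk, hb, mat_dg rfl h.symm]

/-- Elements whose matrix is supported on the two corners and a middle block. -/
theorem represented_corner {a b d e : Fˣ} (h : a * e = b * d) (κ x : F) :
    Represented θ γ (cornerMat a b d e κ x) := by
  by_cases hae : a = e
  · by_cases hbd : b = d
    · subst hae hbd
      have h' : (b : F) * b = a * a := by exact_mod_cast (congrArg Units.val h).symm
      rcases mul_self_eq_mul_self_iff.mp h' with hb | hb
      · obtain rfl : b = a := Units.ext hb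
        exact represented_corner_one hE hγ hθ _ _ _
      · obtain rfl : b = -a := Units.ext hb
        exact represented_corner_neg hE hγ hθ _ _ _
    · subst hae
      refine (Represented.corner_kill hbd ?_)
      refine (represented_corner_middle hE hγ hθ h.symm ?_ ?_ κ).corner_outer
      · rintro rfl
        exact hbd (mul_left_cancel h)
      · rintro rfl
        rw [neg_mul, ← mul_neg, mul_right_inj] at h
        exact hbd (neg_eq_iff_eq_neg.mpr h)
  · by_cases hbd : b = d
    · subst hbd
      refine Represented.corner_kill_outer hae ?_
      refine represented_corner_middle hE hγ hθ h ?_ ?_ x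
      · rintro rfl
        exact hae (mul_left_cancel h).symm
      · rintro rfl
        rw [neg_mul, ← mul_neg, mul_right_inj] at h
        exact hae (neg_eq_iff_eq_neg.mpr h.symm)
    · exact ((represented_corner_diag hE hγ hθ h hae hbd).corner_kill hbd).corner_kill_outer hae

end Corner

/-! ### The classes of elements of the Siegel subgroup with split block -/

section SiegelSplit

variable {F E : Type*} [Field F] [Fintype F] [Field E] [Algebra F E] [FiniteDimensional F E]
  (hE : Module.finrank F E = 2) {θ : Eˣ} {γ : Fˣ}
  (hγ : algebraMap F E (γ : F) = (θ : E) ^ (Fintype.card F + 1))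
  (hq : Odd (Fintype.card F)) (hθ : ∀ x : Eˣ, x ∈ Subgroup.zpowers θ)

include hE hγ hθ

theorem represented_jordan_ne {a d : Fˣ} (had : a ≠ d) : Represented θ γ (jordanMat a d 0) := by
  obtain ⟨k, hk⟩ := exists_zpow_eq hE hγ hθ a
  by_cases h : d = -a
  · refine represented_of_rep (.B51 k) trivial ?_
    rw [Cls.rep, zpow_two_mul_eq hk, hk, mat_jd (d := d)]
    simp [h]
  · obtain ⟨i, hi⟩ := exists_zpow_eq hE hγ hθ (d / a)
    refine represented_of_rep (.C3 i k) ?_ ?_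
    · rw [Cls.Valid, hi]
      refine ⟨fun h' => had (div_eq_one.mp h').symm, fun h' => h ?_⟩
      rw [div_eq_iff_eq_mul] at h'
      simpa using h'
    · have : γ ^ (2 * k + i) = a * d := by
        rw [_root_.zpow_add, zpow_two_mul_eq hk, hi, mul_assoc, mul_div_cancel]
      rw [Cls.rep, this, hk, mat_jd rfl]

include hq

/-- Elements with a scalar block and the same scalar as the other block: the symmetric matrix given
by the upper right block is diagonalized. -/
theorem represented_scalar (a : Fˣ) (p κ x : F) : Represented θ γ
    !![(a : F), 0, p, κ; 0, (a : F), x, p; 0, 0, (a : F), 0; 0, 0, 0, (a : F)] := by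
  have hx0 : ∀ p κ x : F, x ≠ 0 → Represented θ γ
      !![(a : F), 0, p, κ; 0, (a : F), x, p; 0, 0, (a : F), 0; 0, 0, 0, (a : F)] := by
    intro p κ x hx
    refine (represented_corner hE hγ hθ (rfl : a * a = a * a) (κ - p ^ 2 / x) x).of_conj
      (leviUnip (-p / x)) ?_
    rw [mat_leviUnip]
    ext i j
    fin_cases i <;> fin_cases j <;>
      simp [cornerMat, Matrix.mul_apply, Fin.sum_univ_four] <;> field_simp <;> ring
  have hκ0 : ∀ p κ x : F, κ ≠ 0 → Represented θ γ
      !![(a : F), 0, p, κ; 0, (a : F), x, p; 0, 0, (a : F), 0; 0, 0, 0, (a : F)] := by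
    intro p κ x hκ
    refine (hx0 p x κ hκ).of_conj (weylOuter F) ?_
    rw [mat_weylOuter]
    ext i j
    fin_cases i <;> fin_cases j <;>
      simp [Matrix.mul_apply, Fin.sum_univ_four]
  by_cases hx : x = 0
  · by_cases hκ : κ = 0
    · by_cases hp : p = 0
      · subst hx hκ hp
        exact represented_corner hE hγ hθ (rfl : a * a = a * a) 0 0
      · subst hx hκ
        refine (hκ0 p (2 * p) 0 (mul_ne_zero (two_ne_zero_of_odd_card hq) hp)).of_conj
          (leviUnip 1) ?_
        rw [mat_leviUnip]
        ext i j
        fin_cases i <;> fin_cases j <;>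
          simp [Matrix.mul_apply, Fin.sum_univ_four]
        ring
    · exact hκ0 p κ x hκ
  · exact hx0 p κ x hx

/-- If the other diagonal block has the same eigenvalues `a ≠ b`, the unipotent part that cannot be
removed becomes a Jordan block in the Siegel Levi subgroup. -/
theorem represented_siegel_dg (a b c : Fˣ) (μ κ x : F) :
    Represented θ γ (mat (siegelLevi (dg a b) c * siegelUnip μ κ x)) := by
  have ha := a.ne_zero
  have hb := b.ne_zero
  obtain ⟨d, rfl⟩ : ∃ d, c = b * d := ⟨c / b, by simp⟩
  obtain ⟨e, he⟩ : ∃ e, b * d = a * e := ⟨b * d / a, by simp⟩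
  have he' : (b : F) * d = a * e := by exact_mod_cast congrArg Units.val he
  have hmat : mat (siegelLevi (dg a b) (b * d) * siegelUnip μ κ x) =
      !![(a : F), 0, a * μ, a * κ; 0, (b : F), b * x, b * μ; 0, 0, (d : F), 0;
        0, 0, 0, (e : F)] := by
    rw [mat_siegelLevi_mul_siegelUnip]
    simp only [dg_val, Matrix.det_fin_two_of]
    congr 1
    simp
    constructor
    · field_simp
    · field_simp
      linear_combination he'
  rw [hmat]
  by_cases had : a = d
  · subst had
    obtain rfl : b = e := by
      rw [mul_comm, mul_right_inj] at he
      exact he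
    by_cases hab : a = b
    · subst hab
      exact represented_scalar hE hγ hq hθ a _ _ _
    · have h := units_sub_ne_zero hab
      have h' := units_sub_ne_zero (Ne.symm hab)
      have hred : Represented θ γ !![(a : F), 0, a * μ, 0; 0, (b : F), 0, b * μ; 0, 0, (a : F), 0;
          0, 0, 0, (b : F)] := by
        by_cases hμ : μ = 0
        · have := represented_corner hE hγ hθ (mul_comm a b) 0 0
          rwa [hμ, mul_zero, mul_zero]
        · refine (represented_jordan_ne hE hγ hθ hab).of_conj
            (torusElt 1 (Units.mk0 (a * μ) (mul_ne_zero ha hμ)) 1 * weylInner F) ?_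
          rw [mat_mul, mat_torusElt, mat_weylInner]
          ext i j
          fin_cases i <;> fin_cases j <;>
            simp [jordanMat, Matrix.mul_apply, Fin.sum_univ_four] <;> field_simp
      refine hred.of_conj (siegelUnip 0 (a * κ / (a - b)) (b * x / (b - a))) ?_
      rw [mat_siegelUnip]
      ext i j
      fin_cases i <;> fin_cases j <;>
        simp [Matrix.mul_apply, Fin.sum_univ_four] <;> field_simp <;> ring
  · have h := units_sub_ne_zero had
    refine (represented_corner hE hγ hθ he.symm (a * κ) (b * x)).of_conj
      (siegelUnip (a * μ / (a - d)) 0 0) ?_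
    rw [mat_siegelUnip]
    ext i j
    fin_cases i <;> fin_cases j <;>
      simp [cornerMat, Matrix.mul_apply, Fin.sum_univ_four] <;> field_simp
    · ring
    · linear_combination (-μ) * he'

theorem represented_siegel_jd (a c : Fˣ) (μ κ x : F) :
    Represented θ γ (mat (siegelLevi (jd a) c * siegelUnip μ κ x)) := by
  have ha := a.ne_zero
  have h2 := two_ne_zero_of_odd_card hq
  obtain ⟨d, rfl⟩ : ∃ d, c = a * d := ⟨c / a, by simp⟩
  have hmat : mat (siegelLevi (jd a) (a * d) * siegelUnip μ κ x) =
      !![(a : F), 1, a * μ + x, a * κ + μ; 0, (a : F), a * x, a * μ; 0, 0, (d : F), -(d / a);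
        0, 0, 0, (d : F)] := by
    rw [mat_siegelLevi_mul_siegelUnip]
    simp only [jd_val, Matrix.det_fin_two_of]
    congr 1
    simp
    refine ⟨⟨?_, ?_⟩, ?_⟩ <;> field_simp
  rw [hmat]
  by_cases had : a = d
  · subst had
    have hred : Represented θ γ (jordanMat a a x) := by
      by_cases hx : x = 0
      · refine (represented_scalar hE hγ hq hθ a (-1) 0 0).of_conj (weylInner F) ?_
        rw [mat_weylInner, hx]
        ext i j
        fin_cases i <;> fin_cases j <;>
          simp [jordanMat, Matrix.mul_apply, Fin.sum_univ_four]
      · obtain ⟨k, hk⟩ := exists_zpow_eq hE hγ hθ a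
        have hA5 : Represented θ γ (jordanMat a a 1) := by
          refine represented_of_rep (.A5 k) trivial ?_
          rw [Cls.rep, zpow_two_mul_eq hk, hk, mat_jd_unip rfl]
        refine hA5.of_conj (torusElt 1 1 (Units.mk0 x hx)) ?_
        rw [mat_torusElt]
        ext i j
        fin_cases i <;> fin_cases j <;>
          simp [jordanMat, Matrix.mul_apply, Fin.sum_univ_four, ha]
        all_goals ring
    refine hred.of_conj (siegelUnip ((a * κ + μ) / 2) 0 (a * μ)) ?_
    rw [mat_siegelUnip]
    ext i j
    fin_cases i <;> fin_cases j <;>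
      simp [jordanMat, Matrix.mul_apply, Fin.sum_univ_four, ha] <;> field_simp <;> ring
  · have h := units_sub_ne_zero had
    -- the unipotent element solving the linear equations entry by entry
    obtain ⟨y, hy⟩ : ∃ y : F, y * (a - d) = a * x := ⟨a * x / (a - d), by field_simp⟩
    obtain ⟨t, ht⟩ : ∃ t : F, t * (a - d) = a * μ + x - y :=
      ⟨(a * μ + x - y) / (a - d), by field_simp⟩
    obtain ⟨k, hk⟩ : ∃ k : F, k * (a - d) = a * κ + μ - t * (d / a + 1) :=
      ⟨(a * κ + μ - t * (d / a + 1)) / (a - d), by field_simp⟩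
    refine (represented_jordan_ne hE hγ hθ had).of_conj (siegelUnip t k y) ?_
    rw [mat_siegelUnip]
    ext i j
    fin_cases i <;> fin_cases j <;>
      simp [jordanMat, Matrix.mul_apply, Fin.sum_univ_four]
    · linear_combination -ht
    · linear_combination -hk
    · linear_combination -hy
    · field_simp
      linear_combination (-a : F) * ht + hy

end SiegelSplit

/-! ### The classes of elements with an elliptic block -/

section EllipticClasses

variable {F E : Type*} [Field F] [Fintype F] [Field E] [Algebra F E] [FiniteDimensional F E]
  (hE : Module.finrank F E = 2) {θ : Eˣ} {γ : Fˣ}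
  (hγ : algebraMap F E (γ : F) = (θ : E) ^ (Fintype.card F + 1))
  (hq : Odd (Fintype.card F)) (hθ : ∀ x : Eˣ, x ∈ Subgroup.zpowers θ)

theorem Represented.of_conj_symm {M M' : Matrix (Fin 4) (Fin 4) F} (hM' : Represented θ γ M')
    (x : GSp4 F) (h : mat x * M' = M * mat x) : Represented θ γ M := by
  refine hM'.of_conj x⁻¹ ?_
  calc mat x⁻¹ * M = mat x⁻¹ * (M * mat x) * mat x⁻¹ := by
        rw [Matrix.mul_assoc, Matrix.mul_assoc, mat_mul_mat_inv, Matrix.mul_one]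
    _ = M' * mat x⁻¹ := by
        rw [← h, ← Matrix.mul_assoc, mat_inv_mul_mat, Matrix.one_mul]

omit [Fintype F] in
/-- The element `m(w, 2 (a + s))` of the Siegel Levi subgroup with `w = (a + s) + b A`, where
`A² = -N` and `a² + b² N = s²`. As `w² = 2 (a + s) (a + b A)`, it conjugates the unipotent element
of upper right block `1` to that of block `a + b A`. -/
def squareElt {N a b s : F} (hs : a ^ 2 + b ^ 2 * N = s * s) (hs0 : s ≠ 0) (hsa : a + s ≠ 0)
    (h2 : (2 : F) ≠ 0) : GSp4 F :=
  ofMatrix !![a + s, -(b * N), 0, 0; b, a + s, 0, 0; 0, 0, (a + s) / s, b * N / s;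
    0, 0, -(b / s), (a + s) / s] (Units.mk0 (2 * (a + s)) (mul_ne_zero h2 hsa)) (by
    ext i j
    fin_cases i <;> fin_cases j <;>
      simp [J, Matrix.mul_apply, Fin.sum_univ_four] <;> field_simp <;>
      first | ring1 | linear_combination hs | linear_combination -hs)

theorem Represented.ell_square {N : Fˣ} {a b s : F} (hs : a ^ 2 + b ^ 2 * N = s * s)
    (hs0 : s ≠ 0) (hsa : a + s ≠ 0) (h2 : (2 : F) ≠ 0)
    (h : Represented θ γ (ellSiegelMat N (-1) 0 1 0 0)) :
    Represented θ γ (ellSiegelMat N (-1) 0 a (-(b * N)) b) := by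
  refine h.of_conj_symm (squareElt hs hs0 hsa h2) ?_
  rw [squareElt, mat_ofMatrix]
  ext i j
  fin_cases i <;> fin_cases j <;>
    simp [ellSiegelMat, Matrix.mul_apply, Fin.sum_univ_four] <;> field_simp <;>
      first | ring1 | linear_combination hs | linear_combination -hs

include hE hγ hq hθ

/-- Every irreducible quadratic polynomial over `F` has a root in `E`. -/
theorem exists_norm_trace {N : Fˣ} {T : F} (hirr : ∀ s : F, s ^ 2 - T * s + N ≠ 0) :
    ∃ x : Eˣ, x ^ (Fintype.card F - 1) ≠ 1 ∧ normUnit F x = N ∧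
      Algebra.trace F E (x : E) = T := by
  have h2 := two_ne_zero_of_odd_card hq
  have hD : T ^ 2 - 4 * N ≠ 0 := by
    intro h
    apply hirr (T / 2)
    field_simp
    linear_combination -h
  -- the discriminant is a power of `γ = θ^(q+1)`, hence a square in `E`
  obtain ⟨δ, hδ⟩ : ∃ δ : E, δ ^ 2 = algebraMap F E (T ^ 2 - 4 * N) := by
    obtain ⟨j, hj⟩ := exists_zpow_eq hE hγ hθ (Units.mk0 _ hD)
    obtain ⟨m, hm⟩ := hq
    have h1 : up E γ = (θ ^ (m + 1)) ^ 2 := by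
      apply Units.ext
      rw [← pow_mul]
      have : (m + 1) * 2 = Fintype.card F + 1 := by omega
      rw [this, Units.val_pow_eq_pow_val, ← hγ]
      rfl
    refine ⟨(((θ ^ (m + 1)) ^ j : Eˣ) : E), ?_⟩
    rw [← Units.val_pow_eq_pow_val, ← zpow_natCast, ← _root_.zpow_mul, mul_comm j,
      _root_.zpow_mul, zpow_natCast, ← h1]
    have h3 : (up E γ) ^ j = up E (γ ^ j) :=
      (map_zpow (Units.map (algebraMap F E).toMonoidHom) γ j).symm
    rw [h3, hj]
    rfl
  have h2E : (2 : E) ≠ 0 := by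
    rw [← map_ofNat (algebraMap F E)]
    exact (map_ne_zero _).mpr h2
  have hroot : ((algebraMap F E T + δ) / 2) ^ 2 - algebraMap F E T * ((algebraMap F E T + δ) / 2)
      + algebraMap F E N = 0 := by
    rw [map_sub, map_pow, map_mul, map_ofNat] at hδ
    field_simp
    linear_combination hδ
  generalize (algebraMap F E T + δ) / 2 = x at hroot
  have hxF : ∀ s : F, algebraMap F E s ≠ x := by
    rintro s rfl
    apply hirr s
    apply (algebraMap F E).injective
    simpa using hroot
  have hx0 : x ≠ 0 := fun h => hxF 0 (by rw [h, map_zero])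
  have htn : algebraMap F E (T - Algebra.trace F E x) * x
      = algebraMap F E (N - Algebra.norm F x) := by
    rw [map_sub, map_sub, algebraMap_trace hE, algebraMap_norm hE]
    linear_combination -hroot
  have hT : T - Algebra.trace F E x = 0 := by
    by_contra h
    apply hxF ((N - Algebra.norm F x) / (T - Algebra.trace F E x))
    rw [map_div₀, ← htn, mul_div_cancel_left₀ _ ((map_ne_zero _).mpr h)]
  rw [hT, map_zero, zero_mul] at htn
  have hN := (map_eq_zero (algebraMap F E)).mp htn.symm
  refine ⟨Units.mk0 x hx0, fun h => ?_, Units.ext (sub_eq_zero.mp hN).symm,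
    (sub_eq_zero.mp hT).symm⟩
  obtain ⟨k, hk⟩ := exists_up_of_pow_eq_one hE hγ hθ h
  exact hxF _ (congrArg Units.val hk).symm

theorem exists_ellTheta {N : Fˣ} {T : F} (hirr : ∀ s : F, s ^ 2 - T * s + N ≠ 0) :
    ∃ i : ℤ, ellTheta θ γ 0 i = companion N T ∧ γ ^ i = N ∧ eta F θ ^ i ≠ 1 ∧
      (T ≠ 0 → eta F θ ^ i ≠ -1) := by
  obtain ⟨x, hx, hN, hT⟩ := exists_norm_trace hE hγ hq hθ hirr
  obtain ⟨i, rfl⟩ := hθ x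
  simp only at hx hN hT
  have h1 : up E (γ ^ (0 : ℤ)) * θ ^ i = θ ^ i := by rw [_root_.zpow_zero, up_one, one_mul]
  have h2 := pow_card_sub_one_theta (θ := θ) (γ ^ (0 : ℤ)) i
  rw [h1] at h2
  refine ⟨i, ?_, ?_, by rwa [← h2], fun h h' => h ?_⟩
  · rw [ellTheta, h1, ell_eq_companion, hN, hT]
  · rw [← hN, map_zpow, normUnit_generator hE hγ]
  · rw [← hT, trace_eq_zero_iff hE, h2, h']

theorem ellHalf_eq (k : ℤ) : ellHalf θ γ k = companion (-γ ^ (2 * k + 1)) 0 := by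
  rw [ellHalf, ell_eq_companion, normUnit_ellHalf hE hγ hq hθ, _root_.zpow_add, _root_.zpow_one,
    _root_.two_mul, _root_.zpow_add,
    (trace_eq_zero_iff hE).mpr (pow_card_sub_one_ellHalf hE hq hθ _)]

omit hq in
/-- If `X² + N` is irreducible, `-N` is an odd power of `γ`. -/
theorem exists_neg_zpow {N : Fˣ} (hirr : ∀ s : F, s ^ 2 - 0 * s + N ≠ 0) :
    ∃ k : ℤ, N = -γ ^ (2 * k + 1) := by
  obtain ⟨j, hj⟩ := exists_zpow_eq hE hγ hθ (-N)
  rcases Int.even_or_odd' j with ⟨m, rfl | rfl⟩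
  · exfalso
    apply hirr ((γ ^ m : Fˣ) : F)
    have := congrArg Units.val hj
    rw [_root_.two_mul, _root_.zpow_add, Units.val_mul, Units.val_neg] at this
    linear_combination this
  · exact ⟨m, by rw [hj, neg_neg]⟩

/-- Without an eigenvalue in common, the two blocks split. -/
theorem represented_ell_levi {N r : Fˣ} {T : F} (hirr : ∀ s : F, s ^ 2 - T * s + N ≠ 0)
    (h1 : r ≠ 1) (h2 : r = -1 → T ≠ 0) : Represented θ γ (ellSiegelMat N r T 0 0 0) := by
  by_cases hT : T = 0
  · subst hT
    obtain ⟨k, rfl⟩ := exists_neg_zpow hE hγ hθ hirr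
    obtain ⟨i, rfl⟩ := exists_zpow_eq hE hγ hθ r
    refine represented_of_rep (.C22 i k) ⟨h1, fun h => h2 h rfl⟩ ?_
    rw [Cls.rep, ellHalf_eq hE hγ hq hθ, mat_companion]
    rw [mul_neg, ← _root_.zpow_add]
    congr 2
    ring
  · obtain ⟨i, hA, rfl, hi, hi'⟩ := exists_ellTheta hE hγ hq hθ hirr
    by_cases hr : r = -1
    · subst hr
      refine represented_of_rep (.D31 i 0) ⟨hi, hi' hT⟩ ?_
      rw [Cls.rep, hA, mat_companion]
      rw [mul_zero, zero_add, neg_one_mul]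
    · obtain ⟨j, rfl⟩ := exists_zpow_eq hE hγ hθ r
      refine represented_of_rep (.D4 i j 0) ⟨hi, hi' hT, h1, hr⟩ ?_
      rw [Cls.rep, hA, mat_companion]
      rw [mul_zero, zero_add, add_comm, _root_.zpow_add]

/-- Both blocks have the same characteristic polynomial, and a nonzero unipotent part can be scaled
by the torus. -/
theorem represented_ell_one {N : Fˣ} {T : F} (hirr : ∀ s : F, s ^ 2 - T * s + N ≠ 0) (y : F) :
    Represented θ γ (ellSiegelMat N 1 T 0 0 y) := by
  have hscale : y ≠ 0 → Represented θ γ (ellSiegelMat N 1 T 0 0 1) →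
      Represented θ γ (ellSiegelMat N 1 T 0 0 y) := by
    intro hy h
    refine h.of_conj (torusElt 1 1 (Units.mk0 y hy)) ?_
    rw [mat_torusElt]
    ext i j
    fin_cases i <;> fin_cases j <;>
      simp [ellSiegelMat, Matrix.mul_apply, Fin.sum_univ_four, mul_comm]
  by_cases hT : T = 0
  · subst hT
    obtain ⟨k, rfl⟩ := exists_neg_zpow hE hγ hθ hirr
    by_cases hy : y = 0
    · refine represented_of_rep (.B22 k) trivial ?_
      rw [Cls.rep, ellHalf_eq hE hγ hq hθ, mat_companion (one_mul _).symm, hy]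
    · refine hscale hy (represented_of_rep (.B52 k) trivial ?_)
      rw [Cls.rep, ellHalf_eq hE hγ hq hθ, mat_companion_unip (one_mul _).symm]
  · obtain ⟨i, hA, rfl, hi, hi'⟩ := exists_ellTheta hE hγ hq hθ hirr
    have hi0 : γ ^ (2 * 0 + i) = 1 * γ ^ i := by rw [mul_zero, zero_add, one_mul]
    by_cases hy : y = 0
    · refine represented_of_rep (.D2 i 0) ⟨hi, hi' hT⟩ ?_
      rw [Cls.rep, hA, mat_companion hi0, hy]
    · refine hscale hy (represented_of_rep (.D5 i 0) ⟨hi, hi' hT⟩ ?_)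
      rw [Cls.rep, hA, mat_companion_unip hi0]

/-- The case where the two blocks are `A` and `-A'` up to conjugation and `A² = -N`. The upper right
block is then reduced to an element `a + b A` of `F[A]`, which matters up to squares and scalars. -/
theorem represented_ell_neg_one {N : Fˣ} (hirr : ∀ s : F, s ^ 2 - 0 * s + N ≠ 0) (a b : F) :
    Represented θ γ (ellSiegelMat N (-1) 0 a (-(b * N)) b) := by
  obtain ⟨k, hk⟩ := exists_neg_zpow hE hγ hθ hirr
  have h2 := two_ne_zero_of_odd_card hq
  have hc : γ ^ (2 * k + 1) = -1 * N := by rw [hk, neg_one_mul, neg_neg]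
  have hA : ellHalf θ γ k = companion N 0 := by rw [ellHalf_eq hE hγ hq hθ, hk]
  have hc' : ((γ ^ (2 * k + 1) : Fˣ) : F) = -N := by rw [hc]; simp
  by_cases hsq : IsSquare (a ^ 2 + b ^ 2 * N)
  · obtain ⟨r, hr⟩ := hsq
    by_cases hr0 : r = 0
    · have hb : b = 0 := by
        by_contra hb
        apply hirr (a / b)
        field_simp
        rw [hr0] at hr
        linear_combination hr
      have ha : a = 0 := by
        rw [hr0, hb] at hr
        simpa using hr
      refine represented_of_rep (.B12 k) trivial ?_
      rw [Cls.rep, hA, mat_companion hc, ha, hb]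
      simp
    · -- replace `r` by `-r` if necessary
      obtain ⟨s, hs, hs0, hsa⟩ : ∃ s : F, a ^ 2 + b ^ 2 * N = s * s ∧ s ≠ 0 ∧ a + s ≠ 0 := by
        by_cases h : a + r = 0
        · refine ⟨-r, by rw [hr]; ring, neg_ne_zero.mpr hr0, fun h' => hr0 ?_⟩
          have : 2 * r = 0 := by linear_combination h - h'
          simpa [h2] using this
        · exact ⟨r, hr, hr0, h⟩
      have hB43 : Represented θ γ (ellSiegelMat N (-1) 0 1 0 0) := by
        refine represented_of_rep (.B43 k) trivial ?_
        rw [Cls.rep, hA, mat_companion_unip hc]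
      exact hB43.ell_square hs hs0 hsa h2
  · refine represented_of_rep (.B44 k a b) ?_ ?_
    · rw [Cls.Valid, hc']
      rwa [mul_neg, sub_neg_eq_add]
    · rw [Cls.rep, hA, mat_companion_unip hc, hc', mul_neg]

/-- The unipotent part is reduced according to whether the two blocks, with eigenvalues `x`, `x'`
and `r x`, `r x'`, have both eigenvalues in common, for `r = 1` or for `r = -1` and `x' = -x`, or
none. -/
theorem represented_siegel_companion {N : Fˣ} {T : F} (hirr : ∀ s : F, s ^ 2 - T * s + N ≠ 0)
    (c : Fˣ) (μ κ y : F) :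
    Represented θ γ (mat (siegelLevi (companion N T) c * siegelUnip μ κ y)) := by
  have hN := N.ne_zero
  have h2 := two_ne_zero_of_odd_card hq
  obtain ⟨r, hr⟩ : ∃ r, c = r * N := ⟨c / N, by simp⟩
  rw [mat_companion_unip hr]
  by_cases h1 : r = 1
  · subst h1
    refine (represented_ell_one hE hγ hq hθ hirr (y + (κ + T * μ) / N)).of_conj
      (siegelUnip (μ / 2) 0 (-(κ + T * μ) / N)) ?_
    rw [mat_siegelUnip]
    ext i j
    fin_cases i <;> fin_cases j <;>
      simp [ellSiegelMat, Matrix.mul_apply, Fin.sum_univ_four] <;> field_simp <;> ring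
  by_cases h3 : r = -1 ∧ T = 0
  · obtain ⟨rfl, rfl⟩ := h3
    refine (represented_ell_neg_one hE hγ hq hθ hirr μ ((y - κ / N) / 2)).of_conj
      (siegelUnip 0 ((κ + N * y) / 2) 0) ?_
    rw [mat_siegelUnip]
    ext i j
    fin_cases i <;> fin_cases j <;>
      simp [ellSiegelMat, Matrix.mul_apply, Fin.sum_univ_four] <;> field_simp <;> ring
  · have h3' : r = -1 → T ≠ 0 := fun h h' => h3 ⟨h, h'⟩
    have hres := ell_resultant_ne_zero hirr h3'
    have hr1 : (r : F) - 1 ≠ 0 := units_sub_ne_zero h1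
    have hΔ : ((r : F) - 1) * ((1 + r : F) ^ 2 * N - r * T ^ 2) ≠ 0 := mul_ne_zero hr1 hres
    -- conjugation by the unipotent element with parameters `m`, `k`, `z` removes the unipotent part
    -- if these satisfy linear equations; eliminating `z` leaves two equations of determinant `Δ`
    obtain ⟨Q, hQ⟩ : ∃ Q : F, Q = κ + T * μ + r * N * y := ⟨_, rfl⟩
    obtain ⟨Δ, hΔ'⟩ : ∃ Δ : F, Δ = ((r : F) - 1) * ((1 + r : F) ^ 2 * N - r * T ^ 2) := ⟨_, rfl⟩
    rw [← hΔ'] at hΔ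
    obtain ⟨k, hk⟩ : ∃ k : F, k * Δ = -Q * (1 + r) * N - (r - 1) * T * N * μ :=
      ⟨(-Q * (1 + r) * N - (r - 1) * T * N * μ) / Δ, by field_simp⟩
    obtain ⟨m, hm⟩ : ∃ m : F, m * Δ = (r ^ 2 - 1) * N * μ + r * T * Q :=
      ⟨((r ^ 2 - 1) * N * μ + r * T * Q) / Δ, by field_simp⟩
    obtain ⟨z, hz⟩ : ∃ z : F, N * z = N * y + r * k := ⟨y + r * k / N, by field_simp⟩
    have e1 : (r ^ 2 - 1 : F) * k + (r - 1) * T * m = -Q := by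
      apply mul_right_cancel₀ hΔ
      linear_combination (r ^ 2 - 1 : F) * hk + (r - 1) * T * hm + Q * hΔ'
    have e2 : (1 + r : F) * N * m + r * T * k = N * μ := by
      apply mul_right_cancel₀ hΔ
      linear_combination (1 + r : F) * N * hm + r * T * hk - N * μ * hΔ'
    have e3 : (1 + r : F) * m + T * z = μ + T * y := by
      apply mul_left_cancel₀ hN
      linear_combination e2 + T * hz
    refine (represented_ell_levi hE hγ hq hθ hirr h1 h3').of_conj (siegelUnip m k z) ?_
    rw [mat_siegelUnip]
    ext i j
    fin_cases i <;> fin_cases j <;>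
      simp [ellSiegelMat, Matrix.mul_apply, Fin.sum_univ_four]
    · linear_combination hz
    · linear_combination e2
    · linear_combination -e3
    · linear_combination e1 + (r : F) * hz - hQ

/-- Every element of the Siegel subgroup belongs to one of the listed classes. -/
theorem exists_rep_of_mem_siegel {g : GSp4 F} (hg : g ∈ siegel F) :
    ∃ c : Cls F, c.Valid θ γ ∧ IsConj (c.rep θ γ) g := by
  have key : ∀ {A : GL (Fin 2) F}, IsConj A (siegelBlock ⟨g, hg⟩) →
      (∀ (c : Fˣ) (μ κ x : F), Represented θ γ (mat (siegelLevi A c * siegelUnip μ κ x))) →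
      ∃ c : Cls F, c.Valid θ γ ∧ IsConj (c.rep θ γ) g := by
    intro A hA h
    obtain ⟨c, μ, κ, x, hconj⟩ := exists_conj_siegelLevi hg hA
    obtain ⟨C, hC, hC'⟩ := h c μ κ x _ rfl
    exact ⟨C, hC, hC'.trans hconj⟩
  rcases exists_normal_form (siegelBlock ⟨g, hg⟩) with ⟨a, b, h⟩ | ⟨a, h⟩ | ⟨N, T, hirr, h⟩
  · exact key h (represented_siegel_dg hE hγ hq hθ a b)
  · exact key h (represented_siegel_jd hE hγ hq hθ a)
  · exact key h (represented_siegel_companion hE hγ hq hθ hirr)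

end EllipticClasses

/-! ### The classes of elements of the Klingen subgroup -/

section KlingenClasses

variable {F : Type*} [Field F]

theorem klingenLevi_mem_klingen (t : Fˣ) (A : GL (Fin 2) F) : klingenLevi t A ∈ klingen F := by
  rw [mem_klingen_iff]
  simp [klingenLevi, mat_ofMatrix]

theorem klingenBlock_klingenLevi (t : Fˣ) (A : GL (Fin 2) F) :
    klingenBlock ⟨klingenLevi t A, klingenLevi_mem_klingen t A⟩ = A := by
  apply Units.ext
  exact (Matrix.eta_fin_two A.1).symm

/-- Conjugating inside the Klingen subgroup changes the block into any conjugate of it. -/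
theorem exists_conj_klingenLevi {g : GSp4 F} (hg : g ∈ klingen F) {A : GL (Fin 2) F}
    (hA : IsConj A (klingenBlock ⟨g, hg⟩)) :
    ∃ g' : klingen F, klingenBlock g' = A ∧ IsConj (g' : GSp4 F) g := by
  obtain ⟨B, hB⟩ := isConj_iff.mp hA.symm
  obtain ⟨m, hm⟩ : ∃ m : klingen F, klingenBlock m = B :=
    ⟨⟨_, klingenLevi_mem_klingen 1 B⟩, klingenBlock_klingenLevi 1 B⟩
  obtain ⟨g', hg'⟩ : ∃ g' : klingen F, g' = m * ⟨g, hg⟩ * m⁻¹ := ⟨_, rfl⟩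
  refine ⟨g', ?_, IsConj.symm (isConj_iff.mpr ⟨(m : GSp4 F), ?_⟩)⟩
  · rw [hg', map_mul, map_mul, map_inv, hm, hB]
  · rw [hg', Subgroup.coe_mul, Subgroup.coe_mul, Subgroup.coe_inv]

theorem mem_siegel_of_klingenBlock (g : klingen F) (h : (klingenBlock g).1 1 0 = 0) :
    (g : GSp4 F) ∈ siegel F := by
  have h21 : mat (g : GSp4 F) 2 1 = 0 := h
  exact (mem_siegel_iff _).mpr ⟨g.2 (by simp), h21, g.2 (by simp), g.2 (by simp)⟩

/-- The entries not prescribed are determined by the defining relation of `GSp(4)`. -/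
theorem mat_eq_ellKlingenMat {N t : Fˣ} {T : F} (g : klingen F)
    (hA : klingenBlock g = companion N T) (h00 : mat (g : GSp4 F) 0 0 = t)
    (h01 : mat (g : GSp4 F) 0 1 = 0) (h02 : mat (g : GSp4 F) 0 2 = 0) :
    mat (g : GSp4 F) = ellKlingenMat t N T (mat (g : GSp4 F) 0 3 / t) := by
  have hb := congrArg Units.val hA
  have h11 : mat (g : GSp4 F) 1 1 = 0 := congrFun (congrFun hb 0) 0
  have h12 : mat (g : GSp4 F) 1 2 = -N := congrFun (congrFun hb 0) 1
  have h21 : mat (g : GSp4 F) 2 1 = 1 := congrFun (congrFun hb 1) 0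
  have h22 : mat (g : GSp4 F) 2 2 = T := congrFun (congrFun hb 1) 1
  have h10 : mat (g : GSp4 F) 1 0 = 0 := g.2 (by simp)
  have h20 : mat (g : GSp4 F) 2 0 = 0 := g.2 (by simp)
  have h30 : mat (g : GSp4 F) 3 0 = 0 := g.2 (by simp)
  have h31 : mat (g : GSp4 F) 3 1 = 0 := g.2 (by simp)
  have h32 : mat (g : GSp4 F) 3 2 = 0 := g.2 (by simp)
  have ht0 := t.ne_zero
  have hJ := mat_mul_J_mul_transpose (g : GSp4 F)
  generalize ((multiplier (g : GSp4 F) : Fˣ) : F) = c at hJ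
  generalize mat (g : GSp4 F) = M at *
  have f := fun i j => congrFun (congrFun hJ i) j
  have f01 := f 0 1
  have f02 := f 0 2
  have f03 := f 0 3
  have f12 := f 1 2
  clear f hJ hb
  simp [Matrix.mul_apply, Fin.sum_univ_four, J, h00, h01, h02, h10, h20, h30, h31, h32, h11, h12,
    h21, h22] at f01 f02 f03 f12
  have h33 : M 3 3 = N / t := by
    rw [eq_div_iff ht0]
    linear_combination f03 - f12
  ext i j
  fin_cases i <;> fin_cases j <;>
    simp [ellKlingenMat, h00, h01, h02, h10, h20, h30, h31, h32, h11, h12, h21, h22, h33, f01, f02,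
      mul_div_cancel₀]

theorem klingenUnip_mem_klingen (v w : F) : klingenUnip v w ∈ klingen F := by
  rw [mem_klingen_iff]
  simp [mat_klingenUnip]

/-- If the first diagonal entry is not an eigenvalue of the block, the entries to the right of it
can be removed. -/
theorem exists_conj_ellKlingenMat {N : Fˣ} {T : F} (hirr : ∀ s : F, s ^ 2 - T * s + N ≠ 0)
    (g : klingen F) (hA : klingenBlock g = companion N T) :
    ∃ (t : Fˣ) (κ : F) (g' : GSp4 F), mat g' = ellKlingenMat t N T κ ∧ IsConj g' g := by
  obtain ⟨t, ht⟩ : ∃ t : Fˣ, (t : F) = mat (g : GSp4 F) 0 0 := ⟨klingenFst g, rfl⟩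
  have hD := hirr t
  obtain ⟨v, hv⟩ : ∃ v : F, v * ((t : F) ^ 2 - T * t + N)
      = (t - T) * mat (g : GSp4 F) 0 1 + mat (g : GSp4 F) 0 2 :=
    ⟨_, div_mul_cancel₀ _ hD⟩
  obtain ⟨w, hw⟩ : ∃ w : F, w = t * v - mat (g : GSp4 F) 0 1 := ⟨_, rfl⟩
  obtain ⟨u, hu⟩ : ∃ u : klingen F, (u : GSp4 F) = klingenUnip v w :=
    ⟨⟨_, klingenUnip_mem_klingen v w⟩, rfl⟩
  have hu1 : klingenBlock u = 1 := by
    apply Units.ext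
    ext i j
    fin_cases i <;> fin_cases j <;> simp [klingenBlock, hu, mat_klingenUnip]
  obtain ⟨g', hg'⟩ : ∃ g' : klingen F, g' = u * g * u⁻¹ := ⟨_, rfl⟩
  have hA' : klingenBlock g' = companion N T := by
    rw [hg', map_mul, map_mul, map_inv, hu1, hA, one_mul, inv_one, mul_one]
  have hmul : mat (g' : GSp4 F) * mat (klingenUnip v w)
      = mat (klingenUnip v w) * mat (g : GSp4 F) := by
    rw [← mat_mul, ← mat_mul, hg', ← hu, Subgroup.coe_mul, Subgroup.coe_mul, Subgroup.coe_inv,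
      inv_mul_cancel_right]
  have hb := congrArg Units.val hA
  have h11 : mat (g : GSp4 F) 1 1 = 0 := congrFun (congrFun hb 0) 0
  have h12 : mat (g : GSp4 F) 1 2 = -N := congrFun (congrFun hb 0) 1
  have h21 : mat (g : GSp4 F) 2 1 = 1 := congrFun (congrFun hb 1) 0
  have h22 : mat (g : GSp4 F) 2 2 = T := congrFun (congrFun hb 1) 1
  have h10 : mat (g : GSp4 F) 1 0 = 0 := g.2 (by simp)
  have h20 : mat (g : GSp4 F) 2 0 = 0 := g.2 (by simp)
  have h30 : mat (g : GSp4 F) 3 0 = 0 := g.2 (by simp)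
  have h31 : mat (g : GSp4 F) 3 1 = 0 := g.2 (by simp)
  have h32 : mat (g : GSp4 F) 3 2 = 0 := g.2 (by simp)
  rw [mat_klingenUnip] at hmul
  have e00 := congrFun (congrFun hmul 0) 0
  have e01 := congrFun (congrFun hmul 0) 1
  have e02 := congrFun (congrFun hmul 0) 2
  simp [Matrix.mul_apply, Fin.sum_univ_four, h10, h20, h30, h31, h32, h11, h12, h21, h22, ← ht]
    at e00 e01 e02
  rw [e00] at e01 e02
  refine ⟨t, _, g', mat_eq_ellKlingenMat g' hA' e00 ?_ ?_, IsConj.symm (isConj_iff.mpr ⟨u, ?_⟩)⟩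
  · linear_combination e01 + hw
  · linear_combination e02 + (T - t) * hw - hv
  · rw [hg', Subgroup.coe_mul, Subgroup.coe_mul, Subgroup.coe_inv]

end KlingenClasses

section KlingenElliptic

variable {F E : Type*} [Field F] [Fintype F] [Field E] [Algebra F E] [FiniteDimensional F E]
  (hE : Module.finrank F E = 2) {θ : Eˣ} {γ : Fˣ}
  (hγ : algebraMap F E (γ : F) = (θ : E) ^ (Fintype.card F + 1))
  (hq : Odd (Fintype.card F)) (hθ : ∀ x : Eˣ, x ∈ Subgroup.zpowers θ)

/-- A nondegenerate binary quadratic form over a finite field represents every element. -/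
theorem exists_norm_form_eq {N : Fˣ} {T : F} (hq : Odd (Fintype.card F))
    (hirr : ∀ s : F, s ^ 2 - T * s + N ≠ 0) (κ : F) :
    ∃ p r : F, p ^ 2 + p * r * T + r ^ 2 * N = κ := by
  have h2 := two_ne_zero_of_odd_card hq
  have hD : (N : F) - (T / 2) ^ 2 ≠ 0 := by
    intro h
    apply hirr (T / 2)
    field_simp at h ⊢
    linear_combination h
  obtain ⟨a, b, hab⟩ := FiniteField.exists_root_sum_quadratic
    (Polynomial.degree_quadratic (R := F) (a := 1) (b := 0) (c := 0) one_ne_zero)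
    (Polynomial.degree_quadratic (R := F) (a := N - (T / 2) ^ 2) (b := 0) (c := -κ) hD)
    (Nat.odd_iff.mp hq)
  simp at hab
  refine ⟨a - b * T / 2, b, ?_⟩
  field_simp
  field_simp at hab
  linear_combination hab

include hE hγ hq hθ

theorem represented_ellKlingen {N : Fˣ} {T : F} (hirr : ∀ s : F, s ^ 2 - T * s + N ≠ 0)
    (t : Fˣ) (κ : F) : Represented θ γ (ellKlingenMat t N T κ) := by
  have ht := t.ne_zero
  obtain ⟨x, hx, hN, hT⟩ := exists_norm_trace hE hγ hq hθ hirr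
  have hell : ell x = companion N T := by rw [ell_eq_companion, hN, hT]
  obtain ⟨k, hk⟩ := exists_zpow_eq hE hγ hθ t
  by_cases htN : N = t * t
  · have hnorm : normUnit F (x / up E t) = 1 := by
      rw [map_div, normUnit_up hE, hN, htN, pow_two, div_self']
    obtain ⟨i, hi⟩ := exists_eta_zpow hE hθ hnorm
    have hxi : up E (γ ^ k) * eta F θ ^ i = x := by rw [hk, ← hi, mul_div_cancel]
    have hA : ellEta θ γ k i = companion N T := by rw [ellEta, hxi, hell]
    have hp := pow_card_sub_one_eta hγ (γ ^ k) i
    rw [hxi] at hp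
    have hv : eta F θ ^ i ≠ 1 ∧ eta F θ ^ i ≠ -1 := by
      constructor <;> intro h <;> apply hx <;> rw [hp, h] <;> simp
    by_cases hκ : κ = 0
    · refine represented_of_rep (.D6 i k) hv ?_
      rw [Cls.rep, hA, hk, mat_klingen_companion, hκ]
    · have hD8 : Represented θ γ (ellKlingenMat t N T 1) := by
        refine represented_of_rep (.D8 i k) hv ?_
        rw [Cls.rep, hA, hk, mat_klingen_companion_unip]
      -- conjugation by an element of determinant `κ` that commutes with the block
      obtain ⟨p, r, hpr⟩ := exists_norm_form_eq hq hirr κ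
      refine hD8.of_conj (klingenLevi 1 (Matrix.GeneralLinearGroup.mkOfDetNeZero
        !![p, -(r * N); r, p + r * T] ?_)) ?_
      · rw [Matrix.det_fin_two_of]
        intro h
        apply hκ
        linear_combination h - hpr
      · rw [klingenLevi, mat_ofMatrix]
        ext i j
        fin_cases i <;> fin_cases j <;>
          simp [ellKlingenMat, Matrix.mul_apply, Fin.sum_univ_four,
            Matrix.GeneralLinearGroup.mkOfDetNeZero, Matrix.det_fin_two_of]
        all_goals grind
  · have hne : t ≠ N / t := fun h => htN (by rw [eq_div_iff_mul_eq'] at h; exact h.symm)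
    have hsub : (t : F) - N / t ≠ 0 := by
      rw [← Units.val_div_eq_div_val]
      exact units_sub_ne_zero hne
    have hD1 : Represented θ γ (ellKlingenMat t N T 0) := by
      obtain ⟨i, hi⟩ := hθ (x / up E t)
      simp only at hi
      have hxi : up E (γ ^ k) * θ ^ i = x := by rw [hk, hi, mul_div_cancel]
      have hNi := normUnit_theta hE hγ k i
      rw [hxi, hN, hk] at hNi
      refine represented_of_rep (.D1 i k) ⟨?_, fun h => htN ?_⟩ ?_
      · rw [← pow_card_sub_one_theta (γ ^ k) i, hxi]
        exact hx
      · rw [hNi, h, mul_one]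
      · rw [Cls.rep, ellTheta, hxi, hell, hk, mat_klingen_companion]
    obtain ⟨s, hs⟩ : ∃ s : F, s * (t - N / t) = t * κ :=
      ⟨t * κ / (t - N / t), div_mul_cancel₀ _ hsub⟩
    refine hD1.of_conj (siegelUnip 0 s 0) ?_
    rw [mat_siegelUnip]
    ext i j
    fin_cases i <;> fin_cases j <;>
      simp [ellKlingenMat, Matrix.mul_apply, Fin.sum_univ_four]
    linear_combination -hs

/-- Every element of the Klingen subgroup belongs to one of the listed classes. -/
theorem exists_rep_of_mem_klingen {g : GSp4 F} (hg : g ∈ klingen F) :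
    ∃ c : Cls F, c.Valid θ γ ∧ IsConj (c.rep θ γ) g := by
  have key : ∀ {A : GL (Fin 2) F}, IsConj A (klingenBlock ⟨g, hg⟩) → A.1 1 0 = 0 →
      ∃ c : Cls F, c.Valid θ γ ∧ IsConj (c.rep θ γ) g := by
    intro A hA h
    obtain ⟨g', hg', hconj⟩ := exists_conj_klingenLevi hg hA
    obtain ⟨C, hC, hC'⟩ := exists_rep_of_mem_siegel hE hγ hq hθ
      (mem_siegel_of_klingenBlock g' (by rw [hg', h]))
    exact ⟨C, hC, hC'.trans hconj⟩
  rcases exists_normal_form (klingenBlock ⟨g, hg⟩) with ⟨a, b, h⟩ | ⟨a, h⟩ | ⟨N, T, hirr, h⟩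
  · exact key h (by simp [dg_val])
  · exact key h (by simp [jd_val])
  · obtain ⟨g', hg', hconj⟩ := exists_conj_klingenLevi hg h
    obtain ⟨t, κ, g'', hmat, hconj'⟩ := exists_conj_ellKlingenMat hirr g' hg'
    obtain ⟨C, hC, hC'⟩ := represented_ellKlingen hE hγ hq hθ hirr t κ g'' hmat
    exact ⟨C, hC, (hC'.trans hconj').trans hconj⟩

end KlingenElliptic

/-! ### The three tables -/

section Tables

variable {F E V : Type*} [Field F] [Fintype F] [Field E] [Algebra F E] [FiniteDimensional F E]
  [AddCommGroup V] [Module ℂ V]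

section Characters

variable [FiniteDimensional ℂ V] (π : Representation ℂ (GL (Fin 2) F) V)

theorem character_siegelInd (σ : Fˣ →* ℂˣ) (g : GSp4 F) :
    (siegelInd π σ).character g = siegelSum π.character σ g := by
  classical
  rw [siegelInd, isCosetReps_siegelRep.character_coind, siegelSum_eq]
  refine Finset.sum_congr rfl fun i _ => ?_
  split_ifs with h
  · rw [character_twist]
    have := multiplier_conj (siegelRep i) g
    rw [← this]
    rfl
  · rfl

theorem character_klingenInd (χ : Fˣ →* ℂˣ) (g : GSp4 F) :
    (klingenInd χ π).character g = klingenSum χ π.character g := by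
  classical
  rw [klingenInd, isCosetReps_klingenRep.character_coind, klingenSum_eq]
  refine Finset.sum_congr rfl fun i _ => ?_
  split_ifs with h
  · rw [character_twist]
    rfl
  · rfl

end Characters

/-- A character has a table if it has the right values at the representatives and vanishes off the
conjugates of a subgroup all of whose elements are in one of the classes. -/
theorem hasTable_of {θ : Eˣ} {γ : Fˣ} (H : Subgroup (GSp4 F))
    (hH : ∀ g ∈ H, ∃ c : Cls F, c.Valid θ γ ∧ IsConj (c.rep θ γ) g) {W : Type*}
    [AddCommGroup W] [Module ℂ W] (ρ : Representation ℂ (GSp4 F) W) {table : Cls F → ℂ}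
    (h : ∀ c : Cls F, c.Valid θ γ → ρ.character (c.rep θ γ) = table c)
    (h0 : ∀ g, (∀ x, x * g * x⁻¹ ∉ H) → ρ.character g = 0) :
    HasTable θ γ ρ.character table := by
  refine ⟨fun c hc g hg => ?_, fun g hg => h0 g fun x hx => ?_⟩
  · rw [← character_of_isConj ρ hg, h c hc]
  · obtain ⟨c, hc, hconj⟩ := hH _ hx
    exact hg c hc (hconj.trans (IsConj.symm (isConj_iff.mpr ⟨x, rfl⟩)))

end Tables

end GSpFour

end

open GSpFour in
theorem mainTheorem5 {F E V : Type*} [Field F] [Fintype F] [Field E] [Algebra F E]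
    [FiniteDimensional F E] (hq : Odd (Fintype.card F)) (hE : Module.finrank F E = 2)
    (θ : Eˣ) (hθ : ∀ x : Eˣ, x ∈ Subgroup.zpowers θ)
    (γ : Fˣ) (hγ : algebraMap F E (γ : F) = (θ : E) ^ (Fintype.card F + 1))
    [AddCommGroup V] [Module ℂ V] [FiniteDimensional ℂ V]
    (π : Representation ℂ (Matrix.GeneralLinearGroup (Fin 2) F) V) (hπ : π.IsIrreducible)
    (χ₁ χ₂ χ σ : Fˣ →* ℂˣ) :
    HasTable θ γ (borelInd χ₁ χ₂ σ).character (borelTable χ₁ χ₂ σ γ) ∧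
    HasTable θ γ (siegelInd π σ).character (siegelTable π.character σ θ γ) ∧
    HasTable θ γ (klingenInd χ π).character (klingenTable χ π.character θ γ) := by
  have hS := fun g (hg : g ∈ siegel F) => exists_rep_of_mem_siegel hE hγ hq hθ hg
  have hK := fun g (hg : g ∈ klingen F) => exists_rep_of_mem_klingen hE hγ hq hθ hg
  refine ⟨hasTable_of (siegel F) hS _ (fun c hc => ?_) fun g hg => ?_,
    hasTable_of (siegel F) hS _ (fun c hc => ?_) fun g hg => ?_,
    hasTable_of (klingen F) hK _ (fun c hc => ?_) fun g hg => ?_⟩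
  · rw [character_borelInd, siegelSum_rep hE hγ hq hθ (isClassFun_character _) σ c hc,
      siegelTable_principalSeries hE χ₁ χ₂ σ hq hθ c hc]
  · rw [character_borelInd, siegelSum_eq_zero _ _ _ hg]
  · rw [character_siegelInd, siegelSum_rep hE hγ hq hθ (isClassFun_character _) σ c hc]
  · rw [character_siegelInd, siegelSum_eq_zero _ _ _ hg]
  · rw [character_klingenInd, klingenSum_rep hE χ _ hγ hq hθ (isClassFun_character _) c hc]
  · rw [character_klingenInd, klingenSum_eq_zero _ _ _ hg]
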